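/- Let $k$ be an algebraically closed field of characteristic $0$, endowed with the trivial derivation, and let $\mathcal U$ be a saturated differentially closed field (of characteristic $0$) extending $k$, with $|\mathcal U|>|k|$. Let $X$ be a smooth irreducible algebraic variety (reduced, separated and of finite type) over $k$ with $\dim X\ge 2$, and let $v$ be a global regular vector field on $X$, that is, a $k$-derivation $\delta_v$ of $\mathcal O_X$. A closed subvariety $Z\subseteq X$ is invariant if its ideal sheaf satisfies $\delta_v(\mathcal I_Z)\subseteq\mathcal I_Z$. Let $\mathrm{Sing}(v)\subseteq X(k)$ be the set of points at which $v$ vanishes, and let $$(X,v)^{\mathcal U}=\{x\in X(\mathcal U) : f(x)'=\delta_v(f)(x)\text{ for every regular function } f \text{ defined around } x\}$$ be the solution set of $(X,v)$ in $\mathcal U$. Assume that (*) $(X,v)$ does not admit any proper positive-dimensional invariant closed subvariety. Then: (i) $\mathrm{Sing}(v)$ is finite. Moreover, there is a unique complete type $p$ over $k$ (in the theory $\mathrm{DCF}_0$) realized by some $x\in (X,v)^{\mathcal U}$ with $\operatorname{trdeg}(k\langle x\rangle/k)=\dim X$, where $k\langle x\rangle$ is the differential field generated by $x$ over $k$; it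 is called the generic type of $(X,v)$. It satisfies: (ii) $(X,v)^{\mathcal U}=\mathrm{Sing}(v)\cup p(\mathcal U)$, where $p(\mathcal U)$ is the set of realizations of $p$ in $\mathcal U$. (iii) $(X,v)^{\mathcal U}$ is strongly minimal if and only if $p$ is a minimal type. Here $(X,v)^{\mathcal U}$ is strongly minimal if it is infinite and each of its subsets definable with parameters from $\mathcal U$ is finite or cofinite in it; $p$ is minimal if it is not algebraic and every forking extension of $p$ to a set of parameters of cardinality less than $|\mathcal U|$ is algebraic (a type is algebraic if it contains a formula with finitely many solutions). -/

import Mathlib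

universe u

open CategoryTheory AlgebraicGeometry TopologicalSpace
open scoped Differential

noncomputable section

namespace DiffAlg

/-! ### The language of differential rings and differentially closed fields -/

/-- Function symbols of the language of differential rings. -/
inductive DiffRingFunc : ℕ → Type
  | zero : DiffRingFunc 0
  | one : DiffRingFunc 0
  | neg : DiffRingFunc 1
  | add : DiffRingFunc 2
  | mul : DiffRingFunc 2
  | der : DiffRingFunc 1

/-- The language `(0, 1, -, +, ·, ′)` of differential rings. -/
def diffRing : FirstOrder.Language.{0, 0} := ⟨DiffRingFunc, fun _ => Empty⟩

/-- A differential ring is a structure in the language of differential rings. -/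
instance structureOfDifferential (R : Type*) [CommRing R] [Differential R] :
    diffRing.Structure R where
  funMap f a := match f, a with
    | DiffRingFunc.zero, _ => 0
    | DiffRingFunc.one, _ => 1
    | DiffRingFunc.neg, a => - a 0
    | DiffRingFunc.add, a => a 0 + a 1
    | DiffRingFunc.mul, a => a 0 * a 1
    | DiffRingFunc.der, a => Differential.deriv (a 0)
  RelMap r := Empty.elim r

/-- The value at `a` of a differential polynomial in one indeterminate; the variable `i` stands for
the `i`-th derivative of the indeterminate. -/
def diffEval {F : Type*} [Field F] [Differential F] (a : F) (f : MvPolynomial ℕ F) : F :=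
  MvPolynomial.eval (fun i => (Differential.deriv : Derivation ℤ F F)^[i] a) f

/-- Differentially closed fields (of characteristic zero): if `f` and `g` are differential
polynomials in one indeterminate, `g ≠ 0` and the order of `f` (here called `n`) is larger than the
order of `g`, then there is `a` with `f(a) = 0` and `g(a) ≠ 0`. -/
def IsDifferentiallyClosed (F : Type*) [Field F] [Differential F] : Prop :=
  CharZero F ∧ ∀ (n : ℕ) (f g : MvPolynomial ℕ F),
    n ∈ f.vars → (∀ i ∈ f.vars, i ≤ n) → g ≠ 0 → (∀ i ∈ g.vars, i < n) →
      ∃ a : F, diffEval a f = 0 ∧ diffEval a g ≠ 0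

/-- Saturation: over a parameter set of cardinality less than that of the structure, every
finitely satisfiable family of definable sets (in finitely many variables) has a common point. -/
def IsSaturated (F : Type u) [Field F] [Differential F] : Prop :=
  ∀ A : Set F, Cardinal.mk A < Cardinal.mk F → ∀ (n : ℕ) (S : Set (Set (Fin n → F))),
    (∀ E ∈ S, A.Definable diffRing E) →
    (∀ T ⊆ S, T.Finite → (⋂₀ T).Nonempty) → (⋂₀ S).Nonempty

/-- Two tuples have the same complete type over `A`. -/
def SameType {F : Type*} [Field F] [Differential F] (A : Set F) {m : ℕ} (b c : Fin m → F) : Prop :=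
  ∀ E : Set (Fin m → F), A.Definable diffRing E → (b ∈ E ↔ c ∈ E)

/-! ### Smooth irreducible varieties and vector fields -/

/-- A smooth irreducible algebraic variety over `k`. -/
structure SmoothVariety (k : Type u) [Field k] where
  /-- the underlying scheme -/
  scheme : Scheme.{u}
  /-- the structure morphism -/
  str : scheme ⟶ Spec (CommRingCat.of k)
  isIntegral : IsIntegral scheme
  isSeparated : IsSeparated str
  quasiCompact : QuasiCompact str
  locallyOfFiniteType : LocallyOfFiniteType str
  smooth : Smooth str

variable {k : Type u} [Field k]

/-- The constants of `k`, seen as regular functions on an open subset. -/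
def SmoothVariety.const (X : SmoothVariety k) (V : X.scheme.Opens) :
    CommRingCat.of k ⟶ Γ(X.scheme, V) :=
  (Scheme.ΓSpecIso (CommRingCat.of k)).inv ≫ X.str.appTop ≫
    X.scheme.presheaf.map (homOfLE le_top).op

/-- A (global, regular) vector field on `X`, that is, a `k`-derivation of the structure sheaf. -/
structure VectorField (X : SmoothVariety k) where
  /-- the derivation on sections over an open subset -/
  der : ∀ V : X.scheme.Opens, Γ(X.scheme, V) →+ Γ(X.scheme, V)
  leibniz : ∀ (V : X.scheme.Opens) (f g : Γ(X.scheme, V)),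
    der V (f * g) = f * der V g + g * der V f
  map_const : ∀ (V : X.scheme.Opens) (c : k), der V (X.const V c) = 0
  map_res : ∀ (V W : X.scheme.Opens) (h : V ≤ W) (f : Γ(X.scheme, W)),
    der V (X.scheme.presheaf.map (homOfLE h).op f) = X.scheme.presheaf.map (homOfLE h).op (der W f)

/-- The section `f` over `V` belongs to the ideal sheaf of the (reduced) closed subset `Z`. -/
def VanishesOn (X : SmoothVariety k) (Z : Set X.scheme) (V : X.scheme.Opens)
    (f : Γ(X.scheme, V)) : Prop :=
  ∀ (z : X.scheme) (hz : z ∈ V), z ∈ Z → X.scheme.evaluation V z hz f = 0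

/-- `Z` is a closed invariant subvariety of `(X, v)`: a closed subset whose ideal sheaf is stable
under the derivation `v`. -/
def VectorField.IsClosedInvariant {X : SmoothVariety k} (v : VectorField X)
    (Z : Set X.scheme) : Prop :=
  IsClosed Z ∧ ∀ (V : X.scheme.Opens) (f : Γ(X.scheme, V)),
    VanishesOn X Z V f → VanishesOn X Z V (v.der V f)

/-! ### Points, singular points and solutions -/

/-- The set `X(K)` of `K`-points of `X`, for a field extension `K` of `k`. -/
def Point (X : SmoothVariety k) (K : Type u) [Field K] [Algebra k K] : Type u :=
  {x : Spec (CommRingCat.of K) ⟶ X.scheme //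
    x ≫ X.str = Spec.map (CommRingCat.ofHom (algebraMap k K))}

section Points

variable {X : SmoothVariety k} {K : Type u} [Field K] [Algebra k K]

/-- The scheme-theoretic point underlying a `K`-point. -/
def Point.pt (x : Point X K) : X.scheme := x.1 (IsLocalRing.closedPoint K)

/-- The value in `K` of germs of regular functions at a `K`-point. -/
def Point.stalkEval (x : Point X K) : X.scheme.presheaf.stalk x.pt →+* K :=
  (Scheme.stalkClosedPointTo x.1).hom

/-- The value `f(x)` of a regular function, defined on an open set containing `x`. -/
def Point.eval (x : Point X K) (V : X.scheme.Opens) (hx : x.pt ∈ V) (f : Γ(X.scheme, V)) : K :=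
  x.stalkEval (X.scheme.presheaf.germ V x.pt hx f)

/-- The inclusion of `X(k)` in `X(K)`. -/
def Point.extend (K : Type u) [Field K] [Algebra k K] (x : Point X k) : Point X K :=
  ⟨Spec.map (CommRingCat.ofHom (algebraMap k K)) ≫ x.1, by
    rw [Category.assoc, x.2, ← Spec.map_comp]
    rfl⟩

end Points

/-- The set of singular points of `v`: the points of `X(k)` at which `v` vanishes. -/
def VectorField.sing {X : SmoothVariety k} (v : VectorField X) : Set (Point X k) :=
  {x | ∀ (V : X.scheme.Opens) (hx : x.pt ∈ V) (f : Γ(X.scheme, V)), x.eval V hx (v.der V f) = 0}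

variable {U : Type u} [Field U] [Differential U] [Algebra k U]

/-- The solution set of `(X, v)` in `U`: the points `x ∈ X(U)` with `(f(x))′ = v(f)(x)` for all
regular functions `f` defined around `x`. -/
def VectorField.solutions {X : SmoothVariety k} (v : VectorField X) (U : Type u) [Field U]
    [Differential U] [Algebra k U] : Set (Point X U) :=
  {x | ∀ (V : X.scheme.Opens) (hx : x.pt ∈ V) (f : Γ(X.scheme, V)),
    (x.eval V hx f)′ = x.eval V hx (v.der V f)}

/-- The differential field `k⟨x⟩` generated over `k` by the coordinates of `x ∈ X(U)`. -/
def Point.diffField {X : SmoothVariety k} (x : Point X U) : IntermediateField k U :=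
  sInf {L : IntermediateField k U | Set.range x.stalkEval ⊆ L ∧ ∀ a ∈ L, a′ ∈ L}

/-! ### Definable sets and complete types on `X(U)`

All parameter sets `A ⊆ U` below are meant to contain (the image of) `k`. -/

/-- A subset of `X(U) × U^m` is definable over `A` if it is a finite union of sets
`{(x, b) | x ∈ V, (f₁(x), …, f_N(x), b) ∈ E}` with `V` open in `X`, the `f_j` regular on `V` and `E`
definable over `A` in the language of differential rings. -/
def IsDefinableRel {X : SmoothVariety k} (A : Set U) {m : ℕ}
    (R : Set (Point X U × (Fin m → U))) : Prop :=
  ∃ (r : ℕ) (V : Fin r → X.scheme.Opens) (N : Fin r → ℕ)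
    (f : ∀ i, Fin (N i) → Γ(X.scheme, V i)) (E : ∀ i, Set (Fin (N i) ⊕ Fin m → U)),
    (∀ i, A.Definable diffRing (E i)) ∧
    ∀ (x : Point X U) (b : Fin m → U), (x, b) ∈ R ↔
      ∃ (i : Fin r) (hx : x.pt ∈ V i), Sum.elim (fun j => x.eval (V i) hx (f i j)) b ∈ E i

/-- Subsets of `X(U)` definable over `A`. -/
def IsDefinable {X : SmoothVariety k} (A : Set U) (D : Set (Point X U)) : Prop :=
  IsDefinableRel A {q : Point X U × (Fin 0 → U) | q.1 ∈ D}

/-- A complete type over `A` living on `X`: an ultrafilter in the Boolean algebra of the `A`-definable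
subsets of `X(U)`. -/
structure CompleteType (X : SmoothVariety k) (A : Set U) where
  /-- the definable sets that belong to the type -/
  sets : Set (Set (Point X U))
  definable : ∀ D ∈ sets, IsDefinable A D
  univ_mem : Set.univ ∈ sets
  empty_notMem : ∅ ∉ sets
  inter_mem : ∀ D ∈ sets, ∀ E ∈ sets, D ∩ E ∈ sets
  mem_or_compl_mem : ∀ D, IsDefinable A D → D ∈ sets ∨ Dᶜ ∈ sets

variable {X : SmoothVariety k}

/-- The set `p(U)` of realizations of a type in `U`. -/
def CompleteType.realizations {A : Set U} (p : CompleteType X A) : Set (Point X U) :=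
  {x | ∀ D ∈ p.sets, x ∈ D}

/-- A type is algebraic if it contains a finite definable set. -/
def CompleteType.IsAlgebraic {A : Set U} (p : CompleteType X A) : Prop :=
  ∃ D ∈ p.sets, D.Finite

/-- `D` divides over `A`: it is the fiber `R_b` of an `A`-definable family and there are infinitely
many conjugates `c_i` of `b` over `A` such that any `r` of the sets `R_{c_i}` have empty
intersection, for some `r`. -/
def Divides (A : Set U) (D : Set (Point X U)) : Prop :=
  ∃ (m : ℕ) (R : Set (Point X U × (Fin m → U))) (b : Fin m → U),
    IsDefinableRel A R ∧ D = {x | (x, b) ∈ R} ∧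
    ∃ (c : ℕ → Fin m → U) (r : ℕ), (∀ i, SameType A b (c i)) ∧
      ∀ s : Finset ℕ, s.card = r → (⋂ i ∈ s, {x | (x, c i) ∈ R}) = ∅

/-- A type forks over `A` if it implies a finite disjunction of formulas dividing over `A`. -/
def CompleteType.ForksOver {B : Set U} (q : CompleteType X B) (A : Set U) : Prop :=
  ∃ D ∈ q.sets, ∃ (N : ℕ) (F : Fin N → Set (Point X U)),
    (∀ i, Divides A (F i)) ∧ D ⊆ ⋃ i, F i

/-- A type over `A` is minimal if it is not algebraic and all its forking extensions (over small
sets of parameters) are algebraic. -/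
def CompleteType.IsMinimal {A : Set U} (p : CompleteType X A) : Prop :=
  ¬ p.IsAlgebraic ∧ ∀ B : Set U, A ⊆ B → Cardinal.mk B < Cardinal.mk U →
    ∀ q : CompleteType X B, p.sets ⊆ q.sets → q.ForksOver A → q.IsAlgebraic

/-- A definable set (in a saturated structure) is strongly minimal if it is infinite and each of its
subsets that are definable with parameters is finite or cofinite in it. -/
def IsStronglyMinimal (S : Set (Point X U)) : Prop :=
  IsDefinable (Set.univ : Set U) S ∧ S.Infinite ∧
    ∀ D ⊆ S, IsDefinable (Set.univ : Set U) D → D.Finite ∨ (S \ D).Finite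

/-- The type `p` over `k` is the generic type of `(X, v)`: it is the type of a solution `x` such that
the transcendence degree of `k⟨x⟩` over `k` is the dimension of `X`. -/
def VectorField.IsGenericType (v : VectorField X)
    (p : CompleteType X (Set.range (algebraMap k U))) : Prop :=
  ∃ x ∈ p.realizations, x ∈ v.solutions U ∧
    ((Cardinal.toENat (Algebra.trdeg k x.diffField) : ℕ∞) : WithBot ℕ∞) =
      topologicalKrullDim X.scheme

end DiffAlg

end

/-! The closure of the scheme-theoretic point under a solution is invariant
(`isClosedInvariant_closure`). Hence (*) leaves two cases: that point is the generic point of `X`,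
or it is closed, so it is a `k`-point, and constancy of its coordinates makes it a zero of `v`. The
zero locus of `v` is itself invariant. It is not all of `X`, since otherwise every closed subset
would be invariant and `dim X ≥ 2` would provide a proper one of positive dimension. So it has
dimension at most 0, and it is finite.

Generic solutions are the same thing as differential `k`-embeddings of the function field `k(X)`
into `U` (`VectorField.DiffEmb`). They exist because `U` is saturated and differentially closed, and
any two have the same type over `k` by quantifier elimination. This yields the unique generic type
and the decomposition of the solution set. Quantifier elimination comes from a back-and-forth
argument: an embedding of a small differential field into `U` extends to one more element
(`PartialEmb.exists_extension`), so partial embeddings of `U` into itself are elementary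
(`PartialEmb.realize_iff`).

Strong minimality implies minimality: if a set dividing over `k` were cofinite in the solution set,
so would be its conjugates, and any `r` of them would meet. So dividing sets, and therefore forking
formulas, have finitely many solutions in it.

Conversely, let `L` be a small differential field containing `k`. A nontrivial relation `∑ b i * φ
(g i) = 0`, with `b` in `L` linearly independent over `k`, defines a set dividing over `k`: since `U
⊗[k] U` is a domain, `b` has infinitely many conjugates any `n` of which are linearly independent
over `U` (`exists_seq_sameType`), and a nonzero linear form cannot kill `n` of them. Under
minimality, a generic solution whose type over `L` is not algebraic therefore makes `L ⊗[k] k(X) →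
U` injective, and this determines its type over `L`. A subset defined over `L`, infinite and
coinfinite in the solution set, would separate two such solutions. -/

noncomputable section

namespace DiffAlg

open Cardinal

/-! ### Partial embeddings of differential fields -/

section PartialEmbeddings

variable {F U : Type u} [Field F] [Differential F] [Field U] [Differential U]

/-- A differential embedding into `U` of a small differential subfield of `F`. -/
structure PartialEmb (F U : Type u) [Field F] [Differential F] [Field U] [Differential U] where
  /-- the domain -/
  dom : Subfield F
  /-- the embedding -/
  hom : dom →+* U
  deriv_mem : ∀ x ∈ dom, x′ ∈ dom
  comm : ∀ x : dom, hom ⟨(x : F)′, deriv_mem x x.2⟩ = ((hom x)′)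
  small : #dom < #U

/-- The order of extension of partial embeddings. -/
def PartialEmb.Extends (e' e : PartialEmb F U) : Prop :=
  ∀ x : e.dom, ∃ h : (x : F) ∈ e'.dom, e'.hom ⟨x, h⟩ = e.hom x

lemma PartialEmb.Extends.refl (e : PartialEmb F U) : e.Extends e := fun x => ⟨x.2, rfl⟩

lemma PartialEmb.Extends.trans {e₁ e₂ e₃ : PartialEmb F U} (h : e₁.Extends e₂)
    (h' : e₂.Extends e₃) : e₁.Extends e₃ := fun x => by
  obtain ⟨h1, h2⟩ := h' x
  obtain ⟨h3, h4⟩ := h ⟨x, h1⟩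
  exact ⟨h3, h4.trans h2⟩

/-- The elements of `P` whose images under two ring homomorphisms into differential fields have
derivatives coming from a common element of `P`. -/
def commonDerivSubfield {P : Type*} [Field P] (α : P →+* F) (β : P →+* U) : Subfield P where
  carrier := {p | ∃ q, (α p)′ = α q ∧ (β p)′ = β q}
  mul_mem' := by
    rintro a b ⟨q, h1, h2⟩ ⟨r, h3, h4⟩
    exact ⟨a * r + b * q, by simp [Derivation.leibniz, h1, h3], by simp [Derivation.leibniz, h2, h4]⟩
  one_mem' := ⟨0, by simp, by simp⟩
  add_mem' := by
    rintro a b ⟨q, h1, h2⟩ ⟨r, h3, h4⟩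
    exact ⟨q + r, by simp [h1, h3], by simp [h2, h4]⟩
  zero_mem' := ⟨0, by simp, by simp⟩
  neg_mem' := by
    rintro a ⟨q, h1, h2⟩
    exact ⟨-q, by simp [h1], by simp [h2]⟩
  inv_mem' := by
    rintro a ⟨q, h1, h2⟩
    exact ⟨-a⁻¹ ^ 2 * q, by simp [Derivation.leibniz_inv, h1], by simp [Derivation.leibniz_inv, h2]⟩

lemma mem_commonDerivSubfield {P : Type*} [Field P] {α : P →+* F} {β : P →+* U} {p : P} :
    p ∈ commonDerivSubfield α β ↔ ∃ q, (α p)′ = α q ∧ (β p)′ = β q := Iff.rfl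

/-- This is the chain rule; `q` is the value at `x` of the polynomial with differentiated
coefficients. The point is that one `q` serves both maps. -/
lemma deriv_eval₂_of_mem {E P : Type*} [Field E] [Field P] {α : P →+* F} {β : P →+* U}
    (ι : E →+* P) (hι : ∀ c, ι c ∈ commonDerivSubfield α β) (x : P) (m : Polynomial E) :
    ∃ q : P, (α (m.eval₂ ι x))′ = α q + α (m.derivative.eval₂ ι x) * (α x)′ ∧
      (β (m.eval₂ ι x))′ = β q + β (m.derivative.eval₂ ι x) * (β x)′ := by
  induction m using Polynomial.induction_on' with
  | add p q hp hq =>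
    obtain ⟨r, h1, h2⟩ := hp
    obtain ⟨s, h3, h4⟩ := hq
    refine ⟨r + s, ?_, ?_⟩ <;>
      simp only [Polynomial.eval₂_add, map_add, h1, h2, h3, h4] <;> ring
  | monomial n c =>
    obtain ⟨q, h1, h2⟩ := hι c
    refine ⟨q * x ^ n, ?_, ?_⟩ <;>
      simp [Polynomial.eval₂_monomial, Polynomial.derivative_monomial, Derivation.leibniz,
        Derivation.leibniz_pow, h1, h2] <;> ring

/-- Differentiating `m(x) = 0` expresses the derivative of a simple root as a quotient with
denominator `m'(x)`. The same formula holds on both sides, so derivatives extend uniquely along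
separable extensions. -/
lemma mem_commonDerivSubfield_of_root {E P : Type*} [Field E] [Field P] {α : P →+* F} {β : P →+* U}
    (ι : E →+* P) (hι : ∀ c, ι c ∈ commonDerivSubfield α β) (x : P) (m : Polynomial E)
    (h0 : m.eval₂ ι x = 0) (h1 : m.derivative.eval₂ ι x ≠ 0) : x ∈ commonDerivSubfield α β := by
  obtain ⟨q, h2, h3⟩ := deriv_eval₂_of_mem ι hι x m
  set s := m.derivative.eval₂ ι x
  simp only [h0, map_zero] at h2 h3
  refine ⟨-q / s, ?_, ?_⟩
  · have : α s ≠ 0 := by simpa using h1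
    simp only [map_div₀, map_neg]
    rw [eq_div_iff this]
    linear_combination -h2
  · have : β s ≠ 0 := by simpa using h1
    simp only [map_div₀, map_neg]
    rw [eq_div_iff this]
    linear_combination -h3

/-- No derivation is needed on `P`: common preimages of derivatives give at once the stability of
`α(P)` and the compatibility of `β ∘ α⁻¹` with derivatives. -/
lemma exists_partialEmb_of_field {P : Type u} [Field P] (α : P →+* F) (β : P →+* U)
    (hd : ∀ p, p ∈ commonDerivSubfield α β) (hP : #P < #U) :
    ∃ e : PartialEmb F U, e.dom = α.fieldRange ∧
      ∀ p, ∃ h : α p ∈ e.dom, e.hom ⟨α p, h⟩ = β p := by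
  let ε : P ≃+* α.fieldRange := RingEquiv.ofBijective α.rangeRestrictField
    ⟨α.rangeRestrictField.injective, fun ⟨_, p, hp⟩ => ⟨p, Subtype.ext hp⟩⟩
  have hε : ∀ p (y : α.fieldRange), (y : F) = α p → β (ε.symm y) = β p := fun p y hy => by
    rw [(RingEquiv.symm_apply_eq ε).2 (Subtype.ext hy)]
  refine ⟨⟨α.fieldRange, β.comp ε.symm.toRingHom, ?_, ?_, ?_⟩, rfl, ?_⟩
  · rintro _ ⟨p, rfl⟩
    obtain ⟨q, h, -⟩ := hd p
    exact ⟨q, h.symm⟩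
  · rintro ⟨_, p, rfl⟩
    obtain ⟨q, h, h'⟩ := hd p
    refine (hε q _ h).trans ?_
    rw [← h']
    exact congrArg _ (hε p _ rfl).symm
  · exact (Cardinal.mk_congr ε.toEquiv).symm.trans_lt hP
  · intro p
    exact ⟨⟨p, rfl⟩, hε p _ rfl⟩

/-- Two ring homomorphisms into differential fields with the same kernel and compatible with
derivations give rise to a partial embedding. -/
lemma exists_partialEmb {P : Type u} [CommRing P] (α : P →+* F) (β : P →+* U)
    (hker : ∀ p, α p = 0 ↔ β p = 0) (hd : ∀ p, ∃ q, (α p)′ = α q ∧ (β p)′ = β q) (hP : #P < #U) :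
    ∃ e : PartialEmb F U, ∀ p, ∃ h : α p ∈ e.dom, e.hom ⟨α p, h⟩ = β p := by
  -- Since the kernels agree, both maps factor injectively through this domain, hence through its
  -- fraction field.
  let Q := P ⧸ RingHom.ker α
  have : IsDomain Q := (Ideal.Quotient.isDomain_iff_prime _).2 (RingHom.ker_isPrime α)
  let α₁ : Q →+* F := Ideal.Quotient.lift _ α fun a ha => ha
  let β₁ : Q →+* U := Ideal.Quotient.lift _ β fun a ha => (hker a).1 ha
  have hα₁ : Function.Injective α₁ := by
    rw [injective_iff_map_eq_zero]
    intro a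
    obtain ⟨a, rfl⟩ := Ideal.Quotient.mk_surjective a
    exact fun h => Ideal.Quotient.eq_zero_iff_mem.2 h
  have hβ₁ : Function.Injective β₁ := by
    rw [injective_iff_map_eq_zero]
    intro a
    obtain ⟨a, rfl⟩ := Ideal.Quotient.mk_surjective a
    exact fun h => Ideal.Quotient.eq_zero_iff_mem.2 ((hker a).2 h)
  let α₂ : FractionRing Q →+* F := IsFractionRing.lift hα₁
  let β₂ : FractionRing Q →+* U := IsFractionRing.lift hβ₁
  have h1 : ∀ p : P, α₂ (algebraMap Q _ (Ideal.Quotient.mk _ p)) = α p := fun p =>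
    IsFractionRing.lift_algebraMap hα₁ _
  have h2 : ∀ p : P, β₂ (algebraMap Q _ (Ideal.Quotient.mk _ p)) = β p := fun p =>
    IsFractionRing.lift_algebraMap hβ₁ _
  have h3 : ∀ p : P, algebraMap Q (FractionRing Q) (Ideal.Quotient.mk _ p) ∈
      commonDerivSubfield α₂ β₂ := fun p => by
    obtain ⟨q, h, h'⟩ := hd p
    exact ⟨algebraMap Q _ (Ideal.Quotient.mk _ q), by rw [h1, h1, h], by rw [h2, h2, h']⟩
  obtain ⟨e, -, he⟩ := exists_partialEmb_of_field α₂ β₂ (fun x => by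
    obtain ⟨a, b, -, rfl⟩ := IsFractionRing.div_surjective (A := Q) x
    obtain ⟨a, rfl⟩ := Ideal.Quotient.mk_surjective a
    obtain ⟨b, rfl⟩ := Ideal.Quotient.mk_surjective b
    exact div_mem (h3 a) (h3 b)) (by
    rw [Cardinal.mk_fractionRing]
    exact (Cardinal.mk_le_of_surjective Ideal.Quotient.mk_surjective).trans_lt hP)
  refine ⟨e, fun p => ?_⟩
  obtain ⟨h, h'⟩ := he (algebraMap Q _ (Ideal.Quotient.mk _ p))
  simp only [h1, h2] at h h'
  exact ⟨h, h'⟩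

/-- The inverse of a partial embedding. -/
lemma PartialEmb.exists_inverse (e : PartialEmb F U) (hFU : #U = #F) :
    ∃ e' : PartialEmb U F, ∀ x : e.dom, ∃ h : e.hom x ∈ e'.dom, e'.hom ⟨e.hom x, h⟩ = x := by
  obtain ⟨e', -, h⟩ := exists_partialEmb_of_field e.hom e.dom.subtype
    (fun x => ⟨⟨(x : F)′, e.deriv_mem x x.2⟩, (e.comm x).symm, rfl⟩) (e.small.trans_eq hFU)
  exact ⟨e', h⟩

end PartialEmbeddings

/-! ### Definability of zero loci of differential polynomials -/

section Definability

variable {U : Type u} [Field U] [Differential U] {A : Set U} {ι : Type*}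

lemma definableFun_add {f g : (ι → U) → U} (hf : A.DefinableFun diffRing f)
    (hg : A.DefinableFun diffRing g) : A.DefinableFun diffRing fun v => f v + g v := by
  have := Set.DefinableFun.comp (L := diffRing) (A := A) (f := fun w : Fin 2 → U => w 0 + w 1)
    (g := fun v => ![f v, g v]) (fun i => by fin_cases i <;> assumption)
    ((Set.DefinableFun.fun_symbol (L := diffRing) (M := U) (DiffRingFunc.add)).mono
      (Set.empty_subset _))
  simpa using this

lemma definableFun_mul {f g : (ι → U) → U} (hf : A.DefinableFun diffRing f)
    (hg : A.DefinableFun diffRing g) : A.DefinableFun diffRing fun v => f v * g v := by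
  have := Set.DefinableFun.comp (L := diffRing) (A := A) (f := fun w : Fin 2 → U => w 0 * w 1)
    (g := fun v => ![f v, g v]) (fun i => by fin_cases i <;> assumption)
    ((Set.DefinableFun.fun_symbol (L := diffRing) (M := U) (DiffRingFunc.mul)).mono
      (Set.empty_subset _))
  simpa using this

lemma definableFun_deriv {f : (ι → U) → U} (hf : A.DefinableFun diffRing f) :
    A.DefinableFun diffRing fun v => (f v)′ := by
  have := Set.DefinableFun.comp (L := diffRing) (A := A) (f := fun w : Fin 1 → U => (w 0)′)
    (g := fun v => ![f v]) (fun i => by fin_cases i; assumption)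
    ((Set.DefinableFun.fun_symbol (L := diffRing) (M := U) (DiffRingFunc.der)).mono
      (Set.empty_subset _))
  simpa using this

lemma definableFun_iterate_deriv {f : (ι → U) → U} (hf : A.DefinableFun diffRing f) (n : ℕ) :
    A.DefinableFun diffRing fun v => (Differential.deriv : Derivation ℤ U U)^[n] (f v) := by
  induction n with
  | zero => exact hf
  | succ n ih => simpa only [Function.iterate_succ_apply'] using definableFun_deriv ih

lemma definableFun_const {a : U} (ha : a ∈ A) :
    A.DefinableFun diffRing fun _ : ι → U => a :=
  FirstOrder.Language.definableFun_const diffRing _ ha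

lemma definableFun_zero : A.DefinableFun diffRing fun _ : ι → U => 0 := by
  have := Set.DefinableFun.comp (L := diffRing) (A := A) (f := fun _ : Fin 0 → U => (0 : U))
    (g := fun (_ : ι → U) => ![]) (fun i => i.elim0)
    ((Set.DefinableFun.fun_symbol (L := diffRing) (M := U) (DiffRingFunc.zero)).mono
      (Set.empty_subset _))
  simpa using this

lemma definableFun_sum {κ : Type*} (s : Finset κ) {f : κ → (ι → U) → U}
    (hf : ∀ i, A.DefinableFun diffRing (f i)) :
    A.DefinableFun diffRing fun v => ∑ i ∈ s, f i v := by
  classical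
  induction s using Finset.induction_on with
  | empty => simpa using definableFun_zero
  | insert a s ha ih =>
    simp only [Finset.sum_insert ha]
    exact definableFun_add (hf a) ih

lemma definableFun_eval₂ {R κ : Type*} [CommRing R] (σ : R →+* U) (hσ : ∀ r, σ r ∈ A)
    {f : κ → (ι → U) → U} (hf : ∀ i, A.DefinableFun diffRing (f i)) (p : MvPolynomial κ R) :
    A.DefinableFun diffRing fun v => p.eval₂ σ fun i => f i v := by
  induction p using MvPolynomial.induction_on with
  | C a => simpa using definableFun_const (hσ a)
  | add p q hp hq => simpa [MvPolynomial.eval₂_add] using definableFun_add hp hq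
  | mul_X p i hp => simpa [MvPolynomial.eval₂_mul] using definableFun_mul hp (hf i)

end Definability

/-! ### Extending partial embeddings -/

section Extension

variable {F U : Type u} [Field F] [Differential F] [Field U] [Differential U]

/-- The sequence of the derivatives of an element. -/
def derivs {R : Type*} [CommRing R] [Differential R] (a : R) (i : ℕ) : R :=
  (Differential.deriv : Derivation ℤ R R)^[i] a

lemma derivs_zero {R : Type*} [CommRing R] [Differential R] (a : R) : derivs a 0 = a := rfl

lemma derivs_succ {R : Type*} [CommRing R] [Differential R] (a : R) (i : ℕ) :
    derivs a (i + 1) = (derivs a i)′ := Function.iterate_succ_apply' _ _ _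

lemma diffEval_map {L : Type*} [CommRing L] (σ : L →+* U) (b : U) (f : MvPolynomial ℕ L) :
    diffEval b (f.map σ) = f.eval₂ σ (derivs b) := by
  rw [diffEval, MvPolynomial.eval_map]
  rfl

lemma definable_eval₂_derivs {L : Type*} [CommRing L] (σ : L →+* U) (f : MvPolynomial ℕ L) :
    (Set.range σ).Definable diffRing {v : Fin 1 → U | f.eval₂ σ (derivs (v 0)) = 0} :=
  (definableFun_eval₂ (A := Set.range σ) σ (fun r => ⟨r, rfl⟩)
      (f := fun i (v : Fin 1 → U) => derivs (v 0) i)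
      (fun i => definableFun_iterate_deriv (Set.DefinableFun.proj diffRing) i) f).ofPred_eq
    definableFun_zero

/-- Saturation, for indexed families. -/
lemma IsSaturated.exists_forall_mem (hsat : IsSaturated U) {A : Set U} (hA : #A < #U) {n : ℕ}
    {κ : Type*} (E : κ → Set (Fin n → U)) (hE : ∀ i, A.Definable diffRing (E i))
    (h : ∀ T : Finset κ, ∃ v, ∀ i ∈ T, v ∈ E i) : ∃ v, ∀ i, v ∈ E i := by
  classical
  obtain ⟨v, hv⟩ := hsat A hA n (Set.range E) (by rintro _ ⟨i, rfl⟩; exact hE i) (by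
    intro T hT hfin
    choose g hg using fun D : T => hT D.2
    have := hfin.fintype
    obtain ⟨v, hv⟩ := h (Finset.univ.image g)
    refine ⟨v, fun D hD => ?_⟩
    refine (hg ⟨D, hD⟩).subset (?_ : v ∈ E (g ⟨D, hD⟩))
    exact hv _ (Finset.mem_image_of_mem _ (Finset.mem_univ _)))
  exact ⟨v, fun i => hv _ ⟨i, rfl⟩⟩

/-- Compactness for one equation and arbitrarily many inequations; finitely many inequations amount
to the nonvanishing of their product. -/
lemma exists_eval₂_derivs (hsat : IsSaturated U) {L : Type u} [CommRing L] (σ : L →+* U)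
    (hL : #L < #U) (f : MvPolynomial ℕ L) (G : Set (MvPolynomial ℕ L))
    (h : ∀ T : Finset (MvPolynomial ℕ L), ↑T ⊆ G →
      ∃ b : U, f.eval₂ σ (derivs b) = 0 ∧ (∏ g ∈ T, g).eval₂ σ (derivs b) ≠ 0) :
    ∃ b : U, f.eval₂ σ (derivs b) = 0 ∧ ∀ g ∈ G, g.eval₂ σ (derivs b) ≠ 0 := by
  classical
  let Z : MvPolynomial ℕ L → Set (Fin 1 → U) := fun g => {v | g.eval₂ σ (derivs (v 0)) = 0}
  obtain ⟨v, hv⟩ := hsat.exists_forall_mem (Cardinal.mk_range_le.trans_lt hL)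
    -- The index `none` stands for the equation, `some g` for the inequation `g ≠ 0`.
    (fun i : Option G => i.elim (Z f) fun g => (Z g)ᶜ)
    (by
      rintro (_ | g)
      · exact definable_eval₂_derivs σ f
      · exact (definable_eval₂_derivs σ g.1).compl)
    (by
      intro T
      obtain ⟨b, hb, hb'⟩ := h (T.eraseNone.image Subtype.val) (by simp)
      refine ⟨fun _ => b, ?_⟩
      rintro (_ | g) hg
      · exact hb
      · intro h0
        refine hb' ?_
        rw [← MvPolynomial.coe_eval₂Hom, map_prod]
        exact Finset.prod_eq_zero (i := g.1) (by simpa using hg) h0)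
  exact ⟨v 0, hv none, fun g hg => hv (some ⟨g, hg⟩)⟩

/-- The value of a polynomial in the derivatives, for elements satisfying a differential equation
and no equation of smaller order. -/
lemma exists_eval₂_derivs_of_order (hclosed : IsDifferentiallyClosed U) (hsat : IsSaturated U)
    {L : Type u} [Field L] (σ : L →+* U) (hL : #L < #U) (n : ℕ)
    (M : Polynomial (MvPolynomial (Fin n) L)) (hM : M.natDegree ≠ 0) :
    ∃ b : U, M.eval₂ (MvPolynomial.eval₂Hom σ fun i : Fin n => derivs b i) (derivs b n) = 0 ∧
      Function.Injective (MvPolynomial.eval₂Hom σ fun i : Fin n => derivs b i) := by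
  classical
  let ρ : MvPolynomial (Fin n) L →+* MvPolynomial ℕ L :=
    (MvPolynomial.rename Fin.val).toRingHom
  have hρ : Function.Injective ρ := MvPolynomial.rename_injective _ Fin.val_injective
  have hρv : ∀ g, ∀ i ∈ (ρ g).vars, i < n := fun g i hi => by
    have := MvPolynomial.vars_rename _ _ hi
    simp only [Finset.mem_image] at this
    obtain ⟨j, -, rfl⟩ := this
    exact j.2
  -- The indeterminate of `M` becomes the `n`-th derivative, which turns `M` into a differential
  -- polynomial of order `n`.
  let f : MvPolynomial ℕ L := M.eval₂ ρ (MvPolynomial.X n)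
  have hσ := MvPolynomial.map_injective (σ := ℕ) σ σ.injective
  have hle : ∀ i ∈ f.vars, i ≤ n := by
    have : f ∈ MvPolynomial.supported L {i | i ≤ n} := by
      simp only [f, Polynomial.eval₂_eq_sum_range]
      refine Subalgebra.sum_mem _ fun i _ => Subalgebra.mul_mem _ ?_ (Subalgebra.pow_mem _ ?_ _)
      · exact MvPolynomial.mem_supported.2 fun j hj => (hρv _ j hj).le
      · exact MvPolynomial.mem_supported.2 fun j hj => by
          simp only [MvPolynomial.vars_X, Finset.coe_singleton, Set.mem_singleton_iff] at hj
          simp [hj]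
    exact fun i hi => MvPolynomial.mem_supported.1 this hi
  have hmem : n ∈ f.vars := by
    by_contra hn
    -- `θ` singles out the variable `n`. If `n` did not occur, `θ f` would be constant, but it is
    -- `M` with renamed coefficients, of positive degree.
    let θ : MvPolynomial ℕ L →+* Polynomial (MvPolynomial ℕ L) :=
      MvPolynomial.eval₂Hom (Polynomial.C.comp MvPolynomial.C)
        fun i => if i = n then Polynomial.X else Polynomial.C (MvPolynomial.X i)
    have hθ : ∀ p : MvPolynomial ℕ L, n ∉ p.vars → θ p = Polynomial.C p := fun p hp => by
      have : θ p = MvPolynomial.eval₂Hom (Polynomial.C.comp MvPolynomial.C)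
          (fun i => Polynomial.C (MvPolynomial.X i)) p :=
        MvPolynomial.eval₂Hom_congr' rfl (fun i hi _ => if_neg fun (h : i = n) => hp (h ▸ hi)) rfl
      rw [this]
      have h2 := MvPolynomial.eval₂_comp_left (Polynomial.C (R := MvPolynomial ℕ L))
        MvPolynomial.C MvPolynomial.X p
      rw [MvPolynomial.eval₂_eta] at h2
      exact h2.symm
    have h1 : θ f = M.map ρ := by
      simp only [f, Polynomial.hom_eval₂]
      have : θ (MvPolynomial.X n) = Polynomial.X := by simp [θ]
      rw [this, Polynomial.map]
      refine congrArg (fun τ => Polynomial.eval₂ τ Polynomial.X M) (RingHom.ext fun x => ?_)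
      exact hθ _ fun h => (hρv _ _ h).false
    have h2 := congrArg Polynomial.natDegree (h1.symm.trans (hθ f hn))
    rw [Polynomial.natDegree_map_eq_of_injective hρ, Polynomial.natDegree_C] at h2
    exact hM h2
  have hv : ∀ p : MvPolynomial ℕ L, (p.map σ).vars = p.vars := fun p =>
    MvPolynomial.vars_map_of_injective p σ.injective
  -- All nonzero polynomials of order less than `n` are avoided. They are closed under products, so
  -- the axiom of differentially closed fields treats finitely many at once.
  obtain ⟨b, hb, hb'⟩ := exists_eval₂_derivs hsat σ hL f (ρ '' {g | g ≠ 0}) (by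
    intro T hT
    have hT' : ∏ g ∈ T, g ∈ ρ '' {g | g ≠ 0} := by
      refine Finset.prod_induction _ (· ∈ ρ '' {g | g ≠ 0}) ?_ ⟨1, one_ne_zero, map_one _⟩
        fun g hg => hT hg
      rintro _ _ ⟨a, ha, rfl⟩ ⟨b, hb, rfl⟩
      exact ⟨a * b, mul_ne_zero ha hb, map_mul _ _ _⟩
    obtain ⟨g, hg, hgT⟩ := hT'
    rw [← hgT]
    obtain ⟨b, h1, h2⟩ := hclosed.2 n (f.map σ) ((ρ g).map σ) (by rwa [hv]) (by rwa [hv])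
      (fun h => hg (hρ (hσ (by simpa using h)))) (by rw [hv]; exact hρv g)
    rw [diffEval_map] at h1 h2
    exact ⟨b, h1, h2⟩)
  have hcomp : (MvPolynomial.eval₂Hom σ (derivs b)).comp ρ =
      MvPolynomial.eval₂Hom σ fun i : Fin n => derivs b i := by
    ext i <;> simp [ρ]
  refine ⟨b, ?_, ?_⟩
  · have h1 := Polynomial.hom_eval₂ M ρ (MvPolynomial.eval₂Hom σ (derivs b)) (MvPolynomial.X n)
    rw [hcomp] at h1
    simpa using h1.symm.trans hb
  · rw [injective_iff_map_eq_zero]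
    intro g hg
    by_contra h0
    refine hb' _ ⟨g, h0, rfl⟩ ?_
    rw [← hcomp] at hg
    exact hg

/-- Such a `b` is differentially transcendental over `L`. The equation passed to
`exists_eval₂_derivs` is `0`, so only inequations remain. -/
lemma exists_derivs_injective (hclosed : IsDifferentiallyClosed U) (hsat : IsSaturated U)
    {L : Type u} [Field L] (σ : L →+* U) (hL : #L < #U) :
    ∃ b : U, Function.Injective (MvPolynomial.eval₂Hom σ (derivs b)) := by
  obtain ⟨b, -, hb⟩ := exists_eval₂_derivs hsat σ hL 0 {g | g ≠ 0} (by
    intro T hT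
    have hT' : ∏ g ∈ T, g ≠ 0 := Finset.prod_ne_zero_iff.2 fun g hg => hT hg
    obtain ⟨n, hn⟩ : ∃ n, ∀ i ∈ (∏ g ∈ T, g).vars, i < n :=
      ⟨_, fun i hi => Nat.lt_succ_of_le (Finset.le_sup (f := id) hi)⟩
    -- The equation saying that the `n`-th derivative is zero is auxiliary; it serves only to have
    -- order larger than the inequation.
    obtain ⟨b, -, h2⟩ := hclosed.2 n (MvPolynomial.X n) ((∏ g ∈ T, g).map σ)
      (by simp [MvPolynomial.vars_X]) (by simp [MvPolynomial.vars_X])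
      (fun h => hT' (MvPolynomial.map_injective σ σ.injective (by simpa using h)))
      (by rwa [MvPolynomial.vars_map_of_injective _ σ.injective])
    rw [diffEval_map] at h2
    exact ⟨b, by simp, h2⟩)
  refine ⟨b, (injective_iff_map_eq_zero _).2 fun g hg => ?_⟩
  by_contra h0
  exact hb g h0 hg

end Extension

lemma mk_mvPolynomial_lt {L U : Type u} {κ : Type} [Countable κ] [CommRing L] (hU : ℵ₀ < #U)
    (hL : #L < #U) : #(MvPolynomial κ L) < #U := by
  have := MvPolynomial.cardinalMk_le_max_lift (σ := κ) (R := L)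
  refine this.trans_lt (max_lt (max_lt (by simpa using hL) ?_) hU)
  exact (Cardinal.lift_le_aleph0.2 (Cardinal.mk_le_aleph0)).trans_lt hU

section Extension

variable {F U : Type u} [Field F] [Differential F] [Field U] [Differential U]

/-- Polynomials in the derivatives of two elements: a common derivative exists. -/
lemma eval₂_mem_commonDerivSubfield {L P κ : Type*} [CommRing L] [Field P] {α : P →+* F}
    {β : P →+* U} (ι : L →+* P) (hι : ∀ c, ι c ∈ commonDerivSubfield α β) (x : κ → P)
    (hx : ∀ i, x i ∈ commonDerivSubfield α β) (p : MvPolynomial κ L) :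
    p.eval₂ ι x ∈ commonDerivSubfield α β := by
  induction p using MvPolynomial.induction_on with
  | C a => simpa using hι a
  | add p q hp hq => rw [MvPolynomial.eval₂_add]; exact add_mem hp hq
  | mul_X p i hp => rw [MvPolynomial.eval₂_mul, MvPolynomial.eval₂_X]; exact mul_mem hp (hx i)

/-- The shift `s` records which variable is the derivative of which, so both evaluations intertwine
the derivations with one operation on polynomials. -/
lemma exists_deriv_eval₂ {L κ : Type*} [CommRing L] {α : L →+* F} {β : L →+* U}
    (hL : ∀ c, ∃ d, (α c)′ = α d ∧ (β c)′ = β d) (x : κ → F) (y : κ → U) (s : κ → κ)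
    (hx : ∀ i, (x i)′ = x (s i)) (hy : ∀ i, (y i)′ = y (s i)) (p : MvPolynomial κ L) :
    ∃ q : MvPolynomial κ L, (p.eval₂ α x)′ = q.eval₂ α x ∧ (p.eval₂ β y)′ = q.eval₂ β y := by
  induction p using MvPolynomial.induction_on with
  | C a =>
    obtain ⟨d, h1, h2⟩ := hL a
    exact ⟨MvPolynomial.C d, by simp [h1], by simp [h2]⟩
  | add p q hp hq =>
    obtain ⟨r, h1, h2⟩ := hp
    obtain ⟨t, h3, h4⟩ := hq
    exact ⟨r + t, by simp [MvPolynomial.eval₂_add, h1, h3],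
      by simp [MvPolynomial.eval₂_add, h2, h4]⟩
  | mul_X p i hp =>
    obtain ⟨r, h1, h2⟩ := hp
    exact ⟨p * MvPolynomial.X (s i) + MvPolynomial.X i * r,
      by simp [MvPolynomial.eval₂_add, MvPolynomial.eval₂_mul, Derivation.leibniz, h1, hx],
      by simp [MvPolynomial.eval₂_add, MvPolynomial.eval₂_mul, Derivation.leibniz, h2, hy]⟩

lemma PartialEmb.common_deriv (e : PartialEmb F U) (c : e.dom) :
    ∃ d, (e.dom.subtype c)′ = e.dom.subtype d ∧ (e.hom c)′ = e.hom d :=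
  ⟨⟨(c : F)′, e.deriv_mem c c.2⟩, rfl, (e.comm c).symm⟩

lemma PartialEmb.exists_extension_of_independent (hclosed : IsDifferentiallyClosed U)
    (hsat : IsSaturated U) (hU : ℵ₀ < #U) (e : PartialEmb F U) (a : F)
    (ha : Function.Injective (MvPolynomial.eval₂Hom e.dom.subtype (derivs a))) :
    ∃ e' : PartialEmb F U, e'.Extends e ∧ a ∈ e'.dom := by
  obtain ⟨b, hb⟩ := exists_derivs_injective hclosed hsat e.hom e.small
  obtain ⟨e', he'⟩ := exists_partialEmb (MvPolynomial.eval₂Hom e.dom.subtype (derivs a))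
    (MvPolynomial.eval₂Hom e.hom (derivs b))
    (fun p => by rw [map_eq_zero_iff _ ha, map_eq_zero_iff _ hb])
    (exists_deriv_eval₂ e.common_deriv _ _ (· + 1) (fun i => (derivs_succ a i).symm)
      fun i => (derivs_succ b i).symm)
    (mk_mvPolynomial_lt hU e.small)
  refine ⟨e', fun c => ?_, ?_⟩
  · obtain ⟨h, h'⟩ := he' (MvPolynomial.C c)
    simp only [MvPolynomial.coe_eval₂Hom, MvPolynomial.eval₂_C] at h h'
    exact ⟨h, h'⟩
  · obtain ⟨h, -⟩ := he' (MvPolynomial.X 0)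
    simpa [derivs_zero] using h

/-- Here `a` has order `n`: its first `n` derivatives (from the 0-th on) are independent and the
`n`-th is algebraic over them. The image `b` must satisfy the minimal polynomial of `derivs a n` and
no equation of smaller order. As that polynomial is separable, it also determines all higher
derivatives. -/
lemma PartialEmb.exists_extension_of_dependent (hclosed : IsDifferentiallyClosed U)
    (hsat : IsSaturated U) (hU : ℵ₀ < #U) (e : PartialEmb F U) (a : F) (n : ℕ)
    (ha : Function.Injective
      (MvPolynomial.eval₂Hom e.dom.subtype fun i : Fin n => derivs a i))
    (q : Polynomial (MvPolynomial (Fin n) e.dom)) (hq : q ≠ 0)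
    (hqa : q.eval₂ (MvPolynomial.eval₂Hom e.dom.subtype fun i : Fin n => derivs a i)
      (derivs a n) = 0) :
    ∃ e' : PartialEmb F U, e'.Extends e ∧ a ∈ e'.dom := by
  have : CharZero U := hclosed.1
  have : CharZero e.dom := (e.hom.charZero_iff e.hom.injective).2 this
  let R := MvPolynomial (Fin n) e.dom
  let E := FractionRing R
  let α₀ : E →+* F := IsFractionRing.lift ha
  let : Algebra E F := α₀.toAlgebra
  have hα₀ : ∀ r : R, α₀ (algebraMap R E r) = _ := IsFractionRing.lift_algebraMap ha
  have hα₀' : α₀.comp (algebraMap R E) = _ := RingHom.ext hα₀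
  have hRE : Function.Injective (algebraMap R E) := IsFractionRing.injective R E
  have hint : IsIntegral E (derivs a n) := by
    rw [← isAlgebraic_iff_isIntegral]
    refine ⟨q.map (algebraMap R E), (Polynomial.map_ne_zero_iff hRE).2 hq, ?_⟩
    rw [Polynomial.aeval_def, Polynomial.eval₂_map]
    exact (congrArg (fun τ => q.eval₂ τ (derivs a n)) hα₀').trans hqa
  let m := minpoly E (derivs a n)
  have hm : Irreducible m := minpoly.irreducible hint
  -- Denominators are cleared so that the minimal polynomial becomes a differential polynomial over
  -- the domain of `e`.
  obtain ⟨d, hd, hM⟩ := IsLocalization.integerNormalization_spec (nonZeroDivisors R) m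
  set M := IsLocalization.integerNormalization (nonZeroDivisors R) m
  have hd0 : algebraMap R E d ≠ 0 := by
    rw [Ne, map_eq_zero_iff _ hRE]; exact nonZeroDivisors.ne_zero hd
  have hM' : M.map (algebraMap R E) = Polynomial.C (algebraMap R E d) * m := by
    rw [hM, Algebra.smul_def]; rfl
  obtain ⟨b, hb, hbi⟩ := exists_eval₂_derivs_of_order hclosed hsat e.hom e.small n M (by
    rw [← Polynomial.natDegree_map_eq_of_injective hRE, hM', Polynomial.natDegree_C_mul hd0]
    exact (minpoly.natDegree_pos hint).ne')
  let β₀ : E →+* U := IsFractionRing.lift hbi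
  have hβ₀ : ∀ r : R, β₀ (algebraMap R E r) = _ := IsFractionRing.lift_algebraMap hbi
  have hβ₀' : β₀.comp (algebraMap R E) = _ := RingHom.ext hβ₀
  have hmb : m.eval₂ β₀ (derivs b n) = 0 := by
    have h1 : (M.map (algebraMap R E)).eval₂ β₀ (derivs b n) = 0 := by
      rw [Polynomial.eval₂_map]
      exact (congrArg (fun τ => M.eval₂ τ (derivs b n)) hβ₀').trans hb
    rw [hM', Polynomial.eval₂_mul, Polynomial.eval₂_C] at h1
    exact (mul_eq_zero.1 h1).resolve_left (by simpa using hd0)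
  have : Fact (Irreducible m) := ⟨hm⟩
  let P := AdjoinRoot m
  let α : P →+* F := AdjoinRoot.lift α₀ (derivs a n) (minpoly.aeval E (derivs a n))
  let β : P →+* U := AdjoinRoot.lift β₀ (derivs b n) hmb
  let ι : E →+* P := AdjoinRoot.of m
  let ξ : P := AdjoinRoot.root m
  have hαι : ∀ c, α (ι c) = α₀ c := fun c => AdjoinRoot.lift_of _
  have hβι : ∀ c, β (ι c) = β₀ c := fun c => AdjoinRoot.lift_of _
  have hαξ : α ξ = derivs a n := AdjoinRoot.lift_root _
  have hβξ : β ξ = derivs b n := AdjoinRoot.lift_root _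
  let j : e.dom →+* P := ι.comp ((algebraMap R E).comp MvPolynomial.C)
  have hαj : ∀ c, α (j c) = c := fun c => by
    simp only [j, RingHom.comp_apply]
    rw [hαι, hα₀]; exact MvPolynomial.eval₂_C _ _ _
  have hβj : ∀ c, β (j c) = e.hom c := fun c => by
    simp only [j, RingHom.comp_apply]
    rw [hβι, hβ₀]; exact MvPolynomial.eval₂_C _ _ _
  let x : Fin n → P := fun i => ι (algebraMap R E (MvPolynomial.X i))
  have hαx : ∀ i, α (x i) = derivs a i := fun i => by
    simp only [x]
    rw [hαι, hα₀]; simp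
  have hβx : ∀ i, β (x i) = derivs b i := fun i => by
    simp only [x]
    rw [hβι, hβ₀]; simp
  have hjm : ∀ c, j c ∈ commonDerivSubfield α β := fun c => by
    obtain ⟨d, h1, h2⟩ := e.common_deriv c
    exact ⟨j d, by rw [hαj, hαj]; exact h1, by rw [hβj, hβj]; exact h2⟩
  -- The derivative of the last of these variables is the algebraic element `ξ`; that of any other
  -- is the next variable.
  have hxm : ∀ i, x i ∈ commonDerivSubfield α β := fun i => by
    by_cases hi : (i : ℕ) + 1 = n
    · exact ⟨ξ, by rw [hαx, hαξ, ← derivs_succ, hi], by rw [hβx, hβξ, ← derivs_succ, hi]⟩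
    · exact ⟨x ⟨i + 1, by omega⟩, by rw [hαx, hαx, ← derivs_succ],
        by rw [hβx, hβx, ← derivs_succ]⟩
  have hRm : ∀ r : R, ι (algebraMap R E r) ∈ commonDerivSubfield α β := fun r => by
    have : (ι.comp (algebraMap R E)) = MvPolynomial.eval₂Hom j x := by
      ext i <;> simp [j, x]
    rw [← RingHom.comp_apply, this]
    exact eval₂_mem_commonDerivSubfield j hjm x hxm r
  have hEm : ∀ c, ι c ∈ commonDerivSubfield α β := fun c => by
    obtain ⟨r, s, -, rfl⟩ := IsFractionRing.div_surjective (A := R) c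
    rw [map_div₀]
    exact div_mem (hRm r) (hRm s)
  have : CharZero E := charZero_of_injective_algebraMap
    (R := e.dom) (A := E) (algebraMap e.dom E).injective
  have hξm : ξ ∈ commonDerivSubfield α β := by
    refine mem_commonDerivSubfield_of_root ι hEm ξ m (AdjoinRoot.eval₂_root m) fun h => ?_
    have h1 : AdjoinRoot.mk m m.derivative = 0 := by
      rw [← h, ← AdjoinRoot.aeval_eq, Polynomial.aeval_def]; rfl
    rw [AdjoinRoot.mk_eq_zero] at h1
    have h2 := hm.separable
    rw [Polynomial.Separable, isCoprime_comm] at h2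
    exact hm.not_isUnit (h2.isUnit_of_dvd' h1 dvd_rfl)
  obtain ⟨e', -, he'⟩ := exists_partialEmb_of_field α β (fun p => by
    obtain ⟨f, rfl⟩ := AdjoinRoot.mk_surjective p
    induction f using Polynomial.induction_on' with
    | add f g hf hg => rw [map_add]; exact add_mem hf hg
    | monomial k c =>
      rw [← Polynomial.C_mul_X_pow_eq_monomial, map_mul, map_pow]
      exact mul_mem (hEm c) (pow_mem hξm k)) (by
    refine (Cardinal.mk_le_of_surjective (AdjoinRoot.mk_surjective (g := m))).trans_lt ?_
    refine Polynomial.cardinalMk_le_max.trans_lt (max_lt ?_ hU)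
    rw [Cardinal.mk_fractionRing]
    exact mk_mvPolynomial_lt hU e.small)
  refine ⟨e', fun c => ?_, ?_⟩
  · obtain ⟨h, h'⟩ := he' (j c)
    simp only [hαj, hβj] at h h'
    exact ⟨h, h'⟩
  -- For `n = 0` there are no variables, and `a` is itself the algebraic element.
  · rcases Nat.eq_zero_or_pos n with rfl | hn
    · obtain ⟨h, -⟩ := he' ξ
      rwa [hαξ] at h
    · obtain ⟨h, -⟩ := he' (x ⟨0, hn⟩)
      rwa [hαx] at h

/-- A partial embedding into a saturated differentially closed field extends to any given
element. -/
theorem PartialEmb.exists_extension (hclosed : IsDifferentiallyClosed U)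
    (hsat : IsSaturated U) (hU : ℵ₀ < #U) (e : PartialEmb F U) (a : F) :
    ∃ e' : PartialEmb F U, e'.Extends e ∧ a ∈ e'.dom := by
  classical
  by_cases hind : ∀ n : ℕ, AlgebraicIndependent e.dom fun i : Fin n => derivs a i
  · refine e.exists_extension_of_independent hclosed hsat hU a ?_
    rw [injective_iff_map_eq_zero]
    intro p hp
    obtain ⟨n, hn⟩ : ∃ n, ∀ i ∈ p.vars, i < n :=
      ⟨_, fun i hi => Nat.lt_succ_of_le (Finset.le_sup (f := id) hi)⟩
    obtain ⟨q, rfl⟩ := MvPolynomial.exists_rename_eq_of_vars_subset_range p (Fin.val (n := n))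
      Fin.val_injective (fun i hi => ⟨⟨i, hn i hi⟩, rfl⟩)
    rw [MvPolynomial.coe_eval₂Hom, MvPolynomial.eval₂_rename] at hp
    have : q = 0 := (injective_iff_map_eq_zero (MvPolynomial.aeval _)).1 (hind n) q hp
    rw [this, map_zero]
  · push Not at hind
    have h0 : AlgebraicIndependent e.dom fun i : Fin 0 => derivs a i :=
      algebraicIndependent_empty_type
    -- This `n` is the order of `a` over the domain.
    obtain ⟨n, hn, hn'⟩ : ∃ n, AlgebraicIndependent e.dom (fun i : Fin n => derivs a i) ∧
        ¬ AlgebraicIndependent e.dom (fun i : Fin (n + 1) => derivs a i) := by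
      by_contra! h
      obtain ⟨n, hn⟩ := hind
      exact hn (Nat.rec h0 (fun n hn => h n hn) n)
    have h1 : ¬ Transcendental (Algebra.adjoin e.dom (Set.range fun i : Fin n => derivs a i))
        (derivs a n) := fun h => by
      have h2 := (AlgebraicIndependent.option_iff (a := derivs a n)).2 ⟨hn, h⟩
      have h3 := (algebraicIndependent_equiv (finSuccEquivLast (n := n))).2 h2
      refine hn' ?_
      convert h3 using 1
      ext i
      refine Fin.lastCases ?_ (fun i => ?_) i <;> simp
    simp only [Transcendental, not_not] at h1
    obtain ⟨q, hq, hq'⟩ := h1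
    refine e.exists_extension_of_dependent hclosed hsat hU a n hn
      (q.map hn.aevalEquiv.symm.toRingEquiv.toRingHom) ?_ ?_
    · exact (Polynomial.map_ne_zero_iff hn.aevalEquiv.symm.injective).2 hq
    · rw [Polynomial.eval₂_map, ← hq', Polynomial.aeval_def]
      congr 1
      ext x
      obtain ⟨x, rfl⟩ := hn.aevalEquiv.surjective x
      simp [MvPolynomial.aeval_def]
      rfl

end Extension

/-! ### Partial embeddings are elementary -/

section Elementary

variable {U : Type u} [Field U] [Differential U]

lemma PartialEmb.realize_term (e : PartialEmb U U) {α : Type*} (t : diffRing.Term α)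
    (v : α → e.dom) :
    ∃ h : t.realize (fun i => (v i : U)) ∈ e.dom,
      e.hom ⟨_, h⟩ = t.realize fun i => e.hom (v i) := by
  induction t with
  | var i => exact ⟨(v i).2, rfl⟩
  | func f ts ih =>
    choose h h' using ih
    cases f with
    | zero => exact ⟨zero_mem _, map_zero _⟩
    | one => exact ⟨one_mem _, map_one _⟩
    | neg => exact ⟨neg_mem (h 0), (map_neg e.hom (⟨_, h 0⟩ : e.dom)).trans (congrArg _ (h' 0))⟩
    | add =>
      exact ⟨add_mem (h 0) (h 1), (map_add e.hom (⟨_, h 0⟩ : e.dom) ⟨_, h 1⟩).trans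
        (congrArg₂ (· + ·) (h' 0) (h' 1))⟩
    | mul =>
      exact ⟨mul_mem (h 0) (h 1), (map_mul e.hom (⟨_, h 0⟩ : e.dom) ⟨_, h 1⟩).trans
        (congrArg₂ (· * ·) (h' 0) (h' 1))⟩
    | der =>
      exact ⟨e.deriv_mem _ (h 0), (e.comm ⟨_, h 0⟩).trans
        (congrArg (fun x => x′) (h' 0))⟩

/-- Quantifier elimination: partial embeddings of `U` into itself are elementary. -/
theorem PartialEmb.realize_iff (hclosed : IsDifferentiallyClosed U) (hsat : IsSaturated U)
    (hU : ℵ₀ < #U) {α : Type*} {n : ℕ} (φ : diffRing.BoundedFormula α n) (e : PartialEmb U U)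
    (v : α → e.dom) (xs : Fin n → e.dom) :
    φ.Realize (fun i => (v i : U)) (fun i => (xs i : U)) ↔
      φ.Realize (fun i => e.hom (v i)) (fun i => e.hom (xs i)) := by
  induction φ generalizing e with
  | falsum => rfl
  | equal t₁ t₂ =>
    obtain ⟨h₁, h₁'⟩ := e.realize_term t₁ (Sum.elim v xs)
    obtain ⟨h₂, h₂'⟩ := e.realize_term t₂ (Sum.elim v xs)
    have hs : (fun i => ((Sum.elim v xs i : e.dom) : U)) =
        Sum.elim (fun i => (v i : U)) fun i => (xs i : U) := by
      ext (i | i) <;> rfl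
    have hs' : (fun i => e.hom (Sum.elim v xs i)) =
        Sum.elim (fun i => e.hom (v i)) fun i => e.hom (xs i) := by
      ext (i | i) <;> rfl
    rw [hs'] at h₁' h₂'
    simp only [FirstOrder.Language.BoundedFormula.Realize]
    rw [← h₁', ← h₂', e.hom.injective.eq_iff, Subtype.mk.injEq, hs]
  | rel R => exact R.elim
  | imp φ ψ ihφ ihψ =>
    simp only [FirstOrder.Language.BoundedFormula.realize_imp]
    exact imp_congr (ihφ e v xs) (ihψ e v xs)
  | all φ ih =>
    simp only [FirstOrder.Language.BoundedFormula.realize_all]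
    constructor
    -- The "forth" step extends `e`; here `b` lies on the target side, so it is the inverse of `e`
    -- that is extended to `b`.
    · intro h b
      obtain ⟨e₁, he₁⟩ := e.exists_inverse rfl
      obtain ⟨e₂, he₂, hb⟩ := e₁.exists_extension hclosed hsat hU b
      have key : ∀ x : e.dom, ∃ h : e.hom x ∈ e₂.dom, e₂.hom ⟨e.hom x, h⟩ = x := fun x => by
        obtain ⟨h1, h2⟩ := he₁ x
        obtain ⟨h3, h4⟩ := he₂ ⟨_, h1⟩
        exact ⟨h3, h4.trans h2⟩
      choose h1 h2 using key
      have h3 := (ih e₂ (fun i => ⟨_, h1 (v i)⟩)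
        (Fin.snoc (fun i => ⟨_, h1 (xs i)⟩) ⟨b, hb⟩)).2 (by
          simp only [h2]
          convert h (e₂.hom ⟨b, hb⟩) using 2 with i
          refine Fin.lastCases ?_ (fun i => ?_) i <;> simp [h2])
      convert h3 using 2 with i
      refine Fin.lastCases ?_ (fun i => ?_) i <;> simp
    · intro h a
      obtain ⟨e₁, he₁, ha⟩ := e.exists_extension hclosed hsat hU a
      choose h1 h2 using he₁
      have h3 := (ih e₁ (fun i => ⟨_, h1 (v i)⟩)
        (Fin.snoc (fun i => ⟨_, h1 (xs i)⟩) ⟨a, ha⟩)).2 (by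
          simp only [h2]
          convert h (e₁.hom ⟨a, ha⟩) using 2 with i
          refine Fin.lastCases ?_ (fun i => ?_) i <;> simp [h2])
      convert h3 using 2 with i
      refine Fin.lastCases ?_ (fun i => ?_) i <;> simp

lemma PartialEmb.mem_definable_iff (hclosed : IsDifferentiallyClosed U) (hsat : IsSaturated U)
    (hU : ℵ₀ < #U) (e : PartialEmb U U) {A : Set U}
    (hA : ∀ a ∈ A, ∃ h : a ∈ e.dom, e.hom ⟨a, h⟩ = a) {ι : Type*} {E : Set (ι → U)}
    (hE : A.Definable diffRing E) (v : ι → e.dom) :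
    (fun i => (v i : U)) ∈ E ↔ (fun i => e.hom (v i)) ∈ E := by
  obtain ⟨φ, rfl⟩ := Set.definable_iff_exists_formula_sum.1 hE
  choose hA hA' using hA
  have := PartialEmb.realize_iff hclosed hsat hU φ e
    (Sum.elim (fun a : A => ⟨a, hA a a.2⟩) v) default
  have h1 : (fun i => ((Sum.elim (fun a : A => (⟨a, hA a a.2⟩ : e.dom)) v i : e.dom) : U)) =
      Sum.elim (fun a : A => (a : U)) fun i => (v i : U) := by
    ext (i | i) <;> rfl
  have h2 : (fun i => e.hom (Sum.elim (fun a : A => (⟨a, hA a a.2⟩ : e.dom)) v i)) =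
      Sum.elim (fun a : A => (a : U)) fun i => e.hom (v i) := by
    ext (i | i)
    · exact hA' i i.2
    · rfl
  rw [h1, h2] at this
  simp only [Set.mem_ofPred_eq, FirstOrder.Language.Formula.Realize]
  convert this using 2

/-- Tuples satisfying the same differential equations have the same type. -/
lemma mem_definable_iff_of_ringHom (hclosed : IsDifferentiallyClosed U) (hsat : IsSaturated U)
    (hU : ℵ₀ < #U) {P : Type u} [CommRing P] (α β : P →+* U)
    (hker : ∀ p, α p = 0 ↔ β p = 0) (hd : ∀ p, ∃ q, (α p)′ = α q ∧ (β p)′ = β q) (hP : #P < #U)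
    {A : Set U} (hA : ∀ a ∈ A, ∃ p, α p = a ∧ β p = a) {ι : Type*} {E : Set (ι → U)}
    (hE : A.Definable diffRing E) (r : ι → P) :
    (fun i => α (r i)) ∈ E ↔ (fun i => β (r i)) ∈ E := by
  obtain ⟨e, he⟩ := exists_partialEmb α β hker hd hP
  choose h h' using he
  have := e.mem_definable_iff hclosed hsat hU (A := A) (fun a ha => by
    obtain ⟨p, hp, hp'⟩ := hA a ha
    have h1 := h p
    have h2 := h' p
    simp only [hp, hp'] at h1 h2
    exact ⟨h1, h2⟩) hE (fun i => ⟨_, h (r i)⟩)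
  simpa only [h'] using this

variable {k : Type u} [Field k] [Algebra k U]

lemma exists_deriv_eval₂_derivs {F : Type u} [Field F] [Differential F] {L κ : Type*} [CommRing L]
    {α : L →+* F} {β : L →+* U} (hα : ∀ c, (α c)′ = 0) (hβ : ∀ c, (β c)′ = 0) (x : κ → F)
    (y : κ → U) (p : MvPolynomial (κ × ℕ) L) :
    ∃ q : MvPolynomial (κ × ℕ) L,
      (p.eval₂ α fun i => derivs (x i.1) i.2)′ = q.eval₂ α (fun i => derivs (x i.1) i.2) ∧
      (p.eval₂ β fun i => derivs (y i.1) i.2)′ = q.eval₂ β (fun i => derivs (y i.1) i.2) :=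
  exists_deriv_eval₂ (fun c => ⟨0, by simp [hα], by simp [hβ]⟩) _ _ (fun i => (i.1, i.2 + 1))
    (fun i => (derivs_succ _ _).symm) (fun i => (derivs_succ _ _).symm) p

lemma definable_eval₂_derivs_tuple {n : ℕ} (p : MvPolynomial (Fin n × ℕ) k) :
    (Set.range (algebraMap k U)).Definable diffRing
      {w : Fin n → U | p.eval₂ (algebraMap k U) (fun i => derivs (w i.1) i.2) = 0} :=
  (definableFun_eval₂ (A := Set.range (algebraMap k U)) _ (fun r => ⟨r, rfl⟩)
      (f := fun (i : Fin n × ℕ) (v : Fin n → U) => derivs (v i.1) i.2)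
      (fun i => definableFun_iterate_deriv (Set.DefinableFun.proj diffRing) i.2) p).ofPred_eq
    definableFun_zero

/-- From equality of types only one consequence is used: the same differential polynomials over `k`
vanish at `b` and `c`, so the two evaluation maps have the same kernel. -/
lemma SameType.exists_partialEmb (hconst : ∀ c : k, (algebraMap k U c)′ = 0)
    (hU : ℵ₀ < #U) (hk : #k < #U) {n : ℕ} {b c : Fin n → U}
    (h : SameType (Set.range (algebraMap k U)) b c) :
    ∃ e : PartialEmb U U, (∀ a, ∃ h : algebraMap k U a ∈ e.dom, e.hom ⟨_, h⟩ = algebraMap k U a) ∧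
      ∀ i, ∃ h : b i ∈ e.dom, e.hom ⟨_, h⟩ = c i := by
  obtain ⟨e, he⟩ := DiffAlg.exists_partialEmb
    (MvPolynomial.eval₂Hom (algebraMap k U) fun i : Fin n × ℕ => derivs (b i.1) i.2)
    (MvPolynomial.eval₂Hom (algebraMap k U) fun i : Fin n × ℕ => derivs (c i.1) i.2)
    (fun p => h _ (definable_eval₂_derivs_tuple p))
    (exists_deriv_eval₂_derivs hconst hconst b c) (mk_mvPolynomial_lt hU hk)
  refine ⟨e, fun a => ?_, fun i => ?_⟩
  · obtain ⟨h1, h2⟩ := he (MvPolynomial.C a)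
    simp only [MvPolynomial.coe_eval₂Hom, MvPolynomial.eval₂_C] at h1 h2
    exact ⟨h1, h2⟩
  · obtain ⟨h1, h2⟩ := he (MvPolynomial.X (i, 0))
    simp only [MvPolynomial.coe_eval₂Hom, MvPolynomial.eval₂_X, derivs_zero] at h1 h2
    exact ⟨h1, h2⟩

end Elementary

/-! ### Linearly disjoint copies -/

section Free

open TensorProduct

/-- Nullstellensatz: the residue field of a maximal ideal of `A[1/c]` is finite over `k`, hence
equal to `k`, and `c` is a unit in it. -/
lemma exists_algHom_apply_ne_zero {k A : Type*} [Field k] [IsAlgClosed k] [CommRing A] [IsDomain A]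
    [Algebra k A] [Algebra.FiniteType k A] (c : A) (hc : c ≠ 0) : ∃ φ : A →ₐ[k] k, φ c ≠ 0 := by
  have : Nontrivial (Localization.Away c) :=
    (IsLocalization.injective (Localization.Away c)
      (powers_le_nonZeroDivisors_of_noZeroDivisors hc)).nontrivial
  obtain ⟨m, hm⟩ := Ideal.exists_maximal (Localization.Away c)
  let B := Localization.Away c ⧸ m
  let : Field B := Ideal.Quotient.field m
  have : Algebra.FiniteType A (Localization.Away c) := IsLocalization.finiteType_of_monoid_fg
    (Submonoid.powers c) _
  have : Algebra.FiniteType k (Localization.Away c) := Algebra.FiniteType.trans ‹_› this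
  have : Algebra.FiniteType k B := inferInstanceAs (Algebra.FiniteType k (Localization.Away c ⧸ m))
  have : Module.Finite k B := finite_of_finite_type_of_isJacobsonRing k B
  have hbij : Function.Bijective (algebraMap k B) :=
    IsAlgClosed.algebraMap_bijective_of_isIntegral
  let ε : k ≃ₐ[k] B := AlgEquiv.ofBijective (Algebra.ofId k B) hbij
  refine ⟨ε.symm.toAlgHom.comp ((Ideal.Quotient.mkₐ k m).comp
    (IsScalarTower.toAlgHom k A (Localization.Away c))), ?_⟩
  have hu : IsUnit (algebraMap A (Localization.Away c) c) :=
    IsLocalization.map_units _ (⟨c, Submonoid.mem_powers c⟩ : Submonoid.powers c)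
  have hu' := (hu.map (Ideal.Quotient.mkₐ k m)).map ε.symm.toAlgHom
  exact hu'.ne_zero

/-- The tensor product of two fields over an algebraically closed field is a domain. -/
theorem isDomain_tensorProduct (k K L : Type*) [Field k] [IsAlgClosed k] [Field K] [Field L]
    [Algebra k K] [Algebra k L] : IsDomain (K ⊗[k] L) := by
  classical
  have hnz : NoZeroDivisors (K ⊗[k] L) := ⟨by
    intro x y hxy
    by_contra! hne
    let e := Module.Free.chooseBasis k L
    let e' := e.baseChange K
    -- The coordinates of `x` and `y` generate a finitely generated domain `A`. A `k`-point of `A`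
    -- specializes `A ⊗ L` to the field `L`, where products of nonzero elements are nonzero.
    let S : Set K := ((e'.repr x).support.image (e'.repr x) ∪
      (e'.repr y).support.image (e'.repr y) : Finset K)
    let A := Algebra.adjoin k S
    have : Algebra.FiniteType k A := by
      rw [← Subalgebra.fg_iff_finiteType]
      exact Subalgebra.fg_adjoin_finset _
    have hA : ∀ z : K ⊗[k] L, (∀ i, e'.repr z i ∈ A) →
        ∃ z' : A ⊗[k] L, Algebra.TensorProduct.map A.val (AlgHom.id k L) z' = z ∧
          ∀ φ : A →ₐ[k] k, ∀ i (h : e'.repr z i ∈ A), φ ⟨_, h⟩ ≠ 0 →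
            Algebra.TensorProduct.lift ((Algebra.ofId k L).comp φ) (AlgHom.id k L)
              (fun _ _ => Commute.all _ _) z' ≠ 0 := by
      intro z hz
      refine ⟨∑ i ∈ (e'.repr z).support, (⟨_, hz i⟩ : A) ⊗ₜ[k] e i, ?_, ?_⟩
      · rw [map_sum]
        conv_rhs => rw [← e'.linearCombination_repr z, Finsupp.linearCombination_apply,
          Finsupp.sum]
        refine Finset.sum_congr rfl fun i _ => ?_
        simp [e', Module.Basis.baseChange_apply, TensorProduct.smul_tmul']
      · intro φ i hi hφ h0
        rw [map_sum] at h0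
        simp only [Algebra.TensorProduct.lift_tmul, AlgHom.comp_apply, Algebra.ofId_apply,
          AlgHom.id_apply, ← Algebra.smul_def] at h0
        have hi' : i ∈ (e'.repr z).support := by
          rw [Finsupp.mem_support_iff]
          intro h
          refine hφ ?_
          have : (⟨_, hi⟩ : A) = 0 := Subtype.ext h
          rw [this, map_zero]
        exact hφ (linearIndependent_iff'.1 e.linearIndependent _ _ h0 i hi')
    have hmem : ∀ z : K ⊗[k] L, (((e'.repr z).support.image (e'.repr z) : Finset K) : Set K) ⊆ S →
        ∀ i, e'.repr z i ∈ A := fun z hz i => by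
      by_cases h : e'.repr z i = 0
      · rw [h]; exact zero_mem _
      · exact Algebra.subset_adjoin (hz (Finset.mem_coe.2 (Finset.mem_image_of_mem _
          (Finsupp.mem_support_iff.2 h))))
    have hxA := hmem x (by simp [S])
    have hyA := hmem y (by simp [S])
    obtain ⟨x', hx', hx''⟩ := hA x hxA
    obtain ⟨y', hy', hy''⟩ := hA y hyA
    obtain ⟨i, hi⟩ : ∃ i, e'.repr x i ≠ 0 := by
      by_contra! h
      exact hne.1 (e'.repr.map_eq_zero_iff.1 (Finsupp.ext h))
    obtain ⟨j, hj⟩ : ∃ i, e'.repr y i ≠ 0 := by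
      by_contra! h
      exact hne.2 (e'.repr.map_eq_zero_iff.1 (Finsupp.ext h))
    -- The specialization keeps one nonzero coordinate of `x` and one of `y` nonzero, so neither
    -- image vanishes.
    obtain ⟨φ, hφ⟩ := exists_algHom_apply_ne_zero (k := k)
      ((⟨_, hxA i⟩ : A) * ⟨_, hyA j⟩) (mul_ne_zero (fun h => hi (congrArg Subtype.val h))
        (fun h => hj (congrArg Subtype.val h)))
    rw [map_mul] at hφ
    have hinj : Function.Injective (Algebra.TensorProduct.map A.val (AlgHom.id k L)) :=
      Module.Flat.rTensor_preserves_injective_linearMap (M := L) A.val.toLinearMap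
        Subtype.val_injective
    have h0 : x' * y' = 0 := hinj (by rw [map_mul, hx', hy', hxy, map_zero])
    have h1 := congrArg (Algebra.TensorProduct.lift ((Algebra.ofId k L).comp φ) (AlgHom.id k L)
              (fun _ _ => Commute.all _ _)) h0
    rw [map_mul, map_zero] at h1
    exact (mul_ne_zero (hx'' φ i _ (left_ne_zero_of_mul hφ))
      (hy'' φ j _ (right_ne_zero_of_mul hφ))) h1⟩
  exact NoZeroDivisors.to_isDomain _

end Free

/-! ### Derivations on tensor products and conjugates in general position. -/

section Free

open TensorProduct

/-- A derivation on the fraction field, from a ring homomorphism to the dual numbers. -/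
lemma exists_differential_of_dualNumber {T F : Type u} [CommRing T] [IsDomain T] [Field F]
    [Algebra T F] [IsFractionRing T F] (f : T →+* DualNumber F)
    (hf : ∀ t, (f t).fst = algebraMap T F t) :
    ∃ _ : Differential F, ∀ t, (algebraMap T F t)′ = (f t).snd := by
  have hu : ∀ y : nonZeroDivisors T, IsUnit (f y) := fun y => by
    rw [TrivSqZeroExt.isUnit_iff_isUnit_fst, hf]
    exact IsLocalization.map_units F y
  let g : F →+* DualNumber F := IsLocalization.lift hu
  have hg : ∀ t, g (algebraMap T F t) = f t := IsLocalization.lift_eq hu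
  -- A ring homomorphism to the dual numbers whose first component is the identity is the same as a
  -- derivation, given by its second component.
  have hfst : ∀ x, (g x).fst = x := fun x => by
    have : (TrivSqZeroExt.fstHom F F F).toRingHom.comp g = RingHom.id F :=
      IsLocalization.ringHom_ext (nonZeroDivisors T) (RingHom.ext fun t => by simp [hg, hf])
    exact congrArg (fun h : F →+* F => h x) this
  let D : Derivation ℤ F F := Derivation.mk'
    (AddMonoidHom.toIntLinearMap ⟨⟨fun x => (g x).snd, by simp⟩, fun x y => by simp⟩)
    (fun x y => by
      change (g (x * y)).snd = x • (g y).snd + y • (g x).snd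
      simp [hfst, mul_comm])
  exact ⟨⟨D⟩, fun t => by change (g _).snd = _; rw [hg]⟩

/-- The `k`-algebra homomorphism `u ↦ j u + j (u′) ε`. -/
def toDualNumber {k U F : Type u} [Field k] [Field U] [Differential U] [Algebra k U]
    [Field F] [Algebra k F] (hconst : ∀ c : k, (algebraMap k U c)′ = 0) (j : U →ₐ[k] F) :
    U →ₐ[k] DualNumber F where
  toFun u := TrivSqZeroExt.inl (j u) + TrivSqZeroExt.inr (j (u′))
  map_one' := by ext <;> simp
  map_mul' x y := by ext <;> simp [Derivation.leibniz, mul_comm]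
  map_zero' := by ext <;> simp
  map_add' x y := by ext <;> simp
  commutes' c := by
    ext
    · simp [TrivSqZeroExt.algebraMap_eq_inl']
    · simp [TrivSqZeroExt.algebraMap_eq_inl', hconst]

lemma fst_toDualNumber {k U F : Type u} [Field k] [Field U] [Differential U] [Algebra k U]
    [Field F] [Algebra k F] (hconst : ∀ c : k, (algebraMap k U c)′ = 0) (j : U →ₐ[k] F) (u : U) :
    (toDualNumber hconst j u).fst = j u := by simp [toDualNumber]

lemma snd_toDualNumber {k U F : Type u} [Field k] [Field U] [Differential U] [Algebra k U]
    [Field F] [Algebra k F] (hconst : ∀ c : k, (algebraMap k U c)′ = 0) (j : U →ₐ[k] F) (u : U) :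
    (toDualNumber hconst j u).snd = j (u′) := by simp [toDualNumber]

/-- The linear forms dual to `b` extend to all of `V`; tensored with the identity of `W`, they read
off each `l i`. -/
lemma eq_zero_of_sum_tmul_eq_zero {k V W : Type*} [Field k] [AddCommGroup V] [Module k V]
    [AddCommGroup W] [Module k W] {n : ℕ} {b : Fin n → V} (hb : LinearIndependent k b)
    {l : Fin n → W} (h : ∑ i, b i ⊗ₜ[k] l i = 0) : l = 0 := by
  classical
  obtain ⟨g, hg⟩ := (Fintype.linearCombination k b).exists_leftInverse_of_injective
    (LinearMap.ker_eq_bot.2 hb.fintypeLinearCombination_injective)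
  ext i
  have h1 := congrArg (fun t => TensorProduct.lid k W (LinearMap.rTensor W (LinearMap.proj i ∘ₗ g) t)) h
  have h2 : ∀ j, g (b j) = Pi.single j 1 := fun j => by
    have := congrArg (fun f => f (Pi.single j 1)) hg
    simpa [Fintype.linearCombination_apply_single] using this
  simpa [h2, Pi.single_apply, ite_smul] using h1

/-- A differential field containing two linearly disjoint copies of `U` over an algebraically closed
field of constants `k`. -/
lemma exists_linearlyDisjoint_copies (k U : Type u) [Field k] [IsAlgClosed k] [Field U]
    [Differential U] [Algebra k U] (hconst : ∀ c : k, (algebraMap k U c)′ = 0) :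
    ∃ (F : Type u) (_ : Field F) (_ : Differential F) (ι₁ ι₂ : U →+* F),
      (∀ u, (ι₁ u)′ = ι₁ (u′)) ∧ (∀ u, (ι₂ u)′ = ι₂ (u′)) ∧
      (∀ c : k, ι₁ (algebraMap k U c) = ι₂ (algebraMap k U c)) ∧
      ∀ (n : ℕ) (b : Fin n → U), LinearIndependent k b → ∀ l : Fin n → U,
        ∑ i, ι₁ (b i) * ι₂ (l i) = 0 → l = 0 := by
  let T := U ⊗[k] U
  have : IsDomain T := isDomain_tensorProduct k U U
  let F := FractionRing T
  let j₁ : U →ₐ[k] F := (IsScalarTower.toAlgHom k T F).comp Algebra.TensorProduct.includeLeft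
  let j₂ : U →ₐ[k] F := (IsScalarTower.toAlgHom k T F).comp Algebra.TensorProduct.includeRight
  -- This encodes the derivation `x ⊗ y ↦ x′ ⊗ y + x ⊗ y′`. It is well defined over `k` because the
  -- elements of `k` are constants.
  let f : T →ₐ[k] DualNumber F := Algebra.TensorProduct.productMap (toDualNumber hconst j₁) (toDualNumber hconst j₂)
  have hf : (TrivSqZeroExt.fstHom k F F).comp f = IsScalarTower.toAlgHom k T F := by
    ext u
    · exact (congrArg TrivSqZeroExt.fst (Algebra.TensorProduct.productMap_left_apply _ _ u)).trans
        (fst_toDualNumber hconst j₁ u)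
    · exact (congrArg TrivSqZeroExt.fst (Algebra.TensorProduct.productMap_right_apply _ _ u)).trans
        (fst_toDualNumber hconst j₂ u)
  obtain ⟨_, hD⟩ := exists_differential_of_dualNumber (F := F) f.toRingHom
    (fun t => congrArg (fun h : T →ₐ[k] F => h t) hf)
  refine ⟨F, inferInstance, inferInstance, j₁.toRingHom, j₂.toRingHom, fun u => ?_, fun u => ?_,
    fun c => ?_, fun n b hb l h => ?_⟩
  · exact (hD _).trans ((congrArg TrivSqZeroExt.snd
      (Algebra.TensorProduct.productMap_left_apply _ _ u)).trans (snd_toDualNumber hconst j₁ u))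
  · exact (hD _).trans ((congrArg TrivSqZeroExt.snd
      (Algebra.TensorProduct.productMap_right_apply _ _ u)).trans (snd_toDualNumber hconst j₂ u))
  · exact (j₁.commutes c).trans (j₂.commutes c).symm
  · have h1 : algebraMap T F (∑ i, b i ⊗ₜ[k] l i) = 0 := by
      rw [← h, map_sum]
      refine Finset.sum_congr rfl fun i _ => ?_
      change _ = algebraMap T F (b i ⊗ₜ 1) * algebraMap T F (1 ⊗ₜ l i)
      rw [← map_mul, Algebra.TensorProduct.tmul_mul_tmul, mul_one, one_mul]
    rw [map_eq_zero_iff _ (IsFractionRing.injective T F)] at h1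
    exact eq_zero_of_sum_tmul_eq_zero hb h1

variable {U : Type u} [Field U] [Differential U]

lemma PartialEmb.exists_extension_finset {F : Type u} [Field F] [Differential F]
    (hclosed : IsDifferentiallyClosed U) (hsat : IsSaturated U) (hU : ℵ₀ < #U)
    (e : PartialEmb F U) (s : Finset F) :
    ∃ e' : PartialEmb F U, e'.Extends e ∧ ∀ a ∈ s, a ∈ e'.dom := by
  classical
  induction s using Finset.induction_on with
  | empty => exact ⟨e, .refl e, by simp⟩
  | insert a s ha ih =>
    obtain ⟨e', he', hs⟩ := ih
    obtain ⟨e'', he'', h⟩ := e'.exists_extension hclosed hsat hU a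
    refine ⟨e'', he''.trans he', fun x hx => ?_⟩
    rcases Finset.mem_insert.1 hx with rfl | hx
    · exact h
    · exact (he'' ⟨x, hs x hx⟩).1

variable {k : Type u} [Field k] [Algebra k U]

/-- A conjugate of a tuple of elements linearly independent over `k` that is linearly independent
over a given small differential field. -/
lemma exists_sameType_linearIndependent [IsAlgClosed k] (hclosed : IsDifferentiallyClosed U)
    (hsat : IsSaturated U) (hconst : ∀ c : k, (algebraMap k U c)′ = 0) (hU : ℵ₀ < #U)
    (L : Subfield U) (hL : ∀ x ∈ L, x′ ∈ L) (hkL : ∀ c : k, algebraMap k U c ∈ L) (hLU : #L < #U)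
    {n : ℕ} (b : Fin n → U) (hb : LinearIndependent k b) :
    ∃ c : Fin n → U, SameType (Set.range (algebraMap k U)) b c ∧
      ∀ l : Fin n → U, (∀ i, l i ∈ L) → ∑ i, l i * c i = 0 → l = 0 := by
  classical
  obtain ⟨F, _, _, ι₁, ι₂, h₁, h₂, hk, hind⟩ := exists_linearlyDisjoint_copies k U hconst
  -- The second copy of `L` is sent back to `L` identically. Extending this map to the first copy of
  -- `b` gives a conjugate of `b` linearly disjoint from `L`.
  obtain ⟨e₀, -, he₀⟩ := exists_partialEmb_of_field (ι₂.comp L.subtype) L.subtype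
    (fun x => ⟨⟨(x : U)′, hL x x.2⟩, h₂ _, rfl⟩) hLU
  obtain ⟨e, he, hbe⟩ := e₀.exists_extension_finset hclosed hsat hU
    (Finset.univ.image fun i => ι₁ (b i))
  replace hbe : ∀ i, ι₁ (b i) ∈ e.dom := fun i =>
    hbe _ (Finset.mem_image_of_mem _ (Finset.mem_univ i))
  have hLe : ∀ x (hx : x ∈ L), ∃ h : ι₂ x ∈ e.dom, e.hom ⟨_, h⟩ = x := fun x hx => by
    obtain ⟨h1, h2⟩ := he₀ ⟨x, hx⟩
    obtain ⟨h3, h4⟩ := he ⟨_, h1⟩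
    exact ⟨h3, h4.trans h2⟩
  -- On this subfield the inclusion and `e ∘ ι₁` are two differential embeddings agreeing on `k`;
  -- they carry `b` to itself and to its conjugate.
  let K₀ : Subfield U := e.dom.comap ι₁
  let ρ : K₀ →+* e.dom := (ι₁.comp K₀.subtype).codRestrict e.dom fun x => x.2
  refine ⟨fun i => e.hom ⟨_, hbe i⟩, fun E hE => ?_, fun l hl h => ?_⟩
  · refine mem_definable_iff_of_ringHom hclosed hsat hU K₀.subtype (e.hom.comp ρ)
      (fun p => ?_) (fun p => ?_) ?_ ?_ hE fun i => ⟨b i, hbe i⟩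
    · rw [map_eq_zero, map_eq_zero]
    · refine ⟨⟨(p : U)′, ?_⟩, rfl, ?_⟩
      · change ι₁ _ ∈ e.dom
        rw [← h₁]
        exact e.deriv_mem _ p.2
      · refine (e.comm (ρ p)).symm.trans ?_
        exact congrArg e.hom (Subtype.ext (h₁ p))
    · exact (Cardinal.mk_le_of_injective ρ.injective).trans_lt e.small
    · rintro _ ⟨a, rfl⟩
      obtain ⟨h1, h2⟩ := hLe _ (hkL a)
      rw [← hk] at h1
      refine ⟨⟨algebraMap k U a, h1⟩, rfl, ?_⟩
      refine Eq.trans ?_ h2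
      exact congrArg e.hom (Subtype.ext (hk a))
  · refine hind n b hb l ?_
    choose h3 h4 using fun i => hLe (l i) (hl i)
    have h5 : e.hom (∑ i, ⟨_, hbe i⟩ * ⟨_, h3 i⟩) = 0 := by
      rw [map_sum, ← h]
      refine Finset.sum_congr rfl fun i _ => ?_
      rw [map_mul, h4, mul_comm]
    rw [map_eq_zero] at h5
    simpa using congrArg Subtype.val h5

/-- The differential subfield generated by a set. -/
lemma exists_differential_subfield (hU : ℵ₀ < #U) (S : Set U) (hS : #S < #U) :
    ∃ L : Subfield U, (∀ x ∈ L, x′ ∈ L) ∧ S ⊆ L ∧ #L < #U := by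
  let S' : Set U := ⋃ i : ℕ, (fun a => derivs a i) '' S
  refine ⟨Subfield.closure S', fun x hx => ?_, fun a ha => ?_, ?_⟩
  · induction hx using Subfield.closure_induction with
    | mem x hx =>
      obtain ⟨i, a, ha, rfl⟩ := Set.mem_iUnion.1 hx
      exact Subfield.subset_closure (Set.mem_iUnion.2 ⟨i + 1, a, ha, derivs_succ a i⟩)
    | one => simp
    | add x y _ _ hx hy => rw [map_add]; exact add_mem hx hy
    | neg x _ hx => rw [map_neg]; exact neg_mem hx
    | inv x hx' hx =>
      rw [Derivation.leibniz_inv, smul_eq_mul]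
      exact mul_mem (neg_mem (pow_mem (inv_mem hx') 2)) hx
    | mul x y hx' hy' hx hy =>
      rw [Derivation.leibniz, smul_eq_mul, smul_eq_mul]
      exact add_mem (mul_mem hx' hy) (mul_mem hy' hx)
  · exact Subfield.subset_closure (Set.mem_iUnion.2 ⟨0, a, ha, rfl⟩)
  · refine (Subfield.cardinalMk_closure_le_max S').trans_lt (max_lt ?_ hU)
    have h1 : lift.{u} #S' ≤ sum fun i : ℕ => #((fun a => derivs a i) '' S) := by
      simpa using Cardinal.mk_iUnion_le_sum_mk_lift (f := fun i : ℕ => (fun a => derivs a i) '' S)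
    rw [lift_id] at h1
    refine h1.trans_lt ?_
    refine (Cardinal.sum_le_sum _ (fun _ => #S) fun i => Cardinal.mk_image_le).trans_lt ?_
    rw [Cardinal.sum_const]
    simp only [mk_eq_aleph0, lift_aleph0]
    exact Cardinal.mul_lt_of_lt hU.le (by simpa using hU) (by simpa using hS)

/-- A sequence of conjugates in general position of a tuple linearly independent over `k`. -/
lemma exists_seq_sameType [IsAlgClosed k] (hclosed : IsDifferentiallyClosed U)
    (hsat : IsSaturated U) (hconst : ∀ c : k, (algebraMap k U c)′ = 0) (hU : ℵ₀ < #U)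
    (hk : #k < #U) {n : ℕ} (b : Fin n → U) (hb : LinearIndependent k b) :
    ∃ c : ℕ → Fin n → U, (∀ i, SameType (Set.range (algebraMap k U)) b (c i)) ∧
      ∀ s : Finset ℕ, s.card ≤ n → LinearIndependent U fun i : s => c i := by
  classical
  -- A chain of such fields is built, each containing the conjugate chosen generically over the
  -- preceding one.
  let Good := {L : Subfield U // (∀ x ∈ L, x′ ∈ L) ∧ (∀ c : k, algebraMap k U c ∈ L) ∧ #L < #U}
  have key : ∀ L : Good, ∃ c : Fin n → U, SameType (Set.range (algebraMap k U)) b c ∧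
      ∀ l : Fin n → U, (∀ i, l i ∈ L.1) → ∑ i, l i * c i = 0 → l = 0 := fun L =>
    exists_sameType_linearIndependent hclosed hsat hconst hU L.1 L.2.1 L.2.2.1 L.2.2.2 b hb
  choose γ hγ hγ' using key
  have next : ∀ L : Good, ∃ L' : Good, L.1 ≤ L'.1 ∧ ∀ i, γ L i ∈ L'.1 := fun L => by
    obtain ⟨L', h1, h2, h3⟩ := exists_differential_subfield hU ((L.1 : Set U) ∪ Set.range (γ L)) (by
      refine (Cardinal.mk_union_le _ _).trans_lt (Cardinal.add_lt_of_lt hU.le L.2.2.2 ?_)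
      exact (Set.finite_range _).lt_aleph0.trans hU)
    exact ⟨⟨L', h1, fun c => h2 (Or.inl (L.2.2.1 c)), h3⟩, fun x hx => h2 (Or.inl hx),
      fun i => h2 (Or.inr ⟨i, rfl⟩)⟩
  choose ν hν hν' using next
  obtain ⟨L₀, h1, h2, h3⟩ := exists_differential_subfield hU (Set.range (algebraMap k U))
    (Cardinal.mk_range_le.trans_lt hk)
  let chain : ℕ → Good := fun i => ν^[i] ⟨L₀, h1, fun c => h2 ⟨c, rfl⟩, h3⟩
  have hchain : ∀ i, chain (i + 1) = ν (chain i) := fun i => Function.iterate_succ_apply' _ _ _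
  have hmono : Monotone fun i => (chain i).1 := monotone_nat_of_le_succ fun i => by
    rw [hchain]; exact hν _
  have hmem : ∀ a, ∀ i < a, ∀ j, γ (chain i) j ∈ (chain a).1 := fun a i hi j =>
    hmono (Nat.succ_le_of_lt hi) (by simp only [hchain]; exact hν' _ _)
  have hind : ∀ s : Finset ℕ, s.card ≤ n → ∀ g : ℕ → U, ∑ i ∈ s, g i • γ (chain i) = 0 →
      ∀ i ∈ s, g i = 0 := by
    intro s
    induction s using Finset.induction_on_max with
    | empty => simp
    | insert a s ha ih =>
      intro hs g hg
      have has : a ∉ s := fun h => (ha a h).false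
      rw [Finset.card_insert_of_notMem has] at hs
      let La := (chain a).1
      let f : (Fin n → La) →ₗ[La] (s → La) := LinearMap.pi fun i =>
        Fintype.linearCombination La (fun j => (⟨γ (chain i) j, hmem a i (ha i i.2) j⟩ : La))
      -- Fewer than `n` vectors are indexed by `s`, so a nonzero linear form over the field `La`
      -- kills them all. It does not kill the vector of index `a`, which is generic over `La`; so
      -- that vector has coefficient zero.
      obtain ⟨h, hf, h0⟩ := (Submodule.ne_bot_iff _).1 (f.ker_ne_bot_of_finrank_lt
        (by simpa using hs))
      have hf' : ∀ i ∈ s, ∑ j, (h j : U) * γ (chain i) j = 0 := fun i hi => by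
        have := congrArg Subtype.val (congrFun (LinearMap.mem_ker.1 hf) ⟨i, hi⟩)
        simpa [f, Fintype.linearCombination_apply] using this
      have ha' : ∑ j, (h j : U) * γ (chain a) j ≠ 0 := fun h1 => h0 (funext fun j =>
        Subtype.ext (congrFun (hγ' _ (fun j => (h j : U)) (fun j => (h j).2) h1) j))
      have hga : g a = 0 := by
        have h2 : ∑ j, (h j : U) * (∑ i ∈ insert a s, g i • γ (chain i)) j = 0 := by
          rw [hg]; simp
        simp only [Finset.sum_apply, Pi.smul_apply, smul_eq_mul, Finset.mul_sum] at h2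
        rw [Finset.sum_comm] at h2
        have h3 : ∀ i, ∑ j, (h j : U) * (g i * γ (chain i) j) =
            g i * ∑ j, (h j : U) * γ (chain i) j := fun i => by
          rw [Finset.mul_sum]
          exact Finset.sum_congr rfl fun j _ => by ring
        simp only [h3] at h2
        rw [Finset.sum_insert has, Finset.sum_eq_zero (s := s) (fun i hi => by
          rw [hf' i hi, mul_zero]), add_zero] at h2
        exact (mul_eq_zero.1 h2).resolve_right ha'
      rw [Finset.sum_insert has, hga, zero_smul, zero_add] at hg
      intro i hi
      rcases Finset.mem_insert.1 hi with rfl | hi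
      · exact hga
      · exact ih (by omega) g hg i hi
  refine ⟨fun i => γ (chain i), fun i => hγ _, fun s hs => ?_⟩
  exact (linearIndepOn_finset_iff (s := s) (v := fun i => γ (chain i))).2 (hind s hs)

end Free

/-! ### The function field of a variety -/

section FunctionField

variable {k : Type u} [Field k]

instance (X : SmoothVariety k) : AlgebraicGeometry.IsIntegral X.scheme := X.isIntegral

instance (X : SmoothVariety k) : QuasiCompact X.str := X.quasiCompact

instance (X : SmoothVariety k) : LocallyOfFiniteType X.str := X.locallyOfFiniteType

/-- The function field. -/
def SmoothVariety.functionField (X : SmoothVariety k) : Type u := X.scheme.functionField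

instance (X : SmoothVariety k) : Field X.functionField :=
  inferInstanceAs (Field X.scheme.functionField)

/-- The generic point. -/
abbrev SmoothVariety.generic (X : SmoothVariety k) : X.scheme := genericPoint X.scheme

variable (X : SmoothVariety k)

lemma SmoothVariety.generic_mem_top : X.generic ∈ (⊤ : X.scheme.Opens) := trivial

lemma SmoothVariety.generic_mem {V : X.scheme.Opens} {x : X.scheme} (hx : x ∈ V) : X.generic ∈ V :=
  ((genericPoint_spec X.scheme).mem_open_set_iff V.isOpen).2 ⟨x, trivial, hx⟩

/-- The germ of a regular function at the generic point. -/
def SmoothVariety.germ (V : X.scheme.Opens) (hV : X.generic ∈ V) :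
    Γ(X.scheme, V) →+* X.functionField :=
  (X.scheme.presheaf.germ V X.generic hV).hom

/-- Restriction of regular functions. -/
abbrev SmoothVariety.res {V W : X.scheme.Opens} (h : V ≤ W) : Γ(X.scheme, W) ⟶ Γ(X.scheme, V) :=
  X.scheme.presheaf.map (homOfLE h).op

lemma SmoothVariety.germ_res {V W : X.scheme.Opens} (h : V ≤ W) (hV : X.generic ∈ V)
    (f : Γ(X.scheme, W)) : X.germ V hV (X.res h f) = X.germ W (h hV) f :=
  X.scheme.presheaf.germ_res_apply _ _ _ _

lemma SmoothVariety.germ_injective (V : X.scheme.Opens) (hV : X.generic ∈ V) :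
    Function.Injective (X.germ V hV) :=
  germ_injective_of_isIntegral X.scheme X.generic hV

lemma SmoothVariety.exists_germ (g : X.functionField) :
    ∃ (V : X.scheme.Opens) (hV : X.generic ∈ V) (f : Γ(X.scheme, V)), X.germ V hV f = g :=
  X.scheme.presheaf.exists_germ_eq g

lemma SmoothVariety.exists_germ_of_finite {n : ℕ} (g : Fin n → X.functionField) :
    ∃ (V : X.scheme.Opens) (hV : X.generic ∈ V) (f : Fin n → Γ(X.scheme, V)),
      ∀ i, X.germ V hV (f i) = g i := by
  induction n with
  | zero => exact ⟨⊤, X.generic_mem_top, Fin.elim0, fun i => i.elim0⟩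
  | succ n ih =>
    obtain ⟨V, hV, f, hf⟩ := ih (fun i => g i.succ)
    obtain ⟨W, hW, f₀, hf₀⟩ := X.exists_germ (g 0)
    have hVW : X.generic ∈ V ⊓ W := ⟨hV, hW⟩
    refine ⟨V ⊓ W, hVW, Fin.cons (X.res inf_le_right f₀) fun i => X.res inf_le_left (f i),
      fun i => ?_⟩
    refine Fin.cases ?_ (fun i => ?_) i
    · rw [Fin.cons_zero, X.germ_res, hf₀]
    · rw [Fin.cons_succ, X.germ_res, hf]

lemma SmoothVariety.res_const {V W : X.scheme.Opens} (h : V ≤ W) (c : k) :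
    X.res h (X.const W c) = X.const V c := by
  simp only [SmoothVariety.const, SmoothVariety.res, ← CategoryTheory.comp_apply, Category.assoc,
    ← Functor.map_comp]
  rfl

instance : Algebra k X.functionField :=
  ((X.germ ⊤ X.generic_mem_top).comp (X.const ⊤).hom).toAlgebra

lemma SmoothVariety.germ_const (V : X.scheme.Opens) (hV : X.generic ∈ V) (c : k) :
    X.germ V hV (X.const V c) = algebraMap k X.functionField c := by
  rw [← X.res_const (le_top : V ≤ ⊤), X.germ_res]
  rfl

variable {X}

/-- This makes the derivation of `k(X)` independent of the regular function chosen to represent a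
germ. -/
lemma VectorField.germ_der_eq (v : VectorField X) {V W : X.scheme.Opens} (hV : X.generic ∈ V)
    (hW : X.generic ∈ W) (f : Γ(X.scheme, V)) (g : Γ(X.scheme, W))
    (h : X.germ V hV f = X.germ W hW g) :
    X.germ V hV (v.der V f) = X.germ W hW (v.der W g) := by
  have hVW : X.generic ∈ V ⊓ W := ⟨hV, hW⟩
  have h1 : X.res inf_le_left f = X.res (inf_le_right : V ⊓ W ≤ W) g :=
    X.germ_injective (V ⊓ W) hVW (by rw [X.germ_res, X.germ_res, h])
  rw [← X.germ_res (inf_le_left : V ⊓ W ≤ V) hVW,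
    ← X.germ_res (inf_le_right : V ⊓ W ≤ W) hVW]
  have h2 := congrArg (v.der (V ⊓ W)) h1
  rw [v.map_res, v.map_res] at h2
  rw [h2]

/-- The function underlying the derivation of the function field. -/
def VectorField.derFun (v : VectorField X) (g : X.functionField) : X.functionField :=
  X.germ _ (X.exists_germ g).choose_spec.choose
    (v.der _ (X.exists_germ g).choose_spec.choose_spec.choose)

lemma VectorField.derFun_germ (v : VectorField X) (V : X.scheme.Opens) (hV : X.generic ∈ V)
    (f : Γ(X.scheme, V)) : v.derFun (X.germ V hV f) = X.germ V hV (v.der V f) :=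
  v.germ_der_eq _ _ _ _ (X.exists_germ _).choose_spec.choose_spec.choose_spec

lemma SmoothVariety.exists_germ₂ (g h : X.functionField) :
    ∃ (V : X.scheme.Opens) (hV : X.generic ∈ V) (a b : Γ(X.scheme, V)),
      X.germ V hV a = g ∧ X.germ V hV b = h := by
  obtain ⟨V, hV, f, hf⟩ := X.exists_germ_of_finite ![g, h]
  exact ⟨V, hV, f 0, f 1, hf 0, hf 1⟩

/-- The derivation of the function field defined by a vector field. -/
def VectorField.derivation (v : VectorField X) : Derivation ℤ X.functionField X.functionField :=
  Derivation.mk' (AddMonoidHom.toIntLinearMap (AddMonoidHom.mk' v.derFun fun g h => by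
    obtain ⟨V, hV, a, b, rfl, rfl⟩ := SmoothVariety.exists_germ₂ g h
    rw [← map_add, v.derFun_germ, v.derFun_germ, v.derFun_germ, map_add, map_add])) fun g h => by
    obtain ⟨V, hV, a, b, rfl, rfl⟩ := SmoothVariety.exists_germ₂ g h
    simp only [AddMonoidHom.coe_toIntLinearMap, AddMonoidHom.mk'_apply, smul_eq_mul]
    rw [← map_mul, v.derFun_germ, v.derFun_germ, v.derFun_germ, v.leibniz, map_add, map_mul,
      map_mul]

lemma VectorField.derivation_germ (v : VectorField X) (V : X.scheme.Opens) (hV : X.generic ∈ V)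
    (f : Γ(X.scheme, V)) : v.derivation (X.germ V hV f) = X.germ V hV (v.der V f) :=
  v.derFun_germ V hV f

lemma VectorField.derivation_algebraMap (v : VectorField X) (c : k) :
    v.derivation (algebraMap k X.functionField c) = 0 := by
  rw [← X.germ_const ⊤ X.generic_mem_top, v.derivation_germ, v.map_const, map_zero]

end FunctionField

/-! ### Points -/

section Points

variable {k : Type u} [Field k] {X : SmoothVariety k} {K : Type u} [Field K] [Algebra k K]

lemma SmoothVariety.const_top : X.const ⊤ = (Scheme.ΓSpecIso (.of k)).inv ≫ X.str.appTop := by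
  have : (homOfLE (le_top : (⊤ : X.scheme.Opens) ≤ ⊤)).op = 𝟙 _ := Subsingleton.elim _ _
  rw [SmoothVariety.const, this, CategoryTheory.Functor.map_id, Category.comp_id]

lemma SmoothVariety.fromSpecStalk_str (x : X.scheme) :
    X.scheme.fromSpecStalk x ≫ X.str = Spec.map (X.const ⊤ ≫ X.scheme.presheaf.germ ⊤ x trivial) := by
  rw [← cancel_mono (Spec (.of k)).toSpecΓ, Category.assoc, Scheme.toSpecΓ_naturality,
    Scheme.fromSpecStalk_toSpecΓ_assoc, ← SpecMap_ΓSpecIso_hom, ← Spec.map_comp,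
    ← Spec.map_comp, SmoothVariety.const_top, Category.assoc, Iso.hom_inv_id_assoc]

/-- Evaluation at a point, as a ring homomorphism. -/
def Point.evalHom (x : Point X K) (V : X.scheme.Opens) (hx : x.pt ∈ V) : Γ(X.scheme, V) →+* K :=
  x.stalkEval.comp (X.scheme.presheaf.germ V x.pt hx).hom

lemma Point.evalHom_apply (x : Point X K) (V : X.scheme.Opens) (hx : x.pt ∈ V)
    (f : Γ(X.scheme, V)) : x.evalHom V hx f = x.eval V hx f := rfl

lemma Point.eval_res (x : Point X K) {V W : X.scheme.Opens} (h : V ≤ W) (hx : x.pt ∈ V)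
    (f : Γ(X.scheme, W)) : x.eval V hx (X.res h f) = x.eval W (h hx) f :=
  congrArg x.stalkEval (X.scheme.presheaf.germ_res_apply _ _ _ _)

lemma SmoothVariety.const_comp_stalkClosedPointTo {R : CommRingCat.{u}} [IsLocalRing R]
    (x : Spec R ⟶ X.scheme) (φ : CommRingCat.of k ⟶ R) (hx : x ≫ X.str = Spec.map φ) :
    X.const ⊤ ≫ X.scheme.presheaf.germ ⊤ (x (IsLocalRing.closedPoint R)) trivial ≫
      Scheme.stalkClosedPointTo x = φ := by
  apply Spec.map_injective
  rw [← hx, ← Category.assoc, Spec.map_comp, ← X.fromSpecStalk_str, ← Category.assoc,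
    Scheme.Spec_stalkClosedPointTo_fromSpecStalk]

lemma Point.eval_const (x : Point X K) (V : X.scheme.Opens) (hx : x.pt ∈ V) (c : k) :
    x.eval V hx (X.const V c) = algebraMap k K c := by
  rw [← X.res_const (le_top : V ≤ ⊤), x.eval_res]
  exact congrArg (fun f => f.hom c) (X.const_comp_stalkClosedPointTo x.1 _ x.2)

instance (x : Point X K) : IsLocalHom x.stalkEval :=
  inferInstanceAs (IsLocalHom (Scheme.stalkClosedPointTo x.1).hom)

/-- Both sides say that the germ of `f` is not a unit, because `x.stalkEval` is a local
homomorphism. -/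
lemma Point.eval_eq_zero_iff (x : Point X K) (V : X.scheme.Opens) (hx : x.pt ∈ V)
    (f : Γ(X.scheme, V)) : x.eval V hx f = 0 ↔ X.scheme.evaluation V x.pt hx f = 0 := by
  rw [Scheme.evaluation_eq_zero_iff_notMem_basicOpen, Scheme.mem_basicOpen _ _ _ hx,
    Point.eval, ← isUnit_map_iff x.stalkEval, isUnit_iff_ne_zero, not_not]

lemma Point.ext_of_eval (x y : Point X K) (h : x.pt = y.pt)
    (he : ∀ (V : X.scheme.Opens) (hx : x.pt ∈ V) (hy : y.pt ∈ V) (f : Γ(X.scheme, V)),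
      x.eval V hx f = y.eval V hy f) : x = y := by
  refine Subtype.ext ((SpecToEquivOfLocalRing X.scheme (CommRingCat.of K)).injective ?_)
  rw [SpecToEquivOfLocalRing_eq_iff]
  refine ⟨h, TopCat.Presheaf.stalk_hom_ext _ fun V hV => ?_⟩
  ext f
  have hy : y.pt ∈ V := h ▸ hV
  refine (he V hV hy f).trans (congrArg y.stalkEval ?_)
  exact (congrArg (fun g => g.hom f)
    (X.scheme.presheaf.germ_stalkSpecializes (U := V) hV (specializes_of_eq h.symm))).symm

/-- An embedding of the function field, as a morphism of commutative rings. -/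
def embHom (φ : X.functionField →ₐ[k] K) :
    X.scheme.presheaf.stalk X.generic ⟶ CommRingCat.of K :=
  CommRingCat.ofHom (R := X.scheme.presheaf.stalk X.generic) φ.toRingHom

instance isLocalHom_embHom (φ : X.functionField →ₐ[k] K) : IsLocalHom (embHom φ).hom :=
  inferInstanceAs (IsLocalHom φ.toRingHom)

/-- The generic point of `X` with coordinates given by an embedding of the function field. -/
def Point.ofEmb (φ : X.functionField →ₐ[k] K) : Point X K :=
  ⟨Spec.map (embHom φ) ≫ X.scheme.fromSpecStalk X.generic, by
    rw [Category.assoc, X.fromSpecStalk_str, ← Spec.map_comp]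
    exact congrArg Spec.map (CommRingCat.hom_ext (RingHom.ext fun c => φ.commutes c))⟩

lemma Point.pt_ofEmb (φ : X.functionField →ₐ[k] K) : (Point.ofEmb φ).pt = X.generic := by
  refine (Scheme.Hom.comp_apply _ _ _).trans ?_
  refine (congrArg _ (Spec_closedPoint (f := embHom φ))).trans ?_
  rw [Scheme.fromSpecStalk_closedPoint]

lemma Point.eval_ofEmb (φ : X.functionField →ₐ[k] K) (V : X.scheme.Opens)
    (hx : (Point.ofEmb φ).pt ∈ V) (hV : X.generic ∈ V) (f : Γ(X.scheme, V)) :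
    (Point.ofEmb φ).eval V hx f = φ (X.germ V hV f) :=
  congrArg (fun g => g.hom f)
    (Scheme.germ_stalkClosedPointTo_Spec_fromSpecStalk (embHom φ) V hx)

/-- The embedding of the function field defined by a generic point. -/
def Point.toEmbHom (x : Point X K) (hx : x.pt = X.generic) : X.functionField →+* K :=
  x.stalkEval.comp (X.scheme.presheaf.stalkSpecializes (specializes_of_eq hx)).hom

lemma Point.toEmbHom_germ (x : Point X K) (hx : x.pt = X.generic) (V : X.scheme.Opens)
    (hV : X.generic ∈ V) (hxV : x.pt ∈ V) (f : Γ(X.scheme, V)) :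
    x.toEmbHom hx (X.germ V hV f) = x.eval V hxV f :=
  congrArg x.stalkEval (congrArg (fun g => g.hom f)
    (X.scheme.presheaf.germ_stalkSpecializes (U := V) hV (specializes_of_eq hx)))

/-- The embedding of the function field defined by a generic point. -/
def Point.toEmb (x : Point X K) (hx : x.pt = X.generic) : X.functionField →ₐ[k] K :=
  { x.toEmbHom hx with
    commutes' := fun c => by
      have := x.toEmbHom_germ hx ⊤ X.generic_mem_top trivial (X.const ⊤ c)
      rw [X.germ_const] at this
      exact this.trans (x.eval_const ⊤ _ c) }

lemma Point.toEmb_germ (x : Point X K) (hx : x.pt = X.generic) (V : X.scheme.Opens)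
    (hV : X.generic ∈ V) (hxV : x.pt ∈ V) (f : Γ(X.scheme, V)) :
    x.toEmb hx (X.germ V hV f) = x.eval V hxV f :=
  x.toEmbHom_germ hx V hV hxV f

lemma Point.ofEmb_toEmb (x : Point X K) (hx : x.pt = X.generic) : Point.ofEmb (x.toEmb hx) = x :=
  Point.ext_of_eval _ _ ((Point.pt_ofEmb _).trans hx.symm) fun V h1 h2 f => by
    have hV : X.generic ∈ V := hx ▸ h2
    rw [Point.eval_ofEmb _ V h1 hV, x.toEmb_germ hx V hV h2]

lemma Point.ofEmb_injective : Function.Injective (Point.ofEmb (X := X) (K := K)) := by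
  intro φ ψ h
  ext g
  obtain ⟨V, hV, f, rfl⟩ := X.exists_germ g
  have h1 : (Point.ofEmb φ).pt ∈ V := by rwa [Point.pt_ofEmb]
  have h2 : (Point.ofEmb ψ).pt ∈ V := by rwa [Point.pt_ofEmb]
  rw [← Point.eval_ofEmb φ V h1 hV, ← Point.eval_ofEmb ψ V h2 hV]
  congr 1

end Points

/-! ### Invariant closed sets -/

section Topology

variable {Y : Type*} [TopologicalSpace Y]

lemma krullDim_pos_of_specializes [T0Space Y] {Z : Set Y} {a b : Y} (ha : a ∈ Z) (hb : b ∈ Z)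
    (hab : a ⤳ b) (hne : a ≠ b) : 0 < topologicalKrullDim Z := by
  have hab' : (⟨a, ha⟩ : Z) ⤳ ⟨b, hb⟩ := (subtype_specializes_iff _ _).2 hab
  refine Order.krullDim_pos_iff.2 ⟨⟨closure {(⟨b, hb⟩ : Z)}, isIrreducible_singleton.closure,
    isClosed_closure⟩, ⟨closure {(⟨a, ha⟩ : Z)}, isIrreducible_singleton.closure,
    isClosed_closure⟩, lt_of_le_of_ne hab'.closure_subset fun h => hne ?_⟩
  have h1 : closure {(⟨b, hb⟩ : Z)} = closure {(⟨a, ha⟩ : Z)} :=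
    congrArg IrreducibleCloseds.carrier h
  have h2 : (⟨b, hb⟩ : Z) ⤳ ⟨a, ha⟩ := specializes_iff_closure_subset.2 h1.ge
  exact (hab.antisymm ((subtype_specializes_iff _ _).1 h2)).eq

/-- Each irreducible component has a generic point, which specializes to all its points and hence
equals them. So a point is determined by its component, and there are finitely many components. -/
lemma finite_of_forall_eq_of_specializes [QuasiSober Y] [NoetherianSpace Y] {Z : Set Y}
    (hZ : IsClosed Z) (h : ∀ a ∈ Z, ∀ b ∈ Z, a ⤳ b → a = b) : Z.Finite := by
  have : QuasiSober Z := hZ.isClosedEmbedding_subtypeVal.quasiSober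
  have : NoetherianSpace Z := Topology.IsInducing.subtypeVal.noetherianSpace
  have hfin := NoetherianSpace.finite_irreducibleComponents (α := Z)
  have hZ' : ∀ a b : Z, a ⤳ b → a = b := fun a b hab =>
    Subtype.ext (h a a.2 b b.2 ((subtype_specializes_iff _ _).1 hab))
  have key : ∀ z : Z, irreducibleComponent z = closure {z} := fun z => by
    obtain ⟨η, hη⟩ := QuasiSober.sober (isIrreducible_irreducibleComponent (x := z))
      isClosed_irreducibleComponent
    have : η ⤳ z := hη.specializes mem_irreducibleComponent
    exact hη.symm.trans (by rw [hZ' η z this])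
  have : Finite (irreducibleComponents Z) := hfin
  rw [Set.finite_coe_iff.symm]
  refine Finite.of_injective (β := irreducibleComponents Z)
    (fun z => ⟨irreducibleComponent z, irreducibleComponent_mem_irreducibleComponents z⟩)
    (fun a b hab => ?_)
  have h1 : irreducibleComponent a = irreducibleComponent b := congrArg Subtype.val hab
  rw [key, key] at h1
  exact hZ' a b (specializes_iff_closure_subset.2 h1.ge)

/-- The middle term of a chain of three irreducible closed sets is proper and has positive
dimension. -/
lemma exists_of_two_le_topologicalKrullDim (h : 2 ≤ topologicalKrullDim Y) [QuasiSober Y]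
    [T0Space Y] : ∃ Z : Set Y, IsClosed Z ∧ Z ≠ Set.univ ∧ 0 < topologicalKrullDim Z := by
  obtain ⟨l, hl⟩ := Order.le_krullDim_iff (n := 2).1 h
  let Z : Fin 3 → IrreducibleCloseds Y := fun i => l (i.cast (by rw [hl]))
  have hZ : StrictMono Z := fun i j hij => l.strictMono hij
  obtain ⟨a, ha⟩ := QuasiSober.sober (Z 1).isIrreducible' (Z 1).isClosed'
  obtain ⟨b, hb⟩ := QuasiSober.sober (Z 0).isIrreducible' (Z 0).isClosed'
  have h01 : (Z 0).carrier ⊆ (Z 1).carrier := (hZ (by decide : (0 : Fin 3) < 1)).le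
  have hb1 : b ∈ (Z 1).carrier := h01 hb.mem
  refine ⟨(Z 1).carrier, (Z 1).isClosed', fun h1 => ?_, krullDim_pos_of_specializes ha.mem hb1
    (ha.specializes hb1) ?_⟩
  · have h2 := hZ (by decide : (1 : Fin 3) < 2)
    exact h2.not_ge fun x _ => by
      change x ∈ (Z 1).carrier
      rw [h1]; trivial
  · rintro rfl
    exact (hZ (by decide : (0 : Fin 3) < 1)).not_ge (ha.symm.trans hb).le

end Topology

/-! ### Invariant sets attached to a vector field and to its solutions. -/

section Invariant

variable {k : Type u} [Field k]

instance (X : SmoothVariety k) : IsLocallyNoetherian X.scheme :=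
  LocallyOfFiniteType.isLocallyNoetherian X.str

instance (X : SmoothVariety k) : CompactSpace X.scheme :=
  (quasiCompact_iff_compactSpace (f := X.str)).1 inferInstance

instance (X : SmoothVariety k) : IsNoetherian X.scheme where

variable {X : SmoothVariety k}

/-- Closed sets that are invariant are trivial. -/
def VectorField.IsSimple (v : VectorField X) : Prop :=
  ∀ Z : Set X.scheme, v.IsClosedInvariant Z → Z ≠ Set.univ → ¬ 0 < topologicalKrullDim Z

lemma VectorField.IsSimple.eq_of_specializes {v : VectorField X} (hv : v.IsSimple)
    {Z : Set X.scheme} (hZ : v.IsClosedInvariant Z) (hZ' : Z ≠ Set.univ) {a b : X.scheme}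
    (ha : a ∈ Z) (hb : b ∈ Z) (hab : a ⤳ b) : a = b := by
  by_contra h
  exact hv Z hZ hZ' (krullDim_pos_of_specializes ha hb hab h)

/-- The set of scheme-theoretic points at which a vector field vanishes. -/
def VectorField.zeroLocus (v : VectorField X) : Set X.scheme :=
  {x | ∀ (V : X.scheme.Opens) (hx : x ∈ V) (f : Γ(X.scheme, V)),
    X.scheme.evaluation V x hx (v.der V f) = 0}

/-- On this set every `v.der V f` vanishes, whether or not `f` does. -/
lemma VectorField.isClosedInvariant_zeroLocus (v : VectorField X) :
    v.IsClosedInvariant v.zeroLocus := by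
  refine ⟨?_, fun V f _ z hz hzZ => hzZ V hz f⟩
  rw [← isOpen_compl_iff, isOpen_iff_forall_mem_open]
  intro x hx
  simp only [VectorField.zeroLocus, Set.mem_compl_iff, Set.mem_ofPred_eq, not_forall] at hx
  obtain ⟨V, hxV, f, hf⟩ := hx
  refine ⟨X.scheme.basicOpen (v.der V f), fun y hy hyZ => ?_, (X.scheme.basicOpen _).isOpen,
    (X.scheme.evaluation_ne_zero_iff_mem_basicOpen x hxV _).1 hf⟩
  have hyV : y ∈ V := X.scheme.basicOpen_le _ hy
  exact (X.scheme.evaluation_ne_zero_iff_mem_basicOpen y hyV _).2 hy (hyZ V hyV f)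

/-- If `v` vanished at every point, every closed subset would be invariant; dimension at least 2
then contradicts simplicity. -/
lemma VectorField.IsSimple.zeroLocus_ne_univ {v : VectorField X} (hv : v.IsSimple)
    (hdim : 2 ≤ topologicalKrullDim X.scheme) : v.zeroLocus ≠ Set.univ := by
  intro h
  obtain ⟨Z, hZ, hZ', hZ''⟩ := exists_of_two_le_topologicalKrullDim hdim
  refine hv Z ⟨hZ, fun V f _ z hz _ => ?_⟩ hZ' hZ''
  have : z ∈ v.zeroLocus := h ▸ Set.mem_univ z
  exact this V hz f

lemma VectorField.IsSimple.finite_zeroLocus {v : VectorField X} (hv : v.IsSimple)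
    (hdim : 2 ≤ topologicalKrullDim X.scheme) : v.zeroLocus.Finite :=
  finite_of_forall_eq_of_specializes v.isClosedInvariant_zeroLocus.1 fun _ ha _ hb hab =>
    hv.eq_of_specializes v.isClosedInvariant_zeroLocus (hv.zeroLocus_ne_univ hdim) ha hb hab

lemma Point.comp_str_eq_id (x : Point X k) : x.1 ≫ X.str = 𝟙 _ := by
  rw [x.2]
  exact Spec.map_id _

lemma Point.pt_injective [IsAlgClosed k] : Function.Injective (Point.pt : Point X k → X.scheme) :=
  fun x y h => Subtype.ext
    (ext_of_apply_closedPoint_eq X.str x.comp_str_eq_id y.comp_str_eq_id h)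

theorem VectorField.IsSimple.finite_sing [IsAlgClosed k] {v : VectorField X} (hv : v.IsSimple)
    (hdim : 2 ≤ topologicalKrullDim X.scheme) : v.sing.Finite :=
  Set.Finite.of_finite_image ((hv.finite_zeroLocus hdim).subset (by
    rintro _ ⟨x, hx, rfl⟩ V hxV f
    exact (x.eval_eq_zero_iff V hxV _).1 (hx V hxV f))) Point.pt_injective.injOn

variable {U : Type u} [Field U] [Algebra k U]

/-- The function `f - f(y)` vanishes at the common underlying point, hence at `x`. -/
lemma Point.eval_of_pt_eq (x : Point X U) (y : Point X k) (h : x.pt = y.pt) (V : X.scheme.Opens)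
    (hx : x.pt ∈ V) (hy : y.pt ∈ V) (f : Γ(X.scheme, V)) :
    x.eval V hx f = algebraMap k U (y.eval V hy f) := by
  have key : ∀ (z : X.scheme) (hz : z ∈ V) (hzy : z = y.pt),
      X.scheme.evaluation V z hz (f - X.const V (y.eval V hy f)) = 0 := by
    rintro z hz rfl
    rw [← y.eval_eq_zero_iff, ← y.evalHom_apply, map_sub, y.evalHom_apply, y.evalHom_apply,
      y.eval_const]
    exact sub_self _
  have h1 := (x.eval_eq_zero_iff V hx _).2 (key x.pt hx h)
  rw [← x.evalHom_apply, map_sub, x.evalHom_apply, x.evalHom_apply, x.eval_const, sub_eq_zero] at h1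
  exact h1

lemma Point.pt_extend (y : Point X k) : (y.extend U).pt = y.pt := by
  refine (Scheme.Hom.comp_apply _ _ _).trans ?_
  exact congrArg y.1 (Subsingleton.elim _ _)

lemma Point.eq_extend (x : Point X U) (y : Point X k) (h : x.pt = y.pt) : x = y.extend U :=
  Point.ext_of_eval _ _ (h.trans (Point.pt_extend y).symm) fun V hx hx' f => by
    have hy : y.pt ∈ V := h ▸ hx
    rw [x.eval_of_pt_eq y h V hx hy, (y.extend U).eval_of_pt_eq y y.pt_extend V hx' hy]

lemma Point.exists_pt_eq [IsAlgClosed k] (z : X.scheme) (hz : IsClosed {z}) :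
    ∃ y : Point X k, y.pt = z :=
  ⟨⟨pointOfClosedPoint X.str z hz, by
    rw [pointOfClosedPoint_comp]
    exact (Spec.map_id _).symm⟩, pointOfClosedPoint_apply X.str z hz _⟩

variable [Differential U]

/-- If `f(x) = 0` then `v(f)(x) = f(x)′ = 0`, and a function vanishing at `x` vanishes at all
specializations of its underlying point. -/
lemma VectorField.isClosedInvariant_closure {v : VectorField X} {x : Point X U}
    (hx : x ∈ v.solutions U) : v.IsClosedInvariant (closure {x.pt}) := by
  refine ⟨isClosed_closure, fun V f hf z hz hzZ => ?_⟩
  have hxV : x.pt ∈ V := (specializes_iff_mem_closure.2 hzZ).mem_open V.isOpen hz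
  have h1 : x.eval V hxV f = 0 := (x.eval_eq_zero_iff V hxV f).2 (hf _ hxV (subset_closure rfl))
  have h2 : x.eval V hxV (v.der V f) = 0 := by rw [← hx V hxV f, h1, map_zero]
  by_contra h3
  have h4 := (X.scheme.evaluation_ne_zero_iff_mem_basicOpen z hz _).1 h3
  have h5 : x.pt ∈ X.scheme.basicOpen (v.der V f) :=
    (specializes_iff_mem_closure.2 hzZ).mem_open (X.scheme.basicOpen _).isOpen h4
  exact (X.scheme.evaluation_ne_zero_iff_mem_basicOpen x.pt hxV _).2 h5
    ((x.eval_eq_zero_iff V hxV _).1 h2)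

/-- If the closure of `x.pt` is proper, simplicity makes `x.pt` a closed point, hence the support of
a `k`-point `y`. The values at `x` are then constants, and the equation `f(x)′ = v(f)(x)` forces `v`
to vanish at `y`. -/
lemma VectorField.IsSimple.generic_or_mem_sing [IsAlgClosed k] {v : VectorField X}
    (hv : v.IsSimple) (hconst : ∀ c : k, (algebraMap k U c)′ = 0) {x : Point X U}
    (hx : x ∈ v.solutions U) : x.pt = X.generic ∨ x ∈ Point.extend U '' v.sing := by
  by_cases h : closure {x.pt} = Set.univ
  · exact Or.inl (IsGenericPoint.eq h (genericPoint_spec X.scheme))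
  · have hinv := v.isClosedInvariant_closure hx
    have hcl : IsClosed {x.pt} := by
      convert isClosed_closure (s := {x.pt})
      refine (subset_closure).antisymm fun z hz => ?_
      exact (hv.eq_of_specializes hinv h (subset_closure rfl) hz
        (specializes_iff_mem_closure.2 hz)).symm
    obtain ⟨y, hy⟩ := Point.exists_pt_eq x.pt hcl
    refine Or.inr ⟨y, fun V hyV f => ?_, (x.eq_extend y hy.symm).symm⟩
    have hxV : x.pt ∈ V := hy ▸ hyV
    have h1 := hx V hxV f
    rw [x.eval_of_pt_eq y hy.symm V hxV hyV, x.eval_of_pt_eq y hy.symm V hxV hyV, hconst] at h1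
    exact ((map_eq_zero _).1 h1.symm)

lemma VectorField.extend_mem_solutions {v : VectorField X}
    (hconst : ∀ c : k, (algebraMap k U c)′ = 0) {y : Point X k} (hy : y ∈ v.sing) :
    y.extend U ∈ v.solutions U := fun V hxV f => by
  have hyV : y.pt ∈ V := y.pt_extend (U := U) ▸ hxV
  rw [Point.eval_of_pt_eq _ y y.pt_extend V hxV hyV, Point.eval_of_pt_eq _ y y.pt_extend V hxV hyV,
    hconst, hy V hyV f, map_zero]

/-- Differential embeddings of the function field. -/
def VectorField.DiffEmb (v : VectorField X) (U : Type u) [Field U] [Algebra k U]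
    [Differential U] : Type u :=
  {φ : X.functionField →ₐ[k] U // ∀ g, (φ g)′ = φ (v.derivation g)}

lemma VectorField.ofEmb_mem_solutions {v : VectorField X} (φ : v.DiffEmb U) :
    Point.ofEmb φ.1 ∈ v.solutions U := fun V hxV f => by
  have hV : X.generic ∈ V := X.generic_mem hxV
  rw [Point.eval_ofEmb _ V hxV hV, Point.eval_ofEmb _ V hxV hV, φ.2, v.derivation_germ]

lemma VectorField.exists_ofEmb {v : VectorField X} {x : Point X U} (hx : x ∈ v.solutions U)
    (h : x.pt = X.generic) : ∃ φ : v.DiffEmb U, Point.ofEmb φ.1 = x := by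
  refine ⟨⟨x.toEmb h, fun g => ?_⟩, x.ofEmb_toEmb h⟩
  obtain ⟨V, hV, f, rfl⟩ := X.exists_germ g
  have hxV : x.pt ∈ V := h ▸ hV
  rw [v.derivation_germ, x.toEmb_germ h V hV hxV, x.toEmb_germ h V hV hxV]
  exact hx V hxV f

end Invariant

/-! ### Transcendence degree and dimension -/

section Dimension

/-- Chains of irreducible closed sets above `Z` can be read in any open neighbourhood of the generic
point of `Z`. -/
lemma topologicalKrullDim_le_of_isOpenEmbedding {Y : Type u} [TopologicalSpace Y] [QuasiSober Y]
    (d : WithBot ℕ∞) (h : ∀ y : Y, ∃ (V : Type u) (_ : TopologicalSpace V) (f : V → Y),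
      Topology.IsOpenEmbedding f ∧ y ∈ Set.range f ∧ topologicalKrullDim V ≤ d) :
    topologicalKrullDim Y ≤ d := by
  rw [topologicalKrullDim, Order.krullDim_eq_iSup_coheight]
  refine iSup_le fun Z => ?_
  obtain ⟨z, hz⟩ := QuasiSober.sober Z.isIrreducible' Z.isClosed'
  obtain ⟨V, _, f, he, ⟨w, rfl⟩, hd⟩ := h z
  let Z' : IrreducibleCloseds V := ⟨closure {w}, isIrreducible_singleton.closure, isClosed_closure⟩
  have : IrreducibleCloseds.map f he.continuous Z' = Z := by
    refine IrreducibleCloseds.ext ?_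
    refine (closure_image_closure he.continuous).trans ?_
    rw [Set.image_singleton]
    exact hz
  rw [← this, he.coheight_map]
  exact (Order.coheight_le_krullDim Z').trans hd

/-- One inequality is incomparability; the other lifts chains by lying over and going up. -/
lemma ringKrullDim_eq_of_isIntegral {R S : Type*} [CommRing R] [CommRing S] [Algebra R S]
    [Algebra.IsIntegral R S] [FaithfulSMul R S] : ringKrullDim S = ringKrullDim R := by
  refine le_antisymm ?_ (iSup_le fun l => ?_)
  · exact Order.krullDim_le_of_strictMono (PrimeSpectrum.comap (algebraMap R S))
      fun p q h => Ideal.IsIntegral.comap_lt_comap (R := R) (I := p.asIdeal) (J := q.asIdeal) h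
  · obtain ⟨P, hP, hPl⟩ := Ideal.exists_ideal_over_prime_of_isIntegral (S := S) l.head.asIdeal ⊥ (by
      rw [← RingHom.ker_eq_comap_bot, (RingHom.injective_iff_ker_eq_bot _).1
        (FaithfulSMul.algebraMap_injective R S)]
      exact bot_le)
    have : P.LiesOver l.head.asIdeal := ⟨hPl.2.symm⟩
    have := hPl.1
    obtain ⟨L, hL, -⟩ := Ideal.exists_ltSeries_of_hasGoingUp l P
    rw [← hL]
    exact le_iSup (fun L : LTSeries (PrimeSpectrum S) => (L.length : WithBot ℕ∞)) L

/-- Noether normalization reduces both invariants to those of a polynomial ring. -/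
lemma ringKrullDim_eq_trdeg (k A : Type u) [Field k] [CommRing A] [IsDomain A] [Algebra k A]
    [Algebra.FiniteType k A] :
    ringKrullDim A = ((toENat (Algebra.trdeg k A) : ℕ∞) : WithBot ℕ∞) := by
  obtain ⟨s, g, hg, hint⟩ := exists_integral_inj_algHom_of_fg k A
  let := g.toRingHom.toAlgebra
  have : IsScalarTower k (MvPolynomial (Fin s) k) A := IsScalarTower.of_algebraMap_eq fun c =>
    (g.commutes c).symm
  have : Algebra.IsIntegral (MvPolynomial (Fin s) k) A := ⟨hint⟩
  have : FaithfulSMul (MvPolynomial (Fin s) k) A := (faithfulSMul_iff_algebraMap_injective _ _).2 hg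
  rw [ringKrullDim_eq_of_isIntegral (R := MvPolynomial (Fin s) k),
    MvPolynomial.ringKrullDim_of_isNoetherianRing, ← trdeg_add_eq k (MvPolynomial (Fin s) k) (A := A),
    MvPolynomial.trdeg_of_isDomain, trdeg_eq_zero]
  simp

end Dimension

/-! ### Affine charts: finite generation and dimension. -/

section FiniteType

variable {k : Type u} [Field k] {X : SmoothVariety k}

instance (V : X.scheme.Opens) : Algebra k Γ(X.scheme, V) := (X.const V).hom.toAlgebra

lemma SmoothVariety.finiteType {V : X.scheme.Opens} (hV : IsAffineOpen V) :
    Algebra.FiniteType k Γ(X.scheme, V) := by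
  have h1 := X.str.finiteType_appLE (isAffineOpen_top _) hV le_top
  have h2 : (Scheme.ΓSpecIso (CommRingCat.of k)).inv.hom.FiniteType :=
    RingHom.FiniteType.of_surjective _
      (ConcreteCategory.bijective_of_isIso (Scheme.ΓSpecIso (CommRingCat.of k)).inv).2
  exact h1.comp h2

lemma SmoothVariety.ringKrullDim_eq {V : X.scheme.Opens} (hV : IsAffineOpen V)
    (hgen : X.generic ∈ V) : ringKrullDim Γ(X.scheme, V) =
      ((toENat (Algebra.trdeg k X.functionField) : ℕ∞) : WithBot ℕ∞) := by
  have : Nonempty V := ⟨⟨_, hgen⟩⟩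
  let : Algebra Γ(X.scheme, V) X.functionField := (X.germ V hgen).toAlgebra
  have : IsFractionRing Γ(X.scheme, V) X.functionField :=
    functionField_isFractionRing_of_isAffineOpen X.scheme V hV
  have : IsScalarTower k Γ(X.scheme, V) X.functionField := IsScalarTower.of_algebraMap_eq fun c =>
    (X.germ_const V hgen c).symm
  have := X.finiteType hV
  have : FaithfulSMul Γ(X.scheme, V) X.functionField :=
    (faithfulSMul_iff_algebraMap_injective _ _).2 (X.germ_injective V hgen)
  have : Algebra.IsAlgebraic Γ(X.scheme, V) X.functionField :=
    (IsFractionRing.comap_isAlgebraic_iff (K := X.functionField)).2 inferInstance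
  rw [ringKrullDim_eq_trdeg k, ← trdeg_add_eq k Γ(X.scheme, V) (A := X.functionField),
    trdeg_eq_zero (R := Γ(X.scheme, V)), add_zero]

lemma SmoothVariety.topologicalKrullDim_opens {V : X.scheme.Opens} (hV : IsAffineOpen V)
    (hgen : X.generic ∈ V) : topologicalKrullDim (V : Scheme) =
      ((toENat (Algebra.trdeg k X.functionField) : ℕ∞) : WithBot ℕ∞) := by
  rw [← X.ringKrullDim_eq hV hgen, ← PrimeSpectrum.topologicalKrullDim_eq_ringKrullDim]
  exact IsHomeomorph.topologicalKrullDim_eq _ hV.isoSpec.hom.homeomorph.isHomeomorph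

lemma SmoothVariety.exists_affine (x : X.scheme) {W : X.scheme.Opens} (hx : x ∈ W) :
    ∃ V : X.scheme.Opens, IsAffineOpen V ∧ x ∈ V ∧ V ≤ W := by
  obtain ⟨V, hV, hxV, hVW⟩ := Opens.isBasis_iff_nbhd.1 X.scheme.isBasis_affineOpens hx
  exact ⟨V, hV, hxV, hVW⟩

variable (X) in
theorem SmoothVariety.topologicalKrullDim_eq : topologicalKrullDim X.scheme =
    ((toENat (Algebra.trdeg k X.functionField) : ℕ∞) : WithBot ℕ∞) := by
  refine le_antisymm ?_ ?_
  · refine topologicalKrullDim_le_of_isOpenEmbedding _ fun z => ?_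
    obtain ⟨V, hV, hzV, -⟩ := X.exists_affine z (W := ⊤) trivial
    exact ⟨_, _, V.ι, V.ι.isOpenEmbedding, ⟨⟨z, hzV⟩, rfl⟩,
      (X.topologicalKrullDim_opens hV (X.generic_mem hzV)).le⟩
  · obtain ⟨V, hV, hzV, -⟩ := X.exists_affine X.generic X.generic_mem_top
    rw [← X.topologicalKrullDim_opens hV hzV]
    exact V.ι.isOpenEmbedding.isInducing.topologicalKrullDim_le

variable (X) in
/-- The function field is finitely generated. -/
theorem SmoothVariety.exists_adjoin_eq_top :
    ∃ (n : ℕ) (t : Fin n → X.functionField), IntermediateField.adjoin k (Set.range t) = ⊤ := by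
  obtain ⟨V, hV, hgen, -⟩ := X.exists_affine X.generic X.generic_mem_top
  have : Nonempty V := ⟨⟨_, hgen⟩⟩
  let : Algebra Γ(X.scheme, V) X.functionField := (X.germ V hgen).toAlgebra
  have : IsFractionRing Γ(X.scheme, V) X.functionField :=
    functionField_isFractionRing_of_isAffineOpen X.scheme V hV
  have : IsScalarTower k Γ(X.scheme, V) X.functionField := IsScalarTower.of_algebraMap_eq fun c =>
    (X.germ_const V hgen c).symm
  obtain ⟨s, hs⟩ := (X.finiteType hV).out
  let e := s.equivFin.symm
  refine ⟨s.card, fun i => X.germ V hgen (e i), ?_⟩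
  set L := IntermediateField.adjoin k (Set.range fun i => X.germ V hgen (e i))
  have key : ∀ a : Γ(X.scheme, V), X.germ V hgen a ∈ L := fun a => by
    have ha : a ∈ Algebra.adjoin k (s : Set Γ(X.scheme, V)) := hs ▸ Algebra.mem_top
    induction ha using Algebra.adjoin_induction with
    | mem x hx => exact IntermediateField.subset_adjoin _ _ ⟨e.symm ⟨x, hx⟩, by simp⟩
    | algebraMap r => exact (X.germ_const V hgen r).symm ▸ L.algebraMap_mem r
    | add x y _ _ hx hy => rw [map_add]; exact L.add_mem hx hy
    | mul x y _ _ hx hy => rw [map_mul]; exact L.mul_mem hx hy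
  refine eq_top_iff.2 fun g _ => ?_
  obtain ⟨a, b, -, rfl⟩ := IsFractionRing.div_surjective (A := Γ(X.scheme, V)) g
  exact L.div_mem (key a) (key b)

end FiniteType

/-! ### The differential field generated by a solution. -/

section DiffField

variable {k : Type u} [Field k] {X : SmoothVariety k} {U : Type u} [Field U] [Algebra k U]

lemma Point.range_stalkEval (x : Point X U) : Set.range x.stalkEval =
    {a | ∃ (V : X.scheme.Opens) (hx : x.pt ∈ V) (f : Γ(X.scheme, V)), x.eval V hx f = a} := by
  ext a
  constructor
  · rintro ⟨s, rfl⟩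
    obtain ⟨V, hV, f, rfl⟩ := X.scheme.presheaf.exists_germ_eq s
    exact ⟨V, hV, f, rfl⟩
  · rintro ⟨V, hV, f, rfl⟩
    exact ⟨_, rfl⟩

variable [Differential U]

/-- The image of `φ` is already stable under the derivation of `U`, since `φ` is differential. -/
lemma VectorField.diffField_ofEmb {v : VectorField X} (φ : v.DiffEmb U) :
    (Point.ofEmb φ.1).diffField = φ.1.fieldRange := by
  refine le_antisymm (sInf_le ⟨?_, ?_⟩) (le_sInf fun L hL => ?_)
  · rw [Point.range_stalkEval]
    rintro _ ⟨V, hx, f, rfl⟩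
    rw [Point.eval_ofEmb φ.1 V hx (X.generic_mem hx)]
    exact ⟨_, rfl⟩
  · rintro _ ⟨g, rfl⟩
    exact ⟨v.derivation g, (φ.2 g).symm⟩
  · rintro _ ⟨g, rfl⟩
    obtain ⟨V, hV, f, rfl⟩ := X.exists_germ g
    refine hL.1 ?_
    rw [Point.range_stalkEval]
    have hx : (Point.ofEmb φ.1).pt ∈ V := (Point.pt_ofEmb φ.1).symm ▸ hV
    exact ⟨V, hx, f, Point.eval_ofEmb φ.1 V hx hV f⟩

lemma VectorField.trdeg_ofEmb {v : VectorField X} (φ : v.DiffEmb U) :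
    ((toENat (Algebra.trdeg k (Point.ofEmb φ.1).diffField) : ℕ∞) : WithBot ℕ∞) =
      topologicalKrullDim X.scheme := by
  rw [X.topologicalKrullDim_eq, v.diffField_ofEmb]
  congr 2
  exact (AlgEquiv.ofInjectiveField φ.1).trdeg_eq.symm

lemma Point.trdeg_extend (hconst : ∀ c : k, (algebraMap k U c)′ = 0) (y : Point X k) :
    Algebra.trdeg k (y.extend U).diffField = 0 := by
  have : (y.extend U).diffField = ⊥ := by
    refine eq_bot_iff.2 (sInf_le ⟨?_, ?_⟩)
    · rw [Point.range_stalkEval]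
      rintro _ ⟨V, hx, f, rfl⟩
      rw [Point.eval_of_pt_eq _ y y.pt_extend V hx (y.pt_extend (U := U) ▸ hx)]
      exact IntermediateField.algebraMap_mem _ _
    · rintro a ha
      obtain ⟨c, rfl⟩ := IntermediateField.mem_bot.1 ha
      rw [hconst]
      exact IntermediateField.zero_mem _
  rw [this]
  exact trdeg_eq_zero

/-- Singular points generate only `k`, of transcendence degree 0, so a solution of full
transcendence degree is generic. -/
lemma VectorField.IsSimple.exists_ofEmb_of_trdeg [IsAlgClosed k] {v : VectorField X}
    (hv : v.IsSimple) (hconst : ∀ c : k, (algebraMap k U c)′ = 0)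
    (hdim : 2 ≤ topologicalKrullDim X.scheme) {x : Point X U} (hx : x ∈ v.solutions U)
    (h : ((toENat (Algebra.trdeg k x.diffField) : ℕ∞) : WithBot ℕ∞) =
      topologicalKrullDim X.scheme) : ∃ φ : v.DiffEmb U, Point.ofEmb φ.1 = x := by
  rcases hv.generic_or_mem_sing hconst hx with h1 | ⟨y, -, rfl⟩
  · exact v.exists_ofEmb hx h1
  · rw [Point.trdeg_extend hconst] at h
    rw [← h] at hdim
    exact absurd hdim (by simp)

end DiffField

/-! ### Definable subsets of varieties -/

section Definable

lemma Point.eval_ne_zero_iff {k K : Type u} [Field k] {X : SmoothVariety k} [Field K] [Algebra k K]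
    (x : Point X K) (V : X.scheme.Opens) (hx : x.pt ∈ V)
    (f : Γ(X.scheme, V)) : x.eval V hx f ≠ 0 ↔ x.pt ∈ X.scheme.basicOpen f := by
  rw [Ne, x.eval_eq_zero_iff, ← X.scheme.evaluation_ne_zero_iff_mem_basicOpen x.pt hx]

variable {k : Type u} [Field k] {X : SmoothVariety k} {U : Type u} [Field U] [Differential U]
  [Algebra k U] {A : Set U} {m : ℕ}

lemma IsDefinableRel.of_pieces {I : Type*} [Finite I] (V : I → X.scheme.Opens) (J : I → Type*)
    [∀ i, Finite (J i)] (f : ∀ i, J i → Γ(X.scheme, V i)) (E : ∀ i, Set (J i ⊕ Fin m → U))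
    (hE : ∀ i, A.Definable diffRing (E i)) {R : Set (Point X U × (Fin m → U))}
    (hR : ∀ x b, (x, b) ∈ R ↔ ∃ (i : I) (hx : x.pt ∈ V i),
      Sum.elim (fun j => x.eval (V i) hx (f i j)) b ∈ E i) : IsDefinableRel A R := by
  obtain ⟨r, ⟨e⟩⟩ := Finite.exists_equiv_fin I
  choose N hN using fun i => Finite.exists_equiv_fin (J i)
  have ε := fun i => (hN i).some
  refine ⟨r, fun i => V (e.symm i), fun i => N (e.symm i), fun i j => f _ ((ε _).symm j),
    fun i => (fun w => w ∘ Sum.map (ε (e.symm i)) id) ⁻¹' E (e.symm i),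
    fun i => (hE _).preimage_comp _, fun x b => (hR x b).trans ?_⟩
  have key : ∀ i (hx : x.pt ∈ V i), (Sum.elim (fun j => x.eval (V i) hx (f i ((ε i).symm j))) b) ∘
      Sum.map (ε i) id = Sum.elim (fun j => x.eval (V i) hx (f i j)) b := fun i hx => by
    rw [Sum.elim_comp_map]
    congr 1
    funext j
    simp
  constructor
  · rintro ⟨i, hx, h⟩
    obtain ⟨i, rfl⟩ := e.symm.surjective i
    refine ⟨i, hx, ?_⟩
    rw [Set.mem_preimage, key]
    exact h
  · rintro ⟨i, hx, h⟩
    rw [Set.mem_preimage, key] at h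
    exact ⟨_, hx, h⟩

lemma IsDefinableRel.of_piece (V : X.scheme.Opens) {J : Type*} [Finite J] (f : J → Γ(X.scheme, V))
    {E : Set (J ⊕ Fin m → U)} (hE : A.Definable diffRing E) {R : Set (Point X U × (Fin m → U))}
    (hR : ∀ x b, (x, b) ∈ R ↔ ∃ hx : x.pt ∈ V, Sum.elim (fun j => x.eval V hx (f j)) b ∈ E) :
    IsDefinableRel A R :=
  IsDefinableRel.of_pieces (I := Unit) (fun _ => V) (fun _ => J) (fun _ => f) (fun _ => E)
    (fun _ => hE) fun x b => (hR x b).trans (by simp)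

lemma IsDefinableRel.mono {B : Set U} {R : Set (Point X U × (Fin m → U))} (h : IsDefinableRel A R)
    (hAB : A ⊆ B) : IsDefinableRel B R := by
  obtain ⟨r, V, N, f, E, hE, hR⟩ := h
  exact ⟨r, V, N, f, E, fun i => (hE i).mono hAB, hR⟩

lemma IsDefinable.mono {B : Set U} {D : Set (Point X U)} (h : IsDefinable A D)
    (hAB : A ⊆ B) : IsDefinable B D :=
  IsDefinableRel.mono h hAB

lemma IsDefinableRel.isDefinable_fiber {R : Set (Point X U × (Fin m → U))}
    (h : IsDefinableRel A R) {b : Fin m → U} {B : Set U} (hAB : A ⊆ B) (hb : ∀ i, b i ∈ B) :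
    IsDefinable B {x | (x, b) ∈ R} := by
  obtain ⟨r, V, N, f, E, hE, hR⟩ := h
  refine IsDefinableRel.of_pieces V (fun i => Fin (N i)) f
    (fun i => (fun w l => Sum.elim (fun j => w (Sum.inl j)) b l) ⁻¹' E i) (fun i => ?_)
    fun x c => (hR x b).trans ?_
  · refine Set.Definable.preimage_map (fun j => ?_) ((hE i).mono hAB)
    rcases j with j | j
    · exact Set.DefinableFun.proj diffRing
    · exact definableFun_const (hb j)
  · rfl

lemma IsDefinableRel.union {R S : Set (Point X U × (Fin m → U))} (hR : IsDefinableRel A R)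
    (hS : IsDefinableRel A S) : IsDefinableRel A (R ∪ S) := by
  obtain ⟨r, V, N, f, E, hE, hR⟩ := hR
  obtain ⟨s, W, M, g, F, hF, hS⟩ := hS
  refine IsDefinableRel.of_pieces (I := Fin r ⊕ Fin s) (Sum.elim V W)
    (fun i => Fin (Sum.elim N M i)) (fun | .inl i => f i | .inr i => g i)
    (fun | .inl i => E i | .inr i => F i) (fun | .inl i => hE i | .inr i => hF i) fun x b => ?_
  rw [Set.mem_union, hR, hS, Sum.exists]
  rfl

lemma IsDefinableRel.inter {R S : Set (Point X U × (Fin m → U))} (hR : IsDefinableRel A R)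
    (hS : IsDefinableRel A S) : IsDefinableRel A (R ∩ S) := by
  obtain ⟨r, V, N, f, E, hE, hR⟩ := hR
  obtain ⟨s, W, M, g, F, hF, hS⟩ := hS
  refine IsDefinableRel.of_pieces (I := Fin r × Fin s) (fun i => V i.1 ⊓ W i.2)
    (fun i => Fin (N i.1) ⊕ Fin (M i.2))
    (fun i => Sum.elim (fun j => X.res inf_le_left (f i.1 j)) fun j => X.res inf_le_right (g i.2 j))
    (fun i => (fun w => w ∘ Sum.map Sum.inl id) ⁻¹' E i.1 ∩ (fun w => w ∘ Sum.map Sum.inr id) ⁻¹' F i.2)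
    (fun i => ((hE _).preimage_comp _).inter ((hF _).preimage_comp _)) fun x b => ?_
  have h1 : ∀ (i : Fin r × Fin s) (hx : x.pt ∈ V i.1 ⊓ W i.2), (Sum.elim (fun j => x.eval (V i.1 ⊓ W i.2) hx
      (Sum.elim (fun j => X.res inf_le_left (f i.1 j)) (fun j => X.res inf_le_right (g i.2 j)) j)) b) ∘
      Sum.map Sum.inl id = Sum.elim (fun j => x.eval _ hx.1 (f i.1 j)) b := fun i hx => by
    rw [Sum.elim_comp_map]
    congr 1
    funext j
    exact x.eval_res _ hx _
  have h2 : ∀ (i : Fin r × Fin s) (hx : x.pt ∈ V i.1 ⊓ W i.2), (Sum.elim (fun j => x.eval (V i.1 ⊓ W i.2) hx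
      (Sum.elim (fun j => X.res inf_le_left (f i.1 j)) (fun j => X.res inf_le_right (g i.2 j)) j)) b) ∘
      Sum.map Sum.inr id = Sum.elim (fun j => x.eval _ hx.2 (g i.2 j)) b := fun i hx => by
    rw [Sum.elim_comp_map]
    congr 1
    funext j
    exact x.eval_res _ hx _
  rw [Set.mem_inter_iff, hR, hS]
  constructor
  · rintro ⟨⟨i, hx, h⟩, ⟨j, hx', h'⟩⟩
    refine ⟨(i, j), ⟨hx, hx'⟩, ?_, ?_⟩
    · rw [Set.mem_preimage, h1 (i, j) ⟨hx, hx'⟩]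
      exact h
    · rw [Set.mem_preimage, h2 (i, j) ⟨hx, hx'⟩]
      exact h'
  · rintro ⟨i, hx, h, h'⟩
    rw [Set.mem_preimage, h1] at h
    rw [Set.mem_preimage, h2] at h'
    exact ⟨⟨i.1, hx.1, h⟩, ⟨i.2, hx.2, h'⟩⟩

lemma IsDefinableRel.univ : IsDefinableRel A (Set.univ : Set (Point X U × (Fin m → U))) :=
  IsDefinableRel.of_piece ⊤ (J := Empty) Empty.elim (E := Set.univ) Set.definable_univ
    fun x b => by simp

lemma IsDefinableRel.iInter {r : ℕ} {R : Fin r → Set (Point X U × (Fin m → U))}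
    (hR : ∀ i, IsDefinableRel A (R i)) : IsDefinableRel A (⋂ i, R i) := by
  induction r with
  | zero => simpa using IsDefinableRel.univ
  | succ r ih =>
    have : ⋂ i, R i = R 0 ∩ ⋂ i : Fin r, R i.succ := by
      ext q
      simp [Fin.forall_fin_succ]
    rw [this]
    exact (hR 0).inter (ih fun i => hR i.succ)

variable (X) in
lemma SmoothVariety.exists_affine_cover : ∃ (I : Type u) (_ : Finite I) (V : I → X.scheme.Opens),
    (∀ i, IsAffineOpen (V i)) ∧ ∀ x : X.scheme, ∃ i, x ∈ V i := by
  choose V hV hxV _ using fun x : X.scheme => X.exists_affine x (W := ⊤) trivial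
  obtain ⟨t, ht⟩ := CompactSpace.elim_nhds_subcover (fun x => (V x : Set X.scheme))
    fun x => (V x).isOpen.mem_nhds (hxV x)
  refine ⟨t, inferInstance, fun i => V i, fun i => hV i, fun x => ?_⟩
  have hx : x ∈ ⋃ y ∈ t, (V y : Set X.scheme) := ht ▸ trivial
  simp only [Set.mem_iUnion] at hx
  obtain ⟨y, hy, hxy⟩ := hx
  exact ⟨⟨y, hy⟩, hxy⟩

lemma SmoothVariety.exists_basicOpen_cover {W : X.scheme.Opens} (hW : IsAffineOpen W)
    (V : X.scheme.Opens) : ∃ (J : Type u) (_ : Finite J) (g : J → Γ(X.scheme, W)),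
      ∀ x ∈ W, x ∈ V ↔ ∃ j, x ∈ X.scheme.basicOpen (g j) := by
  choose g hg hxg using fun x : (V ⊓ W : X.scheme.Opens) =>
    hW.exists_basicOpen_le (V := V) ⟨x, x.2.1⟩ x.2.2
  have hc : IsCompact ((V ⊓ W : X.scheme.Opens) : Set X.scheme) := NoetherianSpace.isCompact _
  obtain ⟨t, ht⟩ := hc.elim_finite_subcover (fun x => (X.scheme.basicOpen (g x) : Set X.scheme))
    (fun x => (X.scheme.basicOpen (g x)).isOpen) fun x hx => Set.mem_iUnion.2 ⟨⟨x, hx⟩, hxg _⟩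
  refine ⟨t, inferInstance, fun j => g j, fun x hx => ⟨fun hxV => ?_, fun ⟨j, hj⟩ => hg _ hj⟩⟩
  have := ht (show x ∈ ((V ⊓ W : X.scheme.Opens) : Set X.scheme) from ⟨hxV, hx⟩)
  simp only [Set.mem_iUnion] at this
  obtain ⟨y, hy, hxy⟩ := this
  exact ⟨⟨y, hy⟩, hxy⟩

/-- Inside each affine chart `V` is a finite union of basic open sets, so its complement is given by
the vanishing of finitely many functions. -/
lemma isDefinableRel_notMem (V : X.scheme.Opens) :
    IsDefinableRel A {q : Point X U × (Fin m → U) | q.1.pt ∉ V} := by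
  obtain ⟨I, _, W, hW, hcov⟩ := X.exists_affine_cover
  choose J hJ g hg using fun i => X.exists_basicOpen_cover (hW i) V
  refine IsDefinableRel.of_pieces W J g (fun i => ⋂ j, {w | w (Sum.inl j) = 0}) (fun i =>
    Set.definable_iInter_of_finite fun j => Set.DefinableFun.ofPred_eq
      (Set.DefinableFun.proj diffRing) definableFun_zero) fun x b => ?_
  have key : ∀ i, x.pt ∈ W i → (x.pt ∉ V ↔ ∀ (hx : x.pt ∈ W i) j, x.eval _ hx (g i j) = 0) :=
    fun i hx => by
      rw [hg i x.pt hx, not_exists]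
      exact ⟨fun h hx j => by_contra fun h' => h j ((x.eval_ne_zero_iff _ hx _).1 h'),
        fun h j h' => (x.eval_ne_zero_iff _ hx _).2 h' (h hx j)⟩
  simp only [Set.mem_ofPred_eq, Set.mem_iInter, Sum.elim_inl]
  constructor
  · intro h
    obtain ⟨i, hi⟩ := hcov x.pt
    exact ⟨i, hi, (key i hi).1 h hi⟩
  · rintro ⟨i, hi, h⟩
    exact (key i hi).2 fun _ => h

/-- To avoid a piece is to lie outside its open set, or inside with coordinates in the complementary
definable set. -/
lemma IsDefinableRel.compl {R : Set (Point X U × (Fin m → U))} (hR : IsDefinableRel A R) :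
    IsDefinableRel A Rᶜ := by
  obtain ⟨r, V, N, f, E, hE, hR⟩ := hR
  have : Rᶜ = ⋂ i, ({q : Point X U × (Fin m → U) | q.1.pt ∉ V i} ∪
      {q | ∃ hx : q.1.pt ∈ V i, Sum.elim (fun j => q.1.eval (V i) hx (f i j)) q.2 ∈ (E i)ᶜ}) := by
    ext ⟨x, b⟩
    simp only [Set.mem_compl_iff, hR, Set.mem_iInter, Set.mem_union, Set.mem_ofPred_eq, not_exists]
    refine forall_congr' fun i => ?_
    by_cases hx : x.pt ∈ V i <;> simp [hx]
  rw [this]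
  exact IsDefinableRel.iInter fun i => (isDefinableRel_notMem _).union
    (IsDefinableRel.of_piece (V i) (f i) (hE i).compl fun x b => Iff.rfl)

lemma IsDefinable.inter {D E : Set (Point X U)} (hD : IsDefinable A D) (hE : IsDefinable A E) :
    IsDefinable A (D ∩ E) := IsDefinableRel.inter hD hE

lemma IsDefinable.compl {D : Set (Point X U)} (hD : IsDefinable A D) : IsDefinable A Dᶜ :=
  IsDefinableRel.compl hD

lemma isDefinable_univ : IsDefinable A (Set.univ : Set (Point X U)) := IsDefinableRel.univ

lemma isDefinable_mem (V : X.scheme.Opens) : IsDefinable A {x : Point X U | x.pt ∈ V} := by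
  have : {x : Point X U | x.pt ∈ V} = {x : Point X U | x.pt ∉ V}ᶜ := by
    ext
    simp
  rw [this]
  exact IsDefinable.compl (isDefinableRel_notMem V)

/-- The type of a point. -/
def typeOf (A : Set U) (x : Point X U) : CompleteType X A where
  sets := {D | IsDefinable A D ∧ x ∈ D}
  definable _ h := h.1
  univ_mem := ⟨isDefinable_univ, trivial⟩
  empty_notMem h := h.2
  inter_mem _ h _ h' := ⟨h.1.inter h'.1, h.2, h'.2⟩
  mem_or_compl_mem D hD := (em (x ∈ D)).imp (fun h => ⟨hD, h⟩) fun h => ⟨hD.compl, h⟩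

lemma CompleteType.sets_injective : Function.Injective (CompleteType.sets (X := X) (A := A)) := by
  rintro ⟨⟩ ⟨⟩ rfl
  rfl

lemma CompleteType.mem_sets_iff (p : CompleteType X A) {x : Point X U} (hx : x ∈ p.realizations)
    {D : Set (Point X U)} (hD : IsDefinable A D) : D ∈ p.sets ↔ x ∈ D :=
  ⟨hx D, fun h => (p.mem_or_compl_mem D hD).resolve_right fun h' => hx _ h' h⟩

lemma CompleteType.eq_typeOf (p : CompleteType X A) {x : Point X U} (hx : x ∈ p.realizations) :
    p = typeOf A x :=
  CompleteType.sets_injective <| Set.ext fun D =>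
    ⟨fun h => ⟨p.definable D h, hx D h⟩, fun h => (p.mem_sets_iff hx h.1).2 h.2⟩

lemma mem_realizations_typeOf (x : Point X U) : x ∈ (typeOf A x).realizations := fun _ h => h.2

/-- On generic points, definable relations are given by definable conditions on the values of
finitely many rational functions. -/
lemma IsDefinableRel.exists_definable {R : Set (Point X U × (Fin m → U))}
    (hR : IsDefinableRel A R) : ∃ (J : Type) (_ : Finite J) (h : J → X.functionField)
      (E : Set (J ⊕ Fin m → U)), A.Definable diffRing E ∧
      ∀ (φ : X.functionField →ₐ[k] U) b, (Point.ofEmb φ, b) ∈ R ↔ Sum.elim (φ ∘ h) b ∈ E := by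
  classical
  obtain ⟨r, V, N, f, E, hE, hR⟩ := hR
  -- The other pieces have empty open sets and contribute nothing.
  let S := {i // X.generic ∈ V i}
  refine ⟨Σ i : S, Fin (N i), inferInstance, fun j => X.germ (V j.1) j.1.2 (f j.1 j.2),
    ⋃ i : S, (fun w => w ∘ Sum.map (fun j => ⟨i, j⟩) id) ⁻¹' E i,
    Set.definable_iUnion_of_finite fun i => (hE i).preimage_comp _, fun φ b => (hR _ b).trans ?_⟩
  have key : ∀ i (hx : (Point.ofEmb φ).pt ∈ V i) (hi : X.generic ∈ V i),
      (fun j => (Point.ofEmb φ).eval (V i) hx (f i j)) = fun j => φ (X.germ (V i) hi (f i j)) :=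
    fun i hx hi => funext fun j => Point.eval_ofEmb φ (V i) hx hi (f i j)
  simp only [Set.mem_iUnion, Set.mem_preimage, Sum.elim_comp_map, Function.comp_id]
  constructor
  · rintro ⟨i, hx, h⟩
    refine ⟨⟨i, X.generic_mem hx⟩, ?_⟩
    rw [key i hx (X.generic_mem hx)] at h
    exact h
  · rintro ⟨i, h⟩
    have hx : (Point.ofEmb φ).pt ∈ V i := (Point.pt_ofEmb φ).symm ▸ i.2
    refine ⟨i, hx, ?_⟩
    rw [key i hx i.2]
    exact h

lemma IsDefinable.exists_definable {D : Set (Point X U)} (hD : IsDefinable A D) :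
    ∃ (J : Type) (_ : Finite J) (h : J → X.functionField) (E : Set (J → U)),
      A.Definable diffRing E ∧ ∀ φ : X.functionField →ₐ[k] U, Point.ofEmb φ ∈ D ↔ φ ∘ h ∈ E := by
  obtain ⟨J, hJ, h, E, hE, hR⟩ := IsDefinableRel.exists_definable hD
  refine ⟨J, hJ, h, (fun w => w ∘ Sum.elim id Fin.elim0) ⁻¹' E, hE.preimage_comp _, fun φ =>
    (hR φ Fin.elim0).trans ?_⟩
  rw [Set.mem_preimage]
  refine iff_of_eq (congrArg (· ∈ E) ?_)
  funext j
  rcases j with j | j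
  · rfl
  · exact j.elim0

end Definable

/-! ### The solution set -/

section Solutions

/-- The function field contains few elements. -/
lemma SmoothVariety.mk_functionField_lt {k U : Type u} [Field k] {X : SmoothVariety k} [Infinite k]
    (hk : #k < #U) : #X.functionField < #U := by
  obtain ⟨n, t, ht⟩ := X.exists_adjoin_eq_top
  have hU : ℵ₀ < #U := (Cardinal.aleph0_le_mk k).trans_lt hk
  have hP : #(MvPolynomial (Fin n) k) < #U := mk_mvPolynomial_lt hU hk
  have hsurj : Function.Surjective fun p : MvPolynomial (Fin n) k × MvPolynomial (Fin n) k =>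
      MvPolynomial.aeval t p.1 / MvPolynomial.aeval t p.2 := fun g => by
    have hg : g ∈ IntermediateField.adjoin k (Set.range t) := ht ▸ IntermediateField.mem_top
    obtain ⟨r, s, h⟩ := (IntermediateField.mem_adjoin_range_iff k t g).1 hg
    exact ⟨(r, s), h.symm⟩
  refine (Cardinal.mk_le_of_surjective hsurj).trans_lt ?_
  rw [← Cardinal.mul_def]
  exact Cardinal.mul_lt_of_lt hU.le hP hP

variable {k : Type u} [Field k] {X : SmoothVariety k} {U : Type u} [Field U] [Differential U]
  [Algebra k U] {v : VectorField X}

lemma VectorField.deriv_eval_of_adjoin (hconst : ∀ c : k, (algebraMap k U c)′ = 0) (x : Point X U)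
    (V : X.scheme.Opens) (hx : x.pt ∈ V) {s : Set Γ(X.scheme, V)} (hs : Algebra.adjoin k s = ⊤)
    (h : ∀ f ∈ s, (x.eval V hx f)′ = x.eval V hx (v.der V f)) (f : Γ(X.scheme, V)) :
    (x.eval V hx f)′ = x.eval V hx (v.der V f) := by
  have hf : f ∈ Algebra.adjoin k s := hs ▸ Algebra.mem_top
  simp only [← x.evalHom_apply] at h ⊢
  induction hf using Algebra.adjoin_induction with
  | mem f hf => exact h f hf
  | algebraMap r =>
    have h1 : x.evalHom V hx (algebraMap k Γ(X.scheme, V) r) = algebraMap k U r :=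
      x.eval_const V hx r
    have h2 : v.der V (algebraMap k Γ(X.scheme, V) r) = 0 := v.map_const V r
    rw [h1, h2, hconst, map_zero]
  | add f g _ _ hf hg => rw [map_add, map_add, map_add, map_add, hf, hg]
  | mul f g _ _ hf hg =>
    rw [map_mul, Derivation.leibniz, v.leibniz, map_add, map_mul, map_mul, hf, hg, smul_eq_mul,
      smul_eq_mul]

/-- Near `x` one has `f * g ^ n = a` with `a` and `g` regular on `W`. The two Leibniz rules for this
identity differ only in the term sought, multiplied by the nonzero value of `g ^ n`. -/
lemma VectorField.deriv_eval_of_affine (x : Point X U) {W : X.scheme.Opens}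
    (hW : IsAffineOpen W) (hxW : x.pt ∈ W)
    (h : ∀ f, (x.eval W hxW f)′ = x.eval W hxW (v.der W f)) (V : X.scheme.Opens) (hx : x.pt ∈ V)
    (f : Γ(X.scheme, V)) : (x.eval V hx f)′ = x.eval V hx (v.der V f) := by
  obtain ⟨g, hg, hxg⟩ := hW.exists_basicOpen_le (V := V) ⟨x.pt, hx⟩ hxW
  set O := X.scheme.basicOpen g
  have hOW : O ≤ W := X.scheme.basicOpen_le g
  have := hW.isLocalization_basicOpen g
  obtain ⟨n, a, ha⟩ := IsLocalization.Away.surj g (X.res hg f)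
  have ha' : X.res hg f * X.res hOW (g ^ n) = X.res hOW a := by
    rw [map_pow]
    exact ha
  set G := X.res hOW (g ^ n) with hG
  have hG0 : x.evalHom O hxg G ≠ 0 := by
    rw [hG, map_pow, map_pow, x.evalHom_apply, x.eval_res]
    exact pow_ne_zero _ ((x.eval_ne_zero_iff W hxW g).2 hxg)
  have hWO : ∀ b : Γ(X.scheme, W), (x.evalHom O hxg (X.res hOW b))′ =
      x.evalHom O hxg (v.der O (X.res hOW b)) := fun b => by
    rw [v.map_res, x.evalHom_apply, x.evalHom_apply, x.eval_res, x.eval_res, h]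
  have hF : (x.evalHom O hxg (X.res hg f))′ = x.evalHom O hxg (v.der O (X.res hg f)) := by
    have h1 := hWO a
    rw [← ha', map_mul, Derivation.leibniz, v.leibniz, map_add, map_mul, map_mul, hWO (g ^ n),
      smul_eq_mul, smul_eq_mul] at h1
    exact mul_left_cancel₀ hG0 (add_left_cancel h1)
  rw [v.map_res, x.evalHom_apply, x.evalHom_apply, x.eval_res, x.eval_res] at hF
  exact hF

/-- On each chart of a finite affine cover it suffices to impose the differential equation on
finitely many algebra generators. -/
theorem VectorField.isDefinable_solutions (v : VectorField X)
    (hconst : ∀ c : k, (algebraMap k U c)′ = 0) (A : Set U) :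
    IsDefinable A (v.solutions U) := by
  obtain ⟨I, _, W, hW, hcov⟩ := X.exists_affine_cover
  choose s hs using fun i => (X.finiteType (hW i)).out
  refine IsDefinableRel.of_pieces W (fun i => s i ⊕ s i)
    (fun i => Sum.elim (fun j => j) fun j => v.der (W i) j)
    (fun i => ⋂ j, {w | (w (Sum.inl (Sum.inl j)))′ = w (Sum.inl (Sum.inr j))}) (fun i =>
    Set.definable_iInter_of_finite fun j => Set.DefinableFun.ofPred_eq
      (definableFun_deriv (Set.DefinableFun.proj diffRing)) (Set.DefinableFun.proj diffRing))
    fun x b => ?_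
  simp only [Set.mem_iInter, Set.mem_ofPred_eq, Sum.elim_inl, Sum.elim_inr]
  constructor
  · intro h
    obtain ⟨i, hi⟩ := hcov x.pt
    exact ⟨i, hi, fun j => h (W i) hi j⟩
  · rintro ⟨i, hi, h⟩ V hx f
    exact v.deriv_eval_of_affine x (hW i) hi (v.deriv_eval_of_adjoin hconst x (W i) hi (hs i)
      fun f hf => h ⟨f, hf⟩) V hx f

/-- With the derivation of `v`, `k(X)` is a finitely generated extension of `k`, so the embedding of
`k` needs extending to finitely many elements only. -/
theorem VectorField.nonempty_diffEmb [CharZero k] [IsAlgClosed k] (v : VectorField X)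
    (hconst : ∀ c : k, (algebraMap k U c)′ = 0)
    (hclosed : IsDifferentiallyClosed U) (hsat : IsSaturated U) (hk : #k < #U) :
    Nonempty (v.DiffEmb U) := by
  classical
  have hU : ℵ₀ < #U := (Cardinal.aleph0_le_mk k).trans_lt hk
  let : Differential X.functionField := ⟨v.derivation⟩
  obtain ⟨e₀, -, he₀⟩ := exists_partialEmb_of_field (algebraMap k X.functionField)
    (algebraMap k U) (fun c => mem_commonDerivSubfield.2 ⟨0, by
      rw [map_zero, map_zero, hconst]; exact ⟨v.derivation_algebraMap c, rfl⟩⟩) hk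
  obtain ⟨n, t, ht⟩ := X.exists_adjoin_eq_top
  obtain ⟨e, he, het⟩ := PartialEmb.exists_extension_finset hclosed hsat hU e₀
    (Finset.univ.image t)
  have hk' : ∀ c, ∃ h : algebraMap k X.functionField c ∈ e.dom, e.hom ⟨_, h⟩ = algebraMap k U c :=
    fun c => by
      obtain ⟨h, h1⟩ := he₀ c
      obtain ⟨h2, h3⟩ := he ⟨_, h⟩
      exact ⟨h2, h3.trans h1⟩
  have htop : ∀ g, g ∈ e.dom := fun g => by
    let L : IntermediateField k X.functionField :=
      { e.dom with algebraMap_mem' := fun c => (hk' c).1 }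
    have : (⊤ : IntermediateField k X.functionField) ≤ L := by
      rw [← ht, IntermediateField.adjoin_le_iff]
      rintro _ ⟨i, rfl⟩
      exact het _ (Finset.mem_image_of_mem _ (Finset.mem_univ i))
    exact this trivial
  let φ : X.functionField →ₐ[k] U :=
    { toFun := fun g => e.hom ⟨g, htop g⟩
      map_one' := map_one e.hom
      map_mul' := fun a b => map_mul e.hom ⟨a, htop a⟩ ⟨b, htop b⟩
      map_zero' := map_zero e.hom
      map_add' := fun a b => map_add e.hom ⟨a, htop a⟩ ⟨b, htop b⟩
      commutes' := fun c => (hk' c).2 }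
  exact ⟨φ, fun g => (e.comm ⟨g, htop g⟩).symm⟩

end Solutions

/-! ### Generic points -/

section Generic

lemma Point.pt_eq_generic {k K : Type u} [Field k] {X : SmoothVariety k} [Field K] [Algebra k K]
    {x : Point X K}
    (h : ∀ V : X.scheme.Opens, X.generic ∈ V → x.pt ∈ V) : x.pt = X.generic := by
  refine IsGenericPoint.eq ?_ (genericPoint_spec X.scheme)
  refine Set.eq_univ_of_forall fun z => ?_
  rw [← specializes_iff_mem_closure, specializes_iff_forall_open]
  exact fun V hV hz => h ⟨V, hV⟩ (X.generic_mem (V := ⟨V, hV⟩) hz)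

variable {U : Type u} [Field U] [Differential U]

lemma definableFun_inv {A : Set U} {ι : Type*} {f : (ι → U) → U}
    (hf : A.DefinableFun diffRing f) : A.DefinableFun diffRing fun v => (f v)⁻¹ := by
  have h : A.DefinableFun diffRing fun w : Fin 1 → U => (w 0)⁻¹ := by
    have hx : A.DefinableFun diffRing fun w : Option (Fin 1) → U => w (some 0) := .proj diffRing
    have hy : A.DefinableFun diffRing fun w : Option (Fin 1) → U => w none := .proj diffRing
    -- The equations `x * y * x = x` and `y * x * y = y` define the graph of inversion, including
    -- the convention `0⁻¹ = 0`.
    have h1 := ((definableFun_mul (definableFun_mul hx hy) hx).ofPred_eq hx).inter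
      ((definableFun_mul (definableFun_mul hy hx) hy).ofPred_eq hy)
    refine (congrArg (A.Definable diffRing) (Set.ext fun w => ?_)).mpr h1
    simp only [Function.tupleGraph, Function.comp_apply, Set.mem_ofPred_eq, Set.mem_inter_iff]
    constructor
    · intro h
      rw [← h]
      by_cases h0 : w (some 0) = 0 <;> simp [h0]
    · rintro ⟨h2, h3⟩
      by_cases h0 : w (some 0) = 0
      · rw [← h3, h0]; simp
      · exact inv_eq_of_mul_eq_one_right (mul_right_cancel₀ h0 (by rw [h2, one_mul]))
  exact Set.DefinableFun.comp (g := fun v => ![f v]) (fun i => by fin_cases i; exact hf) h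

variable {k : Type u} [Field k] {X : SmoothVariety k} [Algebra k U] {v : VectorField X}

/-! ### Coordinates given by generators of the function field. -/

section Generators

variable {n : ℕ} {t : Fin n → X.functionField} (ht : IntermediateField.adjoin k (Set.range t) = ⊤)

include ht

lemma IsDefinableRel.exists_definable_generators {A : Set U} (hA : ∀ c, algebraMap k U c ∈ A)
    {m : ℕ} {R : Set (Point X U × (Fin m → U))} (hR : IsDefinableRel A R) :
    ∃ E : Set (Fin n ⊕ Fin m → U), A.Definable diffRing E ∧
      ∀ (φ : X.functionField →ₐ[k] U) b, (Point.ofEmb φ, b) ∈ R ↔ Sum.elim (φ ∘ t) b ∈ E := by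
  obtain ⟨J, _, h, E, hE, hR⟩ := hR.exists_definable
  have hg : ∀ g, ∃ r s : MvPolynomial (Fin n) k,
      g = MvPolynomial.aeval t r / MvPolynomial.aeval t s := fun g =>
    (IntermediateField.mem_adjoin_range_iff k t g).1 (ht ▸ IntermediateField.mem_top)
  choose r s hrs using hg
  refine ⟨(fun w => Sum.elim (fun j => (r (h j)).eval₂ (algebraMap k U) (fun i => w (Sum.inl i)) *
    ((s (h j)).eval₂ (algebraMap k U) fun i => w (Sum.inl i))⁻¹) fun j => w (Sum.inr j)) ⁻¹' E,
    Set.Definable.preimage_map (fun j => ?_) hE, fun φ b => (hR φ b).trans ?_⟩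
  · rcases j with j | j
    · exact definableFun_mul (definableFun_eval₂ _ hA (fun i => .proj diffRing) _)
        (definableFun_inv (definableFun_eval₂ _ hA (fun i => .proj diffRing) _))
    · exact .proj diffRing
  · rw [Set.mem_preimage]
    refine iff_of_eq (congrArg (· ∈ E) ?_)
    have key : ∀ p : MvPolynomial (Fin n) k,
        p.eval₂ (algebraMap k U) (fun i => φ (t i)) = φ (MvPolynomial.aeval t p) := fun p => by
      rw [← MvPolynomial.aeval_def]
      exact (MvPolynomial.comp_aeval_apply t φ p).symm
    funext j
    rcases j with j | j
    · simp only [Sum.elim_inl, Function.comp_apply, key, ← div_eq_mul_inv, ← map_div₀, ← hrs]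
    · rfl

lemma IsDefinable.exists_definable_generators {A : Set U} (hA : ∀ c, algebraMap k U c ∈ A)
    {D : Set (Point X U)} (hD : IsDefinable A D) :
    ∃ E : Set (Fin n → U), A.Definable diffRing E ∧
      ∀ φ : X.functionField →ₐ[k] U, Point.ofEmb φ ∈ D ↔ φ ∘ t ∈ E := by
  obtain ⟨E, hE, hR⟩ := IsDefinableRel.exists_definable_generators ht hA hD
  refine ⟨(fun w => w ∘ Sum.elim id Fin.elim0) ⁻¹' E, hE.preimage_comp _, fun φ =>
    (hR φ Fin.elim0).trans ?_⟩
  rw [Set.mem_preimage]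
  refine iff_of_eq (congrArg (· ∈ E) ?_)
  funext j
  rcases j with j | j
  · rfl
  · exact j.elim0

/-- Partial embeddings over `k` act on generic solutions by composition; being defined on the
generators suffices for this. -/
lemma VectorField.DiffEmb.exists_comp (φ : v.DiffEmb U) (e : PartialEmb U U)
    (he : ∀ c, ∃ h : algebraMap k U c ∈ e.dom, e.hom ⟨_, h⟩ = algebraMap k U c)
    (het : ∀ i, φ.1 (t i) ∈ e.dom) :
    ∃ ψ : v.DiffEmb U, ∀ g, ∃ h : φ.1 g ∈ e.dom, e.hom ⟨_, h⟩ = ψ.1 g := by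
  have htop : ∀ g, φ.1 g ∈ e.dom := fun g => by
    let L : IntermediateField k X.functionField :=
      { e.dom.comap φ.1.toRingHom with
        algebraMap_mem' := fun c => by
          change φ.1 (algebraMap k _ c) ∈ e.dom
          rw [φ.1.commutes]
          exact (he c).1 }
    have : (⊤ : IntermediateField k X.functionField) ≤ L := by
      rw [← ht, IntermediateField.adjoin_le_iff]
      rintro _ ⟨i, rfl⟩
      exact het i
    exact this IntermediateField.mem_top
  refine ⟨⟨{ e.hom.comp (φ.1.toRingHom.codRestrict e.dom htop) with
    commutes' := fun c => ?_ }, fun g => ?_⟩, fun g => ⟨htop g, rfl⟩⟩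
  · obtain ⟨h, h'⟩ := he c
    refine Eq.trans (congrArg e.hom (Subtype.ext ?_)) h'
    exact φ.1.commutes c
  · refine (e.comm ⟨φ.1 g, htop g⟩).symm.trans (congrArg e.hom (Subtype.ext ?_))
    exact φ.2 g

end Generators

/-- Both are embeddings of one differential field, so the kernels agree and quantifier elimination
applies. This is the reason why all generic solutions have the same type over `k`. -/
lemma VectorField.DiffEmb.mem_definable_iff [IsAlgClosed k] (hclosed : IsDifferentiallyClosed U)
    (hsat : IsSaturated U) (hk : #k < #U) (φ ψ : v.DiffEmb U) {ι : Type*} {E : Set (ι → U)}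
    (hE : (Set.range (algebraMap k U)).Definable diffRing E) (g : ι → X.functionField) :
    φ.1 ∘ g ∈ E ↔ ψ.1 ∘ g ∈ E :=
  mem_definable_iff_of_ringHom hclosed hsat ((Cardinal.aleph0_le_mk k).trans_lt hk)
    φ.1.toRingHom ψ.1.toRingHom
    (fun p => (map_eq_zero φ.1.toRingHom).trans (map_eq_zero ψ.1.toRingHom).symm)
    (fun p => ⟨v.derivation p, φ.2 p, ψ.2 p⟩) (SmoothVariety.mk_functionField_lt hk)
    (by rintro _ ⟨c, rfl⟩; exact ⟨algebraMap k _ c, φ.1.commutes c, ψ.1.commutes c⟩) hE g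

lemma VectorField.DiffEmb.ofEmb_mem_iff [IsAlgClosed k] (hclosed : IsDifferentiallyClosed U)
    (hsat : IsSaturated U) (hk : #k < #U) (φ ψ : v.DiffEmb U) {D : Set (Point X U)}
    (hD : IsDefinable (Set.range (algebraMap k U)) D) :
    Point.ofEmb φ.1 ∈ D ↔ Point.ofEmb ψ.1 ∈ D := by
  obtain ⟨J, _, h, E, hE, hDE⟩ := hD.exists_definable
  rw [hDE, hDE]
  exact φ.mem_definable_iff hclosed hsat hk ψ hE h

theorem VectorField.IsSimple.existsUnique_isGenericType [CharZero k] [IsAlgClosed k]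
    (hv : v.IsSimple)
    (hconst : ∀ c : k, (algebraMap k U c)′ = 0) (hclosed : IsDifferentiallyClosed U)
    (hsat : IsSaturated U) (hk : #k < #U) (hdim : 2 ≤ topologicalKrullDim X.scheme) :
    ∃! p : CompleteType X (Set.range (algebraMap k U)), v.IsGenericType p := by
  obtain ⟨φ⟩ := v.nonempty_diffEmb hconst hclosed hsat hk
  refine ⟨typeOf _ (Point.ofEmb φ.1), ⟨_, mem_realizations_typeOf _, v.ofEmb_mem_solutions φ,
    v.trdeg_ofEmb φ⟩, ?_⟩
  rintro p ⟨x, hxp, hx, hxd⟩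
  obtain ⟨ψ, rfl⟩ := hv.exists_ofEmb_of_trdeg hconst hdim hx hxd
  rw [p.eq_typeOf hxp]
  refine CompleteType.sets_injective (Set.ext fun D => and_congr_right fun hD => ?_)
  exact ψ.ofEmb_mem_iff hclosed hsat hk φ hD

/-- The solution set and every nonempty open set belong to `p`, so a realization is a generic
solution; conversely all generic solutions have the same type. -/
theorem VectorField.IsSimple.realizations_eq [IsAlgClosed k] (hv : v.IsSimple)
    (hconst : ∀ c : k, (algebraMap k U c)′ = 0) (hclosed : IsDifferentiallyClosed U)
    (hsat : IsSaturated U) (hk : #k < #U) (hdim : 2 ≤ topologicalKrullDim X.scheme)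
    {p : CompleteType X (Set.range (algebraMap k U))} (hp : v.IsGenericType p) :
    p.realizations = Set.range fun φ : v.DiffEmb U => Point.ofEmb φ.1 := by
  obtain ⟨x, hxp, hx, hxd⟩ := hp
  obtain ⟨φ, rfl⟩ := hv.exists_ofEmb_of_trdeg hconst hdim hx hxd
  have hmem := fun {D} => p.mem_sets_iff hxp (D := D)
  ext y
  constructor
  · intro hy
    refine v.exists_ofEmb (hy _ ((hmem (v.isDefinable_solutions hconst _)).2 hx))
      (Point.pt_eq_generic fun V hV => hy _ ((hmem (isDefinable_mem V)).2 ?_))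
    change (Point.ofEmb φ.1).pt ∈ V
    rwa [Point.pt_ofEmb]
  · rintro ⟨ψ, rfl⟩ D hD
    exact (φ.ofEmb_mem_iff hclosed hsat hk ψ (p.definable D hD)).1 (hxp D hD)

theorem VectorField.IsSimple.solutions_eq [IsAlgClosed k] (hv : v.IsSimple)
    (hconst : ∀ c : k, (algebraMap k U c)′ = 0) :
    v.solutions U = Point.extend U '' v.sing ∪ Set.range fun φ : v.DiffEmb U => Point.ofEmb φ.1 := by
  ext x
  constructor
  · intro hx
    exact (hv.generic_or_mem_sing hconst hx).symm.imp id (v.exists_ofEmb hx)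
  · rintro (⟨y, hy, rfl⟩ | ⟨φ, rfl⟩)
    · exact v.extend_mem_solutions hconst hy
    · exact v.ofEmb_mem_solutions φ

end Generic

/-! ### Strong minimality -/

section StronglyMinimal

variable {k : Type u} [Field k] {X : SmoothVariety k} {U : Type u} [Field U] [Differential U]
  [Algebra k U] {v : VectorField X}

lemma SameType.symm {A : Set U} {m : ℕ} {b c : Fin m → U} (h : SameType A b c) : SameType A c b :=
  fun E hE => (h E hE).symm

lemma VectorField.IsSimple.infinite_diffEmb [IsAlgClosed k] (hv : v.IsSimple)
    (hconst : ∀ c : k, (algebraMap k U c)′ = 0) (hdim : 2 ≤ topologicalKrullDim X.scheme)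
    {D : Set (Point X U)} (hD : D ⊆ v.solutions U) (hinf : D.Infinite) :
    {φ : v.DiffEmb U | Point.ofEmb φ.1 ∈ D}.Infinite := fun hfin => hinf <|
  (((hv.finite_sing hdim).image (Point.extend U)).union
    (hfin.image fun φ => Point.ofEmb φ.1)).subset fun x hx => by
  rcases (hv.solutions_eq hconst).subset (hD hx) with h | ⟨φ, rfl⟩
  · exact Or.inl h
  · exact Or.inr ⟨φ, hx, rfl⟩

lemma VectorField.DiffEmb.ofEmb_injective :
    Function.Injective fun φ : v.DiffEmb U => Point.ofEmb φ.1 := fun _ _ h =>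
  Subtype.ext (Point.ofEmb_injective h)

/-- A partial embedding sending `c` to `b` carries any finite number of generic solutions outside
the fibre over `c` injectively to generic solutions outside the fibre over `b`. -/
lemma VectorField.infinite_of_sameType (hconst : ∀ c : k, (algebraMap k U c)′ = 0)
    (hclosed : IsDifferentiallyClosed U) (hsat : IsSaturated U) (hU : ℵ₀ < #U) (hk : #k < #U)
    {m : ℕ} {R : Set (Point X U × (Fin m → U))}
    (hR : IsDefinableRel (Set.range (algebraMap k U)) R) {b c : Fin m → U}
    (h : SameType (Set.range (algebraMap k U)) c b)
    (hinf : {φ : v.DiffEmb U | (Point.ofEmb φ.1, c) ∉ R}.Infinite) :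
    {φ : v.DiffEmb U | (Point.ofEmb φ.1, b) ∉ R}.Infinite := by
  classical
  obtain ⟨n, t, ht⟩ := X.exists_adjoin_eq_top
  obtain ⟨E, hE, hRE⟩ := hR.exists_definable_generators ht Set.mem_range_self
  intro hfin
  obtain ⟨s, hs, hcard⟩ := hinf.exists_subset_card_eq (hfin.toFinset.card + 1)
  obtain ⟨e₀, he₀, he₀'⟩ := h.exists_partialEmb hconst hU hk
  obtain ⟨e, hee, he⟩ := e₀.exists_extension_finset hclosed hsat hU
    (s.biUnion fun φ => Finset.univ.image fun i => φ.1 (t i))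
  have hek : ∀ c, ∃ h : algebraMap k U c ∈ e.dom, e.hom ⟨_, h⟩ = algebraMap k U c := fun c => by
    obtain ⟨h1, h2⟩ := he₀ c
    obtain ⟨h3, h4⟩ := hee ⟨_, h1⟩
    exact ⟨h3, h4.trans h2⟩
  have hcb : ∀ i, ∃ h : c i ∈ e.dom, e.hom ⟨_, h⟩ = b i := fun i => by
    obtain ⟨h1, h2⟩ := he₀' i
    obtain ⟨h3, h4⟩ := hee ⟨_, h1⟩
    exact ⟨h3, h4.trans h2⟩
  have hcomp : ∀ φ : s, ∃ ψ : v.DiffEmb U, ∀ g, ∃ h : φ.1.1 g ∈ e.dom, e.hom ⟨_, h⟩ = ψ.1 g :=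
    fun φ => φ.1.exists_comp ht e hek fun i => he _ (Finset.mem_biUnion.2
      ⟨φ, φ.2, Finset.mem_image_of_mem _ (Finset.mem_univ i)⟩)
  choose ψ hψ hψ' using hcomp
  have hinj : Function.Injective ψ := fun φ₁ φ₂ h12 => by
    refine Subtype.ext (Subtype.ext (AlgHom.ext fun g => ?_))
    have h1 := hψ' φ₁ g
    rw [h12, ← hψ' φ₂ g] at h1
    exact congrArg Subtype.val (e.hom.injective h1)
  choose hc hcb using hcb
  have hmem : ∀ φ, ψ φ ∈ hfin.toFinset := fun φ => by
    rw [Set.Finite.mem_toFinset, Set.mem_ofPred_eq, hRE]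
    have h1 : (Point.ofEmb φ.1.1, c) ∉ R := hs φ.2
    rw [hRE] at h1
    have h2 := e.mem_definable_iff hclosed hsat hU
      (by rintro _ ⟨a, rfl⟩; exact hek a) hE
      (Sum.elim (fun i => ⟨_, hψ φ (t i)⟩) fun i => ⟨_, hc i⟩)
    have h3 : (fun i => ((Sum.elim (fun i => (⟨_, hψ φ (t i)⟩ : e.dom))
        (fun i => ⟨_, hc i⟩) i : e.dom) : U)) = Sum.elim (φ.1.1 ∘ t) c := by
      ext (i | i) <;> rfl
    have h4 : (fun i => e.hom (Sum.elim (fun i => (⟨_, hψ φ (t i)⟩ : e.dom))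
        (fun i => ⟨_, hc i⟩) i)) = Sum.elim ((ψ φ).1 ∘ t) b := by
      ext (i | i)
      · exact hψ' φ (t i)
      · exact hcb i
    rw [h3, h4] at h2
    exact fun h5 => h1 (h2.2 h5)
  have h1 := Finset.card_le_card_of_injOn (s := Finset.univ) ψ (fun φ _ => hmem φ) hinj.injOn
  rw [Finset.card_univ, Fintype.card_coe, hcard] at h1
  omega

/-- Otherwise strong minimality makes the fibre over `b` cofinite in the solution set, and
conjugation does the same for the fibres over all `c j`; any `r` of these would then have a common
point. -/
lemma VectorField.IsSimple.finite_of_divides [IsAlgClosed k] (hv : v.IsSimple)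
    (hconst : ∀ c : k, (algebraMap k U c)′ = 0) (hclosed : IsDifferentiallyClosed U)
    (hsat : IsSaturated U) (hk : #k < #U) (hdim : 2 ≤ topologicalKrullDim X.scheme)
    (hS : IsStronglyMinimal (v.solutions U)) {F : Set (Point X U)}
    (hF : Divides (Set.range (algebraMap k U)) F) : (F ∩ v.solutions U).Finite := by
  have hU : ℵ₀ < #U := (Cardinal.aleph0_le_mk k).trans_lt hk
  obtain ⟨m, R, b, hR, rfl, c, r, hc, hr⟩ := hF
  have hfib : ∀ d : Fin m → U, IsDefinable (Set.univ : Set U) {x : Point X U | (x, d) ∈ R} := fun d =>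
    hR.isDefinable_fiber (Set.subset_univ _) fun _ => trivial
  rcases hS.2.2 _ Set.inter_subset_right ((hfib b).inter hS.1) with h | h
  · exact h
  have hb : {φ : v.DiffEmb U | (Point.ofEmb φ.1, b) ∉ R}.Finite :=
    Set.Finite.of_finite_image (h.subset (by
      rintro _ ⟨φ, hφ, rfl⟩
      exact ⟨v.ofEmb_mem_solutions φ, fun h' => hφ h'.1⟩))
      (VectorField.DiffEmb.ofEmb_injective).injOn
  have hcj : ∀ j, (v.solutions U \ {x | (x, c j) ∈ R}).Finite := fun j => by
    by_contra hinf
    refine v.infinite_of_sameType hconst hclosed hsat hU hk hR (hc j).symm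
      (fun hfin => ?_) hb
    exact hv.infinite_diffEmb hconst hdim Set.sdiff_subset hinf (hfin.subset fun φ hφ => hφ.2)
  exfalso
  have hfin : (⋃ j ∈ Finset.range r, v.solutions U \ {x | (x, c j) ∈ R}).Finite :=
    Set.Finite.biUnion (Finset.range r).finite_toSet fun j _ => hcj j
  obtain ⟨x, hx, hx'⟩ := hS.2.1.exists_notMem_finite hfin
  have : x ∈ ⋂ j ∈ Finset.range r, {x | (x, c j) ∈ R} := by
    simp only [Set.mem_iInter]
    intro j hj
    by_contra h'
    exact hx' (Set.mem_biUnion hj ⟨hx, h'⟩)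
  rw [hr _ (Finset.card_range r)] at this
  exact this

theorem VectorField.IsSimple.isMinimal_of_isStronglyMinimal [IsAlgClosed k] (hv : v.IsSimple)
    (hconst : ∀ c : k, (algebraMap k U c)′ = 0) (hclosed : IsDifferentiallyClosed U)
    (hsat : IsSaturated U) (hk : #k < #U) (hdim : 2 ≤ topologicalKrullDim X.scheme)
    {p : CompleteType X (Set.range (algebraMap k U))} (hp : v.IsGenericType p)
    (hS : IsStronglyMinimal (v.solutions U)) : p.IsMinimal := by
  have hreal := hv.realizations_eq hconst hclosed hsat hk hdim hp
  refine ⟨?_, fun B hB _ q hpq => ?_⟩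
  · rintro ⟨D, hD, hfin⟩
    refine hS.2.1 ?_
    rw [hv.solutions_eq hconst, ← hreal]
    exact ((hv.finite_sing hdim).image _).union (hfin.subset fun x hx => hx D hD)
  · rintro ⟨D, hD, N, F, hF, hDF⟩
    obtain ⟨x, hxp, hx, -⟩ := hp
    refine ⟨D ∩ v.solutions U, q.inter_mem _ hD _ (hpq ((p.mem_sets_iff hxp
      (v.isDefinable_solutions hconst _)).2 hx)), ?_⟩
    refine (Set.finite_iUnion fun i => hv.finite_of_divides hconst hclosed hsat hk hdim hS
      (hF i)).subset fun x hx => ?_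
    obtain ⟨i, hi⟩ := Set.mem_iUnion.1 (hDF hx.1)
    exact Set.mem_iUnion.2 ⟨i, hi, hx.2⟩

/-- A definable set containing infinitely many generic solutions contains one whose type is not
algebraic. -/
lemma VectorField.exists_not_isAlgebraic [IsAlgClosed k]
    (hconst : ∀ c : k, (algebraMap k U c)′ = 0) (hclosed : IsDifferentiallyClosed U)
    (hsat : IsSaturated U) (hk : #k < #U) {B : Set U}
    (hB : ∀ c, algebraMap k U c ∈ B) (hBU : #B < #U) {D : Set (Point X U)} (hD : IsDefinable B D)
    (hinf : {φ : v.DiffEmb U | Point.ofEmb φ.1 ∈ D}.Infinite) :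
    ∃ φ : v.DiffEmb U, Point.ofEmb φ.1 ∈ D ∧ ¬ (typeOf B (Point.ofEmb φ.1)).IsAlgebraic := by
  classical
  have hU : ℵ₀ < #U := (Cardinal.aleph0_le_mk k).trans_lt hk
  obtain ⟨n, t, ht⟩ := X.exists_adjoin_eq_top
  -- These sets contain the coordinates of all but finitely many generic solutions in `D`, so
  -- finitely many of them always meet, and saturation gives a common point `w`.
  let κ := {E : Set (Fin n → U) // B.Definable diffRing E ∧
    {φ : v.DiffEmb U | Point.ofEmb φ.1 ∈ D ∧ φ.1 ∘ t ∉ E}.Finite}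
  obtain ⟨w, hw⟩ := hsat.exists_forall_mem hBU (fun E : κ => E.1) (fun E => E.2.1) fun T => by
    have hfin : (⋃ E ∈ T, {φ : v.DiffEmb U | Point.ofEmb φ.1 ∈ D ∧ φ.1 ∘ t ∉ E.1}).Finite :=
      Set.Finite.biUnion T.finite_toSet fun E _ => E.2.2
    obtain ⟨φ, hφ, hφ'⟩ := hinf.exists_notMem_finite hfin
    exact ⟨φ.1 ∘ t, fun E hE => by_contra fun h => hφ' (Set.mem_biUnion hE ⟨hφ, h⟩)⟩
  obtain ⟨φ₀, -⟩ := hinf.nonempty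
  have hkB : Set.range (algebraMap k U) ⊆ B := by rintro _ ⟨c, rfl⟩; exact hB c
  -- A set definable over `k` holds of the coordinates of all generic solutions or of none. Hence
  -- `w` has their type over `k`, and it is itself the coordinate tuple of a generic solution.
  have hall : ∀ E : Set (Fin n → U), (Set.range (algebraMap k U)).Definable diffRing E →
      φ₀.1 ∘ t ∈ E → w ∈ E := fun E hE h => by
    refine hw ⟨E, hE.mono hkB, ?_⟩
    convert Set.finite_empty
    refine Set.eq_empty_of_forall_notMem fun φ hφ => hφ.2 ?_
    exact (φ₀.mem_definable_iff hclosed hsat hk φ hE t).1 h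
  have hsame : SameType (Set.range (algebraMap k U)) (φ₀.1 ∘ t) w := fun E hE =>
    ⟨hall E hE, fun h => by_contra fun h' => hall _ hE.compl h' h⟩
  obtain ⟨e, hek, het⟩ := hsame.exists_partialEmb hconst hU hk
  obtain ⟨φ, hφ⟩ := φ₀.exists_comp ht e hek fun i => (het i).1
  have hφw : φ.1 ∘ t = w := funext fun i => by
    obtain ⟨h1, h2⟩ := hφ (t i)
    exact h2.symm.trans (het i).2
  obtain ⟨E, hE, hDE⟩ := hD.exists_definable_generators ht hB
  refine ⟨φ, ?_, ?_⟩
  · rw [hDE, hφw]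
    refine hw ⟨E, hE, ?_⟩
    convert Set.finite_empty
    exact Set.eq_empty_of_forall_notMem fun φ hφ => hφ.2 ((hDE _).1 hφ.1)
  · rintro ⟨D', ⟨hD', hφD'⟩, hfin⟩
    obtain ⟨E', hE', hDE'⟩ := hD'.exists_definable_generators ht hB
    rw [hDE', hφw] at hφD'
    -- A finite `D'` contains only finitely many generic solutions, so the complement of `E'` is one
    -- of the sets that contain `w`.
    refine hw ⟨E'ᶜ, hE'.compl, ?_⟩ hφD'
    refine Set.Finite.of_finite_image (hfin.subset ?_) (VectorField.DiffEmb.ofEmb_injective).injOn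
    rintro _ ⟨ψ, ⟨-, hψ⟩, rfl⟩
    exact (hDE' _).2 (not_not.1 hψ)

/-- Linear relations on generic solutions yield dividing. -/
lemma divides_of_sum_eq_zero [IsAlgClosed k]
    (hconst : ∀ c : k, (algebraMap k U c)′ = 0) (hclosed : IsDifferentiallyClosed U)
    (hsat : IsSaturated U) (hk : #k < #U) {n : ℕ} {b : Fin n → U} (hb : LinearIndependent k b)
    (V : X.scheme.Opens) (f : Fin n → Γ(X.scheme, V)) (i₀ : Fin n) :
    Divides (Set.range (algebraMap k U)) {x : Point X U | ∃ hx : x.pt ∈ V,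
      x.eval V hx (f i₀) ≠ 0 ∧ ∑ i, b i * x.eval V hx (f i) = 0} := by
  obtain ⟨c, hc, hind⟩ := exists_seq_sameType hclosed hsat hconst
    ((Cardinal.aleph0_le_mk k).trans_lt hk) hk b hb
  refine ⟨n, {q | ∃ hx : q.1.pt ∈ V, q.1.eval V hx (f i₀) ≠ 0 ∧
    ∑ i, q.2 i * q.1.eval V hx (f i) = 0}, b, ?_, rfl, c, n, hc, fun s hs => ?_⟩
  · refine IsDefinableRel.of_piece V f (E := {w | w (Sum.inl i₀) = 0}ᶜ ∩
      {w | ∑ i, w (Sum.inr i) * w (Sum.inl i) = 0}) (Set.Definable.inter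
        (Set.DefinableFun.ofPred_eq (.proj diffRing) definableFun_zero).compl
        (Set.DefinableFun.ofPred_eq (definableFun_sum _ fun i =>
          definableFun_mul (.proj diffRing) (.proj diffRing)) definableFun_zero)) fun x d => Iff.rfl
  · refine Set.eq_empty_of_forall_notMem fun x hx => ?_
    simp only [Set.mem_iInter, Set.mem_ofPred_eq] at hx
    have hn : 0 < s.card := by rw [hs]; exact i₀.pos
    obtain ⟨j₀, hj₀⟩ := Finset.card_pos.1 hn
    obtain ⟨hxV, h0, -⟩ := hx j₀ hj₀
    -- The `n` conjugates span `U^n`, so the linear form with coefficients `f i (x)` that kills them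
    -- is zero, against `f i₀ (x) ≠ 0`.
    have hspan := (hind s hs.le).span_eq_top_of_card_eq_finrank' (by simp [hs])
    let ℓ : (Fin n → U) →ₗ[U] U := ∑ i, x.eval V hxV (f i) • LinearMap.proj i
    have hℓ : ∀ d, ℓ d = ∑ i, d i * x.eval V hxV (f i) := fun d => by
      simp [ℓ, mul_comm]
    have hℓ0 : ℓ = 0 := by
      refine LinearMap.ext_on_range (v := fun i : s => c i) hspan fun j => ?_
      rw [hℓ]
      exact (hx j j.2).2.2
    have h1 := hℓ (Pi.single i₀ 1)
    rw [hℓ0] at h1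
    exact h0 (by simpa [Pi.single_apply] using h1.symm)

/-- A nontrivial relation would put a set dividing over `k` into the type over `B`, which would then
be algebraic by minimality. -/
lemma CompleteType.IsMinimal.eq_zero_of_sum_eq_zero [IsAlgClosed k]
    (hconst : ∀ c : k, (algebraMap k U c)′ = 0) (hclosed : IsDifferentiallyClosed U)
    (hsat : IsSaturated U) (hk : #k < #U) {φ : v.DiffEmb U}
    (hp : (typeOf (Set.range (algebraMap k U)) (Point.ofEmb φ.1)).IsMinimal) {B : Set U}
    (hB : ∀ c, algebraMap k U c ∈ B) (hBU : #B < #U)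
    (hφ : ¬ (typeOf B (Point.ofEmb φ.1)).IsAlgebraic) {n : ℕ} {b : Fin n → U}
    (hb : LinearIndependent k b) (hbB : ∀ i, b i ∈ B) (g : Fin n → X.functionField)
    (h : ∑ i, b i * φ.1 (g i) = 0) : g = 0 := by
  by_contra hg
  obtain ⟨i₀, hi₀⟩ := Function.ne_iff.1 hg
  have hkB : Set.range (algebraMap k U) ⊆ B := by rintro _ ⟨c, rfl⟩; exact hB c
  obtain ⟨V, hV, f, hf⟩ := X.exists_germ_of_finite g
  have hx : (Point.ofEmb φ.1).pt ∈ V := (Point.pt_ofEmb φ.1).symm ▸ hV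
  have heval : ∀ i, (Point.ofEmb φ.1).eval V hx (f i) = φ.1 (g i) := fun i => by
    rw [Point.eval_ofEmb φ.1 V hx hV, hf]
  let D : Set (Point X U) := {x | ∃ hx : x.pt ∈ V,
    x.eval V hx (f i₀) ≠ 0 ∧ ∑ i, b i * x.eval V hx (f i) = 0}
  have hD : IsDefinable B D := by
    refine IsDefinableRel.of_piece V f (E := {w | w (Sum.inl i₀) = 0}ᶜ ∩
      {w | ∑ i, b i * w (Sum.inl i) = 0}) (Set.Definable.inter
        (Set.DefinableFun.ofPred_eq (.proj diffRing) definableFun_zero).compl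
        (Set.DefinableFun.ofPred_eq (definableFun_sum _ fun i =>
          definableFun_mul (definableFun_const (hbB i)) (.proj diffRing)) definableFun_zero))
      fun x d => Iff.rfl
  have hxD : Point.ofEmb φ.1 ∈ D := by
    refine ⟨hx, ?_⟩
    simp only [heval]
    exact ⟨fun h0 => hi₀ ((map_eq_zero φ.1).1 h0), h⟩
  exact hφ (hp.2 B hkB hBU (typeOf B (Point.ofEmb φ.1)) (fun D hD => ⟨hD.1.mono hkB, hD.2⟩)
    ⟨D, ⟨hD, hxD⟩, 1, fun _ => D,
    fun _ => divides_of_sum_eq_zero hconst hclosed hsat hk hb V f i₀, fun x hx =>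
      Set.mem_iUnion.2 ⟨0, hx⟩⟩)

end StronglyMinimal

/-! ### Minimality of the generic type implies strong minimality -/

section Minimal

open scoped TensorProduct

lemma mk_tensorProduct_lt {k L K U : Type u} [Field k] [Field L] [Field K] [Algebra k L]
    [Algebra k K] (hU : ℵ₀ < #U) (hL : #L < #U) (hK : #K < #U) : #(L ⊗[k] K) < #U := by
  have hsurj : Function.Surjective fun s : List (L × K) => (s.map fun p => p.1 ⊗ₜ[k] p.2).sum :=
    fun x => by
      induction x using TensorProduct.induction_on with
      | zero => exact ⟨[], rfl⟩
      | tmul a b => exact ⟨[(a, b)], by simp⟩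
      | add x y hx hy =>
        obtain ⟨s, rfl⟩ := hx
        obtain ⟨s', rfl⟩ := hy
        exact ⟨s ++ s', by simp⟩
  refine (Cardinal.mk_le_of_surjective hsurj).trans_lt
    ((Cardinal.mk_list_le_max _).trans_lt (max_lt hU ?_))
  rw [← Cardinal.mul_def]
  exact Cardinal.mul_lt_of_lt hU.le hL hK

variable {k : Type u} [Field k] {X : SmoothVariety k} {U : Type u} [Field U] [Differential U]
  [Algebra k U] {v : VectorField X}

/-- The map `L ⊗ k(X) → U` given by a generic solution. -/
def VectorField.DiffEmb.lift (φ : v.DiffEmb U) (L : IntermediateField k U) :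
    L ⊗[k] X.functionField →ₐ[k] U :=
  Algebra.TensorProduct.productMap L.val φ.1

lemma VectorField.DiffEmb.lift_tmul (φ : v.DiffEmb U) (L : IntermediateField k U) (a : L)
    (g : X.functionField) : φ.lift L (a ⊗ₜ g) = a * φ.1 g :=
  Algebra.TensorProduct.productMap_apply_tmul _ _ _ _

/-- The hypothesis is linear disjointness of `L` and the image of `φ` over `k`; writing a tensor in
a `k`-basis of `L` turns it into injectivity. -/
lemma VectorField.DiffEmb.lift_eq_zero_iff (φ : v.DiffEmb U) (L : IntermediateField k U)
    (h : ∀ (n : ℕ) (b : Fin n → U), LinearIndependent k b → (∀ i, b i ∈ L) →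
      ∀ g : Fin n → X.functionField, ∑ i, b i * φ.1 (g i) = 0 → g = 0)
    (x : L ⊗[k] X.functionField) : φ.lift L x = 0 ↔ x = 0 := by
  refine ⟨fun hx => ?_, fun hx => by rw [hx, map_zero]⟩
  let ℬ := Module.Free.chooseBasis k L
  obtain ⟨c, rfl⟩ := TensorProduct.eq_repr_basis_left ℬ x
  let e := c.support.equivFin.symm
  have hli : LinearIndependent k fun i => ((ℬ (e i) : L) : U) :=
    (ℬ.linearIndependent.map' L.val.toLinearMap (LinearMap.ker_eq_bot.2 L.val.injective)).comp
      (fun i => (e i : _)) (Subtype.val_injective.comp e.injective)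
  have hsum : ∀ {M : Type u} [AddCommMonoid M] (F : Module.Free.ChooseBasisIndex k L → M),
      ∑ i, F (e i) = ∑ j ∈ c.support, F j := fun F => by
    rw [Equiv.sum_comp e (fun j => F j), Finset.sum_coe_sort c.support F]
  have h1 := h _ _ hli (fun i => (ℬ (e i)).2) (fun i => c (e i)) (by
    rw [hsum fun j => ((ℬ j : L) : U) * φ.1 (c j)]
    rw [Finsupp.sum, map_sum] at hx
    simpa only [φ.lift_tmul] using hx)
  refine Finset.sum_eq_zero fun j hj => ?_
  have h2 := congrFun h1 (e.symm ⟨j, hj⟩)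
  simp only [Equiv.apply_symm_apply, Pi.zero_apply] at h2
  rw [h2]
  exact TensorProduct.tmul_zero _ _

lemma VectorField.DiffEmb.exists_deriv_lift (φ ψ : v.DiffEmb U) (L : IntermediateField k U)
    (hL : ∀ a ∈ L, a′ ∈ L) (x : L ⊗[k] X.functionField) :
    ∃ y, (φ.lift L x)′ = φ.lift L y ∧ (ψ.lift L x)′ = ψ.lift L y := by
  induction x using TensorProduct.induction_on with
  | zero => exact ⟨0, by simp⟩
  | tmul a g =>
    refine ⟨a ⊗ₜ v.derivation g + ⟨(a : U)′, hL a a.2⟩ ⊗ₜ g, ?_, ?_⟩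
    · rw [map_add, φ.lift_tmul, φ.lift_tmul, φ.lift_tmul, Derivation.leibniz, φ.2, smul_eq_mul,
        smul_eq_mul, mul_comm (φ.1 g)]
    · rw [map_add, ψ.lift_tmul, ψ.lift_tmul, ψ.lift_tmul, Derivation.leibniz, ψ.2, smul_eq_mul,
        smul_eq_mul, mul_comm (ψ.1 g)]
  | add x y hx hy =>
    obtain ⟨x', h1, h2⟩ := hx
    obtain ⟨y', h3, h4⟩ := hy
    exact ⟨x' + y', by simp only [map_add, h1, h3], by simp only [map_add, h2, h4]⟩

/-- When both lifts are injective, they embed the same differential ring `L ⊗[k] k(X)` and fix `L`,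
so the two solutions have the same type over `L`. -/
lemma VectorField.DiffEmb.ofEmb_mem_iff_of_injective [IsAlgClosed k]
    (hclosed : IsDifferentiallyClosed U) (hsat : IsSaturated U) (hk : #k < #U) (φ ψ : v.DiffEmb U)
    (L : IntermediateField k U) (hL : ∀ a ∈ L, a′ ∈ L) (hLU : #L < #U)
    (hφ : ∀ x, φ.lift L x = 0 ↔ x = 0) (hψ : ∀ x, ψ.lift L x = 0 ↔ x = 0) {D : Set (Point X U)}
    (hD : IsDefinable (L : Set U) D) : Point.ofEmb φ.1 ∈ D ↔ Point.ofEmb ψ.1 ∈ D := by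
  have hU : ℵ₀ < #U := (Cardinal.aleph0_le_mk k).trans_lt hk
  obtain ⟨J, _, h, E, hE, hDE⟩ := hD.exists_definable
  have hval : ∀ χ : v.DiffEmb U, (fun j => χ.lift L (1 ⊗ₜ h j)) = χ.1 ∘ h := fun χ =>
    funext fun j => (χ.lift_tmul L _ _).trans (one_mul _)
  have hval' : ∀ (χ : v.DiffEmb U) (a : L), χ.lift L (a ⊗ₜ 1) = a := fun χ a =>
    (χ.lift_tmul L _ _).trans (by rw [map_one, mul_one])
  rw [hDE, hDE, ← hval, ← hval]
  have hcard : #(L ⊗[k] X.functionField) < #U :=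
    mk_tensorProduct_lt hU hLU (SmoothVariety.mk_functionField_lt hk)
  have hker : ∀ x, φ.lift L x = 0 ↔ ψ.lift L x = 0 := fun x => (hφ x).trans (hψ x).symm
  exact mem_definable_iff_of_ringHom hclosed hsat hU (φ.lift L : _ →+* U) (ψ.lift L : _ →+* U)
    hker (φ.exists_deriv_lift ψ L hL) hcard
    (fun a ha => ⟨(⟨a, ha⟩ : L) ⊗ₜ 1, hval' φ _, hval' ψ _⟩) hE fun j => 1 ⊗ₜ h j

lemma IsDefinable.exists_finset {D : Set (Point X U)} (hD : IsDefinable (Set.univ : Set U) D) :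
    ∃ A : Finset U, IsDefinable (A : Set U) D := by
  classical
  obtain ⟨r, V, N, f, E, hE, hR⟩ := hD
  choose A _ hA using fun i => Set.definable_iff_finitely_definable.1 (hE i)
  exact ⟨Finset.univ.biUnion A, r, V, N, f, E, fun i => (hA i).mono (by
    exact_mod_cast Finset.subset_biUnion_of_mem A (Finset.mem_univ i)), hR⟩

theorem VectorField.IsSimple.isStronglyMinimal_of_isMinimal [IsAlgClosed k] (hv : v.IsSimple)
    (hconst : ∀ c : k, (algebraMap k U c)′ = 0) (hclosed : IsDifferentiallyClosed U)
    (hsat : IsSaturated U) (hk : #k < #U) (hdim : 2 ≤ topologicalKrullDim X.scheme)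
    {p : CompleteType X (Set.range (algebraMap k U))} (hp : v.IsGenericType p)
    (hmin : p.IsMinimal) : IsStronglyMinimal (v.solutions U) := by
  classical
  have hU : ℵ₀ < #U := (Cardinal.aleph0_le_mk k).trans_lt hk
  refine ⟨v.isDefinable_solutions hconst _, fun hfin => ?_, fun D hDS hD => ?_⟩
  · obtain ⟨x, hxp, hx, -⟩ := hp
    exact hmin.1 ⟨_, (p.mem_sets_iff hxp (v.isDefinable_solutions hconst _)).2 hx, hfin⟩
  by_contra! hinf
  have hreal := hv.realizations_eq hconst hclosed hsat hk hdim hp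
  obtain ⟨A₀, hDA⟩ := hD.exists_finset
  obtain ⟨L₀, hL₀, hSL, hLU⟩ := exists_differential_subfield hU
    (Set.range (algebraMap k U) ∪ A₀) (by
      refine (Cardinal.mk_union_le _ _).trans_lt (Cardinal.add_lt_of_lt hU.le
        (Cardinal.mk_range_le.trans_lt hk) ?_)
      exact (Cardinal.mk_lt_aleph0 (α := A₀)).trans hU)
  let L : IntermediateField k U :=
    { L₀ with algebraMap_mem' := fun c => hSL (Or.inl ⟨c, rfl⟩) }
  have hkL : ∀ c, algebraMap k U c ∈ (L : Set U) := L.algebraMap_mem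
  have hDL : IsDefinable (L : Set U) D := hDA.mono fun a ha => hSL (Or.inr ha)
  have hinf₁ := hv.infinite_diffEmb hconst hdim hDS hinf.1
  have hinf₂ := (hv.infinite_diffEmb hconst hdim Set.sdiff_subset hinf.2).mono
    (t := {φ : v.DiffEmb U | Point.ofEmb φ.1 ∈ Dᶜ}) fun φ hφ => hφ.2
  -- One generic solution in `D` and one outside are chosen with types over `L` that are not
  -- algebraic; minimality makes both lifts injective, so `D` cannot separate them.
  obtain ⟨φ, hφD, hφ⟩ := v.exists_not_isAlgebraic hconst hclosed hsat hk hkL hLU hDL hinf₁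
  obtain ⟨ψ, hψD, hψ⟩ := v.exists_not_isAlgebraic hconst hclosed hsat hk hkL hLU hDL.compl hinf₂
  have hker : ∀ χ : v.DiffEmb U, ¬ (typeOf (L : Set U) (Point.ofEmb χ.1)).IsAlgebraic →
      ∀ x, χ.lift L x = 0 ↔ x = 0 := fun χ hχ => χ.lift_eq_zero_iff L fun m b hb hbL g hg => by
    have hχp : Point.ofEmb χ.1 ∈ p.realizations := hreal ▸ ⟨χ, rfl⟩
    rw [p.eq_typeOf hχp] at hmin
    exact hmin.eq_zero_of_sum_eq_zero hconst hclosed hsat hk hkL hLU hχ hb hbL g hg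
  exact hψD ((φ.ofEmb_mem_iff_of_injective hclosed hsat hk ψ L hL₀ hLU (hker φ hφ) (hker ψ hψ)
    hDL).1 hφD)

end Minimal

end DiffAlg

end

theorem lemma5p1p1 {k U : Type u} [Field k] [IsAlgClosed k] [CharZero k]
    [Field U] [Differential U] [Algebra k U]
    (hconst : ∀ c : k, (algebraMap k U c)′ = 0)
    (hclosed : DiffAlg.IsDifferentiallyClosed U) (hsat : DiffAlg.IsSaturated U)
    (hsmall : Cardinal.mk k < Cardinal.mk U)
    (X : DiffAlg.SmoothVariety k) (v : DiffAlg.VectorField X)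
    (hdim : 2 ≤ topologicalKrullDim X.scheme)
    (hinv : ∀ Z : Set X.scheme, v.IsClosedInvariant Z → Z ≠ Set.univ →
      ¬ 0 < topologicalKrullDim Z) :
    v.sing.Finite ∧
    (∃! p : DiffAlg.CompleteType X (Set.range (algebraMap k U)), v.IsGenericType p) ∧
    ∀ p : DiffAlg.CompleteType X (Set.range (algebraMap k U)), v.IsGenericType p →
      v.solutions U = DiffAlg.Point.extend U '' v.sing ∪ p.realizations ∧
      (DiffAlg.IsStronglyMinimal (v.solutions U) ↔ p.IsMinimal) := by
  have hv : v.IsSimple := hinv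
  refine ⟨hv.finite_sing hdim,
    hv.existsUnique_isGenericType hconst hclosed hsat hsmall hdim, fun p hp => ⟨?_, ?_⟩⟩
  · rw [hv.realizations_eq hconst hclosed hsat hsmall hdim hp]
    exact hv.solutions_eq hconst
  · exact ⟨hv.isMinimal_of_isStronglyMinimal hconst hclosed hsat hsmall hdim hp,
      hv.isStronglyMinimal_of_isMinimal hconst hclosed hsat hsmall hdim hp⟩
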